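/- Let $\beta\in\mathbb{R}$ and $G>0$ be fixed. For $\varepsilon>0$ and $s\in\mathbb{R}$ let $$\mathfrak{F}_\varepsilon^s=\Big\{f:\mathbb{C}\to\mathbb{C}\ \text{entire}:\ \int_{\mathbb{C}}(1+|z|^2)^s|f(z)|^2e^{-|z|^2/\varepsilon}\,dz<\infty\Big\},$$ where $dz$ is Lebesgue measure on $\mathbb{C}\cong\mathbb{R}^2$, let $\mathfrak{F}_\varepsilon=\mathfrak{F}_\varepsilon^0$ with norm $\|f\|_{\mathfrak{F}_\varepsilon}=\big(\int_{\mathbb{C}}|f|^2e^{-|z|^2/\varepsilon}\,dz\big)^{1/2}$, and let $$\mathcal{F}^{\mathrm{LLL}}[f]=\int_{\mathbb{C}}\Big(\big(-\beta|z|^2+\tfrac14|z|^4\big)|f|^2e^{-|z|^2/\varepsilon}+\tfrac G2|f|^4e^{-2|z|^2/\varepsilon}\Big)dz$$ for $f\in\mathfrak{F}_\varepsilon^2$, and $\mathcal{F}^{\mathrm{LLL}}[f]=+\infty$ for $f\notin\mathfrak{F}_\varepsilon^2$. Consider the minimisation problem $$F^{\mathrm{LLL}}=\inf\big\{\mathcal{F}^{\mathrm{LLL}}[f]:\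 f\in\mathfrak{F}_\varepsilon^1,\ \|f\|_{\mathfrak{F}_\varepsilon}=1\big\}.$$ Then there is $\varepsilon_0>0$, depending only on $\beta$ and $G$, such that for every $0<\varepsilon<\varepsilon_0$ every minimiser $f$ of this problem (i.e. every $f\in\mathfrak{F}_\varepsilon^1$ with $\|f\|_{\mathfrak{F}_\varepsilon}=1$ and $\mathcal{F}^{\mathrm{LLL}}[f]=F^{\mathrm{LLL}}$) has infinitely many zeros in $\mathbb{C}$; in particular, no polynomial is a minimiser. -/

import Mathlib

open MeasureTheory

noncomputable section

/-- The Fock-Bargmann space `𝔉_ε`: entire functions `f` on `ℂ` with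
`∫ |f|² exp(-|z|²/ε) dz < ∞`, where `dz` is Lebesgue measure on `ℂ ≃ ℝ²`. -/
def Fock (ε : ℝ) : Set (ℂ → ℂ) :=
  {f | Differentiable ℂ f ∧
    Integrable (fun z : ℂ => ‖f z‖ ^ 2 * Real.exp (-‖z‖ ^ 2 / ε)) volume}

/-- The weighted Fock-Bargmann space `𝔉_ε^s`: entire functions `f` on `ℂ` with
`∫ (1 + |z|²)^s |f|² exp(-|z|²/ε) dz < ∞`. -/
def FockS (ε s : ℝ) : Set (ℂ → ℂ) :=
  {f | Differentiable ℂ f ∧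
    Integrable (fun z : ℂ =>
      (1 + ‖z‖ ^ 2) ^ s * ‖f z‖ ^ 2 * Real.exp (-‖z‖ ^ 2 / ε)) volume}

/-- The norm of the Hilbert space `𝔉_ε`. It is only meaningful on `Fock ε`. -/
def fockNorm (ε : ℝ) (f : ℂ → ℂ) : ℝ :=
  Real.sqrt (∫ z : ℂ, ‖f z‖ ^ 2 * Real.exp (-‖z‖ ^ 2 / ε))

open Classical in
/-- The lowest-Landau-level energy
`∫ ((-β|z|² + |z|⁴/4) |f|² exp(-|z|²/ε) + (G/2) |f|⁴ exp(-2|z|²/ε)) dz`,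
with the convention that it is `+∞` outside `𝔉_ε²`. -/
def energyLLL (β G ε : ℝ) (f : ℂ → ℂ) : EReal :=
  if f ∈ FockS ε 2 then
    ((∫ z : ℂ,
      ((-β * ‖z‖ ^ 2 + 1 / 4 * ‖z‖ ^ 4) * ‖f z‖ ^ 2 * Real.exp (-‖z‖ ^ 2 / ε)
        + G / 2 * ‖f z‖ ^ 4 * Real.exp (-2 * ‖z‖ ^ 2 / ε)) : ℝ) : EReal)
  else ⊤

/-- The admissible functions of the minimisation problem: `f ∈ 𝔉_ε¹` of unit mass. -/
def admissibleLLL (ε : ℝ) : Set (ℂ → ℂ) :=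
  {f | f ∈ FockS ε 1 ∧ f ∈ Fock ε ∧ fockNorm ε f = 1}

/-- The infimum of the energy over the admissible functions. -/
def infLLL (β G ε : ℝ) : EReal :=
  sInf (energyLLL β G ε '' admissibleLLL ε)

/-- `f` solves the minimisation problem: it is admissible and attains the infimum. -/
def IsMinimizerLLL (β G ε : ℝ) (f : ℂ → ℂ) : Prop :=
  f ∈ admissibleLLL ε ∧ energyLLL β G ε f = infLLL β G ε

end

open ComplexConjugate

/-! Suppose that a minimiser `f` has finitely many zeros, and put `κ = 1/ε`. Finite energy gives `f
∈ 𝔉_ε²`, hence `|f|² ≤ C exp(κ|z|²)`, and Hadamard factorisation yields `f = P exp(az² + bz)` with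
`P` a polynomial and `2|a| < κ`.

The Euler-Lagrange equation, tested on the kernels `exp(t̄w)`, becomes an identity in `t` between
two terms, each a polynomial times the exponential of a quadratic. The linear terms carry the
quadratic coefficient `a/κ²`, the interaction carries `2a/(4κ² - 8|a|²)`. For `a ≠ 0` these agree
only if `2|a| = κ`, so the linear part would vanish by itself; its degree `deg P + 4` forbids this
(`IsMinimizerLLL.quadratic_coeff_eq_zero`). So `a = 0`.

A magnetic translation then removes `exp(bz)` and leaves a polynomial `Q` with a shifted potential
(`IsMinimizerLLL.exists_translated_polynomial`). Comparing extreme coefficients in its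
Euler-Lagrange equation forces `Q` to be a monomial, with zero shift, or to have degree at most 3
(`PolynomialEulerLagrange.monomial_or_natDegree_le`).

Both cases cost too much energy when `ε` is small. A monomial lives on a ring of width about `√ε`,
and a polynomial of degree at most 3 on a disc of area about `ε`, so the interaction blows up
(`exists_monomial_energy_lt`, `quarticEnergy_lower_of_natDegree_le`), whereas a sum of monomials
with well-chosen signs has energy bounded independently of `ε` (`exists_trial`). -/

/-! ### Gaussian integrals, the mean value property and orthogonality of monomials. -/

theorem integrable_norm_pow_mul_exp_neg (n : ℕ) {κ : ℝ} (hκ : 0 < κ) :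
    Integrable (fun z : ℂ => ‖z‖ ^ n * Real.exp (-κ * ‖z‖ ^ 2)) := by
  -- A non-integrable function has integral 0 by convention, whereas the Gamma formula gives a
  -- positive value.
  by_contra h
  have h1 := Complex.integral_rpow_mul_exp_neg_mul_rpow (p := 2) (q := n) (b := κ)
    (by norm_num) (by have : (0:ℝ) ≤ n := by positivity
                      linarith) hκ
  simp only [Real.rpow_natCast, Real.rpow_two] at h1
  rw [integral_undef h] at h1
  have : 0 < Real.Gamma (((n:ℝ) + 2) / 2) := Real.Gamma_pos_of_pos (by positivity)
  have h2 : 0 < (2 * Real.pi / 2) * κ ^ (-((n:ℝ) + 2) / 2) * Real.Gamma (((n:ℝ) + 2) / 2) := by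
    positivity
  linarith

theorem integral_norm_sq_pow_mul_exp_neg (n : ℕ) {κ : ℝ} (hκ : 0 < κ) :
    ∫ z : ℂ, (‖z‖ ^ 2) ^ n * Real.exp (-κ * ‖z‖ ^ 2) = Real.pi * n.factorial / κ ^ (n + 1) := by
  have h1 := Complex.integral_rpow_mul_exp_neg_mul_rpow (p := 2) (q := ((2 * n : ℕ) : ℝ)) (b := κ)
    (by norm_num) (by have : (0:ℝ) ≤ ((2 * n : ℕ) : ℝ) := by positivity
                      linarith) hκ
  simp only [Real.rpow_natCast, Real.rpow_two] at h1
  simp only [← pow_mul]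
  rw [h1]
  have e1 : (((2 * n : ℕ) : ℝ) + 2) / 2 = (n : ℝ) + 1 := by push_cast; ring
  have e2 : -(((2 * n : ℕ) : ℝ) + 2) / 2 = -((n + 1 : ℕ) : ℝ) := by push_cast; ring
  rw [e1, e2, Real.Gamma_nat_eq_factorial, Real.rpow_neg hκ.le, Real.rpow_natCast]
  field_simp

theorem measurePreserving_rotation (u : Circle) :
    MeasurePreserving (fun z : ℂ => (u : ℂ) * z) volume volume :=
  (rotation u).measurePreserving

theorem integral_comp_rotation {E : Type*} [NormedAddCommGroup E] [NormedSpace ℝ E] (u : Circle)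
    (F : ℂ → E) : ∫ z, F ((u : ℂ) * z) = ∫ z, F z :=
  (measurePreserving_rotation u).integral_comp
    (rotation u).toHomeomorph.measurableEmbedding F

/-- The mean value property of entire functions against a radial weight. -/
theorem integral_radial_mul {ρ : ℝ → ℝ} (hρ : Continuous ρ) {g : ℂ → ℂ} (hg : Differentiable ℂ g)
    (hi : Integrable (fun z => (ρ ‖z‖ : ℂ) * g z)) :
    ∫ z, (ρ ‖z‖ : ℂ) * g z = (∫ z : ℂ, ρ ‖z‖ : ℝ) * g 0 := by
  set F : ℂ → ℂ := fun z => (ρ ‖z‖ : ℂ) * g z with hF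
  have hFc : Continuous F := by
    have := hg.continuous
    fun_prop
  have hrot : ∀ θ : ℝ, ∀ z, F ((Circle.exp θ : ℂ) * z)
      = (ρ ‖z‖ : ℂ) * g (Complex.exp (θ * Complex.I) * z) := by
    intro θ z
    simp [hF]
  have hcont : Continuous (fun p : ℝ × ℂ => F ((Circle.exp p.1 : ℂ) * p.2)) := by
    fun_prop
  have hprod : Integrable (fun p : ℝ × ℂ => F ((Circle.exp p.1 : ℂ) * p.2))
      ((volume.restrict (Set.uIoc 0 (2 * Real.pi))).prod volume) := by
    rw [integrable_prod_iff hcont.aestronglyMeasurable]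
    constructor
    · refine Filter.Eventually.of_forall fun θ => ?_
      exact (measurePreserving_rotation (Circle.exp θ)).integrable_comp_of_integrable hi
    · have : (fun θ : ℝ => ∫ z, ‖F ((Circle.exp θ : ℂ) * z)‖) = fun _ => ∫ z, ‖F z‖ := by
        ext θ
        exact integral_comp_rotation (Circle.exp θ) (fun z => ‖F z‖)
      simp only [this]
      exact integrableOn_const (by simp [ENNReal.mul_eq_top])
  have hcirc : ∀ z : ℂ, ∫ θ in (0:ℝ)..2 * Real.pi, g (Complex.exp (θ * Complex.I) * z)
      = (2 * Real.pi : ℝ) * g 0 := by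
    intro z
    have h1 : Real.circleAverage g 0 ‖z‖ = g 0 :=
      (hg.diffContOnCl).circleAverage
    -- Shifting the angle by `arg z` parametrises the circle by the rotations of `z` itself.
    rw [Real.circleAverage_eq_integral_add (Complex.arg z)] at h1
    have h2 : ∀ θ : ℝ, circleMap 0 ‖z‖ (θ + Complex.arg z) = Complex.exp (θ * Complex.I) * z := by
      intro θ
      conv_rhs => rw [← Complex.norm_mul_exp_arg_mul_I z]
      simp only [circleMap, zero_add]
      push_cast
      rw [add_mul, Complex.exp_add]
      ring
    simp only [h2] at h1
    rw [← h1, Complex.real_smul, ← mul_assoc, ← Complex.ofReal_mul, mul_inv_cancel₀ (by positivity)]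
    simp
  have h2pi : (0:ℝ) ≤ 2 * Real.pi := by positivity
  have key : ∫ θ in (0:ℝ)..2 * Real.pi, (∫ z, F ((Circle.exp θ : ℂ) * z))
      = ∫ z, ∫ θ in (0:ℝ)..2 * Real.pi, F ((Circle.exp θ : ℂ) * z) := by
    rw [Set.uIoc_of_le h2pi] at hprod
    simp only [intervalIntegral.integral_of_le h2pi]
    exact integral_integral_swap hprod
  have hleft : ∀ θ : ℝ, ∫ z, F ((Circle.exp θ : ℂ) * z) = ∫ z, F z :=
    fun θ => integral_comp_rotation (Circle.exp θ) F
  simp only [hleft] at key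
  simp only [hrot, intervalIntegral.integral_const_mul, hcirc] at key
  rw [intervalIntegral.integral_const, integral_mul_const, integral_complex_ofReal] at key
  simp only [sub_zero, Complex.real_smul] at key
  have hpi : ((2 * Real.pi : ℝ) : ℂ) ≠ 0 := by
    exact_mod_cast (by positivity : (2 * Real.pi) ≠ 0)
  apply mul_left_cancel₀ hpi
  rw [key]
  ring_nf

theorem integral_exp_neg_mul_entire {κ : ℝ} (hκ : 0 < κ) {g : ℂ → ℂ} (hg : Differentiable ℂ g)
    (hi : Integrable (fun z => (Real.exp (-κ * ‖z‖ ^ 2) : ℂ) * g z)) :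
    ∫ z, (Real.exp (-κ * ‖z‖ ^ 2) : ℂ) * g z = (Real.pi / κ : ℝ) * g 0 := by
  have h := integral_radial_mul (ρ := fun r => Real.exp (-κ * r ^ 2)) (by fun_prop) hg hi
  have h2 := integral_norm_sq_pow_mul_exp_neg 0 hκ
  simp only [pow_zero, one_mul, Nat.factorial_zero, Nat.cast_one, mul_one, zero_add, pow_one] at h2
  rw [h, h2]

/-- The squared norm `π k! / κ^(k+1)` of the monomial `w ^ k` for the weight `exp (-κ‖w‖²)`. -/
noncomputable def gaussMoment (κ : ℝ) (k : ℕ) : ℝ := Real.pi * k.factorial / κ ^ (k + 1)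

theorem gaussMoment_pos {κ : ℝ} (hκ : 0 < κ) (k : ℕ) : 0 < gaussMoment κ k := by
  unfold gaussMoment; positivity

/-- The inner product of two polynomials for the weight `exp (-κ‖w‖²)`. -/
noncomputable def polyInner (κ : ℝ) (R S : Polynomial ℂ) : ℂ :=
  ∫ w : ℂ, R.eval w * conj (S.eval w) * (Real.exp (-κ * ‖w‖ ^ 2) : ℂ)

theorem integrable_monomial_mul_conj {κ : ℝ} (hκ : 0 < κ) (j k : ℕ) :
    Integrable (fun w : ℂ => w ^ j * conj (w ^ k) * (Real.exp (-κ * ‖w‖ ^ 2) : ℂ)) := by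
  refine (integrable_norm_pow_mul_exp_neg (j + k) hκ).mono' (by fun_prop) ?_
  refine Filter.Eventually.of_forall fun w => le_of_eq ?_
  simp only [norm_mul, norm_pow, RCLike.norm_conj, Complex.norm_real, Real.norm_eq_abs,
    Real.abs_exp, pow_add, mul_assoc]

/-- With `d = j - k` the integrand is a radial function times `w ^ d`, so the mean value property
replaces `w ^ d` by its value at 0. -/
theorem integral_monomial_mul_conj_of_le {κ : ℝ} (hκ : 0 < κ) {j k : ℕ} (h : k ≤ j) :
    ∫ w : ℂ, w ^ j * conj (w ^ k) * (Real.exp (-κ * ‖w‖ ^ 2) : ℂ)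
      = if j = k then (gaussMoment κ k : ℂ) else 0 := by
  obtain ⟨d, rfl⟩ := Nat.exists_eq_add_of_le h
  have e : ∀ w : ℂ, w ^ (k + d) * conj (w ^ k) * (Real.exp (-κ * ‖w‖ ^ 2) : ℂ)
      = (((‖w‖ ^ 2) ^ k * Real.exp (-κ * ‖w‖ ^ 2) : ℝ) : ℂ) * w ^ d := by
    intro w
    have : (((‖w‖ ^ 2) ^ k : ℝ) : ℂ) = w ^ k * conj (w ^ k) := by
      rw [Complex.mul_conj, Complex.normSq_eq_norm_sq, norm_pow]
      push_cast; ring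
    rw [Complex.ofReal_mul, this, pow_add]
    ring
  have hint := integrable_monomial_mul_conj hκ (k + d) k
  simp only [e] at hint ⊢
  rw [integral_radial_mul (ρ := fun r => (r ^ 2) ^ k * Real.exp (-κ * r ^ 2)) (by fun_prop)
    (by fun_prop) hint, integral_norm_sq_pow_mul_exp_neg k hκ]
  rcases Nat.eq_zero_or_pos d with rfl | hd
  · simp [gaussMoment]
  · simp [hd.ne']

theorem integral_monomial_mul_conj {κ : ℝ} (hκ : 0 < κ) (j k : ℕ) :
    ∫ w : ℂ, w ^ j * conj (w ^ k) * (Real.exp (-κ * ‖w‖ ^ 2) : ℂ)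
      = if j = k then (gaussMoment κ k : ℂ) else 0 := by
  rcases le_total k j with h | h
  · exact integral_monomial_mul_conj_of_le hκ h
  · have h1 := congrArg conj (integral_monomial_mul_conj_of_le hκ h)
    rw [← integral_conj] at h1
    have e : ∀ w : ℂ, conj (w ^ k * conj (w ^ j) * (Real.exp (-κ * ‖w‖ ^ 2) : ℂ))
        = w ^ j * conj (w ^ k) * (Real.exp (-κ * ‖w‖ ^ 2) : ℂ) := by
      intro w
      simp only [map_mul, Complex.conj_conj, Complex.conj_ofReal]
      ring
    simp only [e] at h1
    rw [h1]
    by_cases hjk : j = k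
    · simp [hjk]
    · simp [hjk, Ne.symm hjk]

theorem integrable_polyInner {κ : ℝ} (hκ : 0 < κ) (R S : Polynomial ℂ) :
    Integrable (fun w : ℂ => R.eval w * conj (S.eval w) * (Real.exp (-κ * ‖w‖ ^ 2) : ℂ)) := by
  simp only [Polynomial.eval_eq_sum_range, map_sum, map_mul, Finset.sum_mul,
    Finset.mul_sum]
  refine integrable_finsetSum _ fun j _ => integrable_finsetSum _ fun i _ => ?_
  refine ((integrable_monomial_mul_conj hκ i j).const_mul
    (R.coeff i * conj (S.coeff j))).congr (Filter.Eventually.of_forall fun w => ?_)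
  ring

theorem polyInner_eq_sum {κ : ℝ} (hκ : 0 < κ) (R S : Polynomial ℂ) :
    polyInner κ R S = ∑ k ∈ Finset.range (R.natDegree + 1),
      R.coeff k * conj (S.coeff k) * gaussMoment κ k := by
  unfold polyInner
  have e : ∀ w : ℂ, R.eval w * conj (S.eval w) * (Real.exp (-κ * ‖w‖ ^ 2) : ℂ)
      = ∑ i ∈ Finset.range (R.natDegree + 1), ∑ j ∈ Finset.range (S.natDegree + 1),
        (R.coeff i * conj (S.coeff j)) * (w ^ i * conj (w ^ j)
          * (Real.exp (-κ * ‖w‖ ^ 2) : ℂ)) := by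
    intro w
    simp only [Polynomial.eval_eq_sum_range, map_sum, map_mul, Finset.sum_mul,
    Finset.mul_sum]
    rw [Finset.sum_comm]
    refine Finset.sum_congr rfl fun i _ => Finset.sum_congr rfl fun j _ => ?_
    ring
  simp only [e]
  rw [integral_finsetSum _ fun i _ => integrable_finsetSum _ fun j _ =>
    (integrable_monomial_mul_conj hκ i j).const_mul _]
  refine Finset.sum_congr rfl fun i _ => ?_
  rw [integral_finsetSum _ fun j _ => (integrable_monomial_mul_conj hκ i j).const_mul _]
  simp only [integral_const_mul, integral_monomial_mul_conj hκ, mul_ite, mul_zero]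
  rw [Finset.sum_ite_eq]
  split_ifs with h
  · rfl
  · have : S.coeff i = 0 := Polynomial.coeff_eq_zero_of_natDegree_lt (by simpa using h)
    simp [this]

theorem polyInner_conj_symm (κ : ℝ) (R S : Polynomial ℂ) :
    conj (polyInner κ R S) = polyInner κ S R := by
  unfold polyInner
  rw [← integral_conj]
  congr 1
  ext w
  simp only [map_mul, Complex.conj_conj, Complex.conj_ofReal]
  ring

/-- The degrees of the two factors overlap at `d` only. This is how extreme coefficients are read
off the Euler-Lagrange equation. -/
theorem polyInner_X_pow_mul {κ : ℝ} (hκ : 0 < κ) {R : Polynomial ℂ} (T : Polynomial ℂ) {d : ℕ}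
    (h : R.natDegree ≤ d) :
    polyInner κ R (Polynomial.X ^ d * T) = R.coeff d * conj (T.coeff 0) * gaussMoment κ d := by
  rw [polyInner_eq_sum hκ]
  have h0 : ∀ k, k < d → (Polynomial.X ^ d * T).coeff k = 0 := fun k hk => by
    rw [Polynomial.coeff_X_pow_mul', if_neg (by omega)]
  rcases h.lt_or_eq with h | h
  · rw [Polynomial.coeff_eq_zero_of_natDegree_lt h]
    rw [Finset.sum_eq_zero fun k hk => ?_]
    · simp
    · rw [h0 k (by have := Finset.mem_range.1 hk; omega)]; simp
  · rw [Finset.sum_range_succ, Finset.sum_eq_zero fun k hk => ?_]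
    · rw [h, Polynomial.coeff_X_pow_mul']; simp
    · rw [h0 k (by have := Finset.mem_range.1 hk; omega)]; simp

/-! ### The pointwise bound, the energy functional and its admissible competitors. -/

theorem exp_neg_norm_sq_div (ε : ℝ) (z : ℂ) :
    Real.exp (-‖z‖ ^ 2 / ε) = Real.exp (-ε⁻¹ * ‖z‖ ^ 2) := by
  congr 1; rw [div_eq_inv_mul]; ring

theorem exp_neg_two_mul_norm_sq_div (ε : ℝ) (z : ℂ) :
    Real.exp (-2 * ‖z‖ ^ 2 / ε) = Real.exp (-‖z‖ ^ 2 / ε) ^ 2 := by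
  rw [← Real.exp_nat_mul]; congr 1; push_cast; ring

/-- The sharp pointwise bound for functions of the Fock-Bargmann space. -/
theorem norm_sq_mul_exp_le {ε : ℝ} (hε : 0 < ε) {f : ℂ → ℂ} (hf : f ∈ Fock ε) (z : ℂ) :
    ‖f z‖ ^ 2 * Real.exp (-‖z‖ ^ 2 / ε)
      ≤ (Real.pi * ε)⁻¹ * ∫ w : ℂ, ‖f w‖ ^ 2 * Real.exp (-‖w‖ ^ 2 / ε) := by
  obtain ⟨hd, hi⟩ := hf
  -- A magnetic translation: `|F|²` against the centred Gaussian is, up to the factor `exp(|z|²/ε)`,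
  -- the translated density of `f`. The mean value property is then applied to the entire function
  -- `F²`.
  set F : ℂ → ℂ := fun w => f (z + w) * Complex.exp (-(conj z * w) / ε) with hF
  have hFd : Differentiable ℂ fun w => F w ^ 2 := by
    simp only [hF]; fun_prop
  have hκ : 0 < ε⁻¹ := by positivity
  have hnorm : ∀ w, ‖(Real.exp (-ε⁻¹ * ‖w‖ ^ 2) : ℂ) * F w ^ 2‖
      = Real.exp (‖z‖ ^ 2 / ε) * (‖f (z + w)‖ ^ 2 * Real.exp (-‖z + w‖ ^ 2 / ε)) := by
    intro w
    have h1 : ‖z + w‖ ^ 2 = ‖z‖ ^ 2 + ‖w‖ ^ 2 + 2 * (conj z * w).re := by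
      simp only [← Complex.normSq_eq_norm_sq, Complex.normSq_apply, Complex.add_re, Complex.add_im,
        Complex.mul_re, Complex.conj_re, Complex.conj_im]
      ring
    simp only [hF, norm_mul, norm_pow, Complex.norm_real, Real.norm_eq_abs, Real.abs_exp,
      Complex.norm_exp]
    have h2 : (-(conj z * w) / (ε : ℂ)).re = -(conj z * w).re / ε := by
      rw [Complex.div_ofReal_re, Complex.neg_re]
    rw [h2, mul_pow, ← Real.exp_nat_mul, h1]
    have h3 : Real.exp (-ε⁻¹ * ‖w‖ ^ 2) * Real.exp ((2 : ℕ) * (-(conj z * w).re / ε))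
        = Real.exp (‖z‖ ^ 2 / ε) *
          Real.exp (-(‖z‖ ^ 2 + ‖w‖ ^ 2 + 2 * (conj z * w).re) / ε) := by
      rw [← Real.exp_add, ← Real.exp_add]
      congr 1; push_cast; field_simp; ring
    calc _ = ‖f (z + w)‖ ^ 2 * (Real.exp (-ε⁻¹ * ‖w‖ ^ 2) *
          Real.exp ((2 : ℕ) * (-(conj z * w).re / ε))) := by ring
      _ = _ := by rw [h3]; ring
  have hi' : Integrable fun w => ‖f (z + w)‖ ^ 2 * Real.exp (-‖z + w‖ ^ 2 / ε) :=
    hi.comp_add_left z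
  have hint : Integrable fun w => (Real.exp (-ε⁻¹ * ‖w‖ ^ 2) : ℂ) * F w ^ 2 := by
    have hc := hFd.continuous
    rw [← integrable_norm_iff (by fun_prop)]
    simp only [hnorm]
    exact hi'.const_mul _
  have h := integral_exp_neg_mul_entire hκ hFd hint
  have h5 : ‖∫ w, (Real.exp (-ε⁻¹ * ‖w‖ ^ 2) : ℂ) * F w ^ 2‖
      ≤ Real.exp (‖z‖ ^ 2 / ε) * ∫ w : ℂ, ‖f w‖ ^ 2 * Real.exp (-‖w‖ ^ 2 / ε) := by
    refine (norm_integral_le_integral_norm _).trans (le_of_eq ?_)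
    simp only [hnorm]
    rw [integral_const_mul]
    congr 1
    exact integral_add_left_eq_self (fun w : ℂ => ‖f w‖ ^ 2 * Real.exp (-‖w‖ ^ 2 / ε)) z
  rw [h] at h5
  have h6 : F 0 = f z := by simp [hF]
  rw [h6, norm_mul, Complex.norm_real, norm_pow, Real.norm_eq_abs, abs_of_pos (by positivity)] at h5
  have hexp : Real.exp (‖z‖ ^ 2 / ε) * Real.exp (-‖z‖ ^ 2 / ε) = 1 := by
    rw [← Real.exp_add, neg_div, add_neg_cancel, Real.exp_zero]
  have h7 := mul_le_mul_of_nonneg_right h5 (Real.exp_pos (-‖z‖ ^ 2 / ε)).le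
  rw [mul_right_comm (Real.exp (‖z‖ ^ 2 / ε)), hexp, one_mul] at h7
  rw [inv_mul_eq_div, le_div_iff₀ (by positivity)]
  calc _ = Real.pi / ε⁻¹ * ‖f z‖ ^ 2 * Real.exp (-‖z‖ ^ 2 / ε) := by
        rw [div_inv_eq_mul]; ring
    _ ≤ _ := h7

/-- The squared norm of the Fock-Bargmann space. -/
noncomputable def fockMass (ε : ℝ) (f : ℂ → ℂ) : ℝ :=
  ∫ z : ℂ, ‖f z‖ ^ 2 * Real.exp (-‖z‖ ^ 2 / ε)

/-- The potential energy. -/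
noncomputable def potentialEnergy (β ε : ℝ) (f : ℂ → ℂ) : ℝ :=
  ∫ z : ℂ, (-β * ‖z‖ ^ 2 + 1 / 4 * ‖z‖ ^ 4) * (‖f z‖ ^ 2 * Real.exp (-‖z‖ ^ 2 / ε))

/-- The quartic interaction integral. -/
noncomputable def quarticEnergy (ε : ℝ) (f : ℂ → ℂ) : ℝ :=
  ∫ z : ℂ, (‖f z‖ ^ 2 * Real.exp (-‖z‖ ^ 2 / ε)) ^ 2

theorem fockS_two_iff {ε : ℝ} {f : ℂ → ℂ} : f ∈ FockS ε 2 ↔ Differentiable ℂ f ∧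
    Integrable fun z : ℂ => (1 + ‖z‖ ^ 2) ^ 2 * (‖f z‖ ^ 2 * Real.exp (-‖z‖ ^ 2 / ε)) := by
  simp only [FockS, Set.mem_ofPred_eq, Real.rpow_two, mul_assoc]

theorem integrable_of_norm_le {E : Type*} [NormedAddCommGroup E] {ε : ℝ} {f : ℂ → ℂ}
    (hf : f ∈ FockS ε 2) {F : ℂ → E} (hF : Continuous F) (C : ℝ)
    (h : ∀ z, ‖F z‖ ≤ C * ((1 + ‖z‖ ^ 2) ^ 2 * (‖f z‖ ^ 2 * Real.exp (-‖z‖ ^ 2 / ε)))) :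
    Integrable F :=
  ((fockS_two_iff.1 hf).2.const_mul C).mono' hF.aestronglyMeasurable
    (Filter.Eventually.of_forall h)

theorem one_le_weight (z : ℂ) : 1 ≤ (1 + ‖z‖ ^ 2) ^ 2 := by
  nlinarith [sq_nonneg ‖z‖, sq_nonneg (‖z‖ ^ 2)]

theorem fock_of_fockS_two {ε : ℝ} {f : ℂ → ℂ} (hf : f ∈ FockS ε 2) : f ∈ Fock ε := by
  have hc := hf.1.continuous
  refine ⟨hf.1, integrable_of_norm_le hf (by fun_prop) 1 fun z => ?_⟩
  rw [Real.norm_of_nonneg (by positivity), one_mul]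
  exact le_mul_of_one_le_left (by positivity) (one_le_weight z)

theorem fockS_one_of_fockS_two {ε : ℝ} {f : ℂ → ℂ} (hf : f ∈ FockS ε 2) : f ∈ FockS ε 1 := by
  have hc := hf.1.continuous
  refine ⟨hf.1, ?_⟩
  simp only [Real.rpow_one]
  refine integrable_of_norm_le hf (by fun_prop) 1 fun z => ?_
  rw [Real.norm_of_nonneg (by positivity), one_mul, mul_assoc]
  exact mul_le_mul_of_nonneg_right (by nlinarith [sq_nonneg ‖z‖, sq_nonneg (‖z‖ ^ 2)])
    (by positivity)

theorem abs_potential_le (β : ℝ) (z : ℂ) :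
    |-β * ‖z‖ ^ 2 + 1 / 4 * ‖z‖ ^ 4| ≤ (|β| + 1) * (1 + ‖z‖ ^ 2) ^ 2 := by
  have h0 : 0 ≤ ‖z‖ ^ 2 := by positivity
  have e : ‖z‖ ^ 4 = (‖z‖ ^ 2) ^ 2 := by ring
  rw [e]
  set r := ‖z‖ ^ 2
  have h1 := neg_abs_le β
  have h2 := le_abs_self β
  have h3 := abs_nonneg β
  rw [abs_le]
  constructor <;>
  nlinarith [mul_nonneg h3 h0, mul_nonneg h3 (mul_nonneg h0 h0),
    mul_le_mul_of_nonneg_right h1 h0, mul_le_mul_of_nonneg_right h2 h0]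

theorem integrable_potential {β ε : ℝ} {f : ℂ → ℂ} (hf : f ∈ FockS ε 2) :
    Integrable fun z : ℂ => (-β * ‖z‖ ^ 2 + 1 / 4 * ‖z‖ ^ 4) *
      (‖f z‖ ^ 2 * Real.exp (-‖z‖ ^ 2 / ε)) := by
  have hc := hf.1.continuous
  refine integrable_of_norm_le hf (by fun_prop) (|β| + 1) fun z => ?_
  have h0 : 0 ≤ ‖f z‖ ^ 2 * Real.exp (-‖z‖ ^ 2 / ε) := by positivity
  rw [norm_mul, Real.norm_of_nonneg h0, Real.norm_eq_abs, ← mul_assoc (|β| + 1)]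
  exact mul_le_mul_of_nonneg_right (abs_potential_le β z) (by positivity)

theorem exists_density_le {ε : ℝ} (hε : 0 < ε) {f : ℂ → ℂ} (hf : f ∈ FockS ε 2) :
    ∃ C, 0 ≤ C ∧ ∀ z, ‖f z‖ ^ 2 * Real.exp (-‖z‖ ^ 2 / ε) ≤ C :=
  ⟨_, mul_nonneg (by positivity) (integral_nonneg fun _ => by positivity),
    norm_sq_mul_exp_le hε (fock_of_fockS_two hf)⟩

theorem integrable_quartic {ε : ℝ} (hε : 0 < ε) {f : ℂ → ℂ} (hf : f ∈ FockS ε 2) :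
    Integrable fun z : ℂ => (‖f z‖ ^ 2 * Real.exp (-‖z‖ ^ 2 / ε)) ^ 2 := by
  have hc := hf.1.continuous
  obtain ⟨C, hC, h⟩ := exists_density_le hε hf
  refine integrable_of_norm_le hf (by fun_prop) C fun z => ?_
  rw [Real.norm_of_nonneg (by positivity), sq]
  exact mul_le_mul (h z) (le_mul_of_one_le_left (by positivity) (one_le_weight z))
    (by positivity) hC

theorem energyLLL_eq {β G ε : ℝ} (hε : 0 < ε) {f : ℂ → ℂ} (hf : f ∈ FockS ε 2) :
    energyLLL β G ε f
      = ((potentialEnergy β ε f + G / 2 * quarticEnergy ε f : ℝ) : EReal) := by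
  rw [energyLLL, if_pos hf, potentialEnergy, quarticEnergy, ← integral_const_mul,
    ← integral_add (integrable_potential hf) ((integrable_quartic hε hf).const_mul _)]
  congr 2
  ext z
  rw [exp_neg_two_mul_norm_sq_div]
  ring

theorem admissible_of_fockS_two {ε : ℝ} {f : ℂ → ℂ} (hf : f ∈ FockS ε 2)
    (h : fockMass ε f = 1) : f ∈ admissibleLLL ε :=
  ⟨fockS_one_of_fockS_two hf, fock_of_fockS_two hf, by
    rw [fockNorm, show (∫ z : ℂ, ‖f z‖ ^ 2 * Real.exp (-‖z‖ ^ 2 / ε)) = fockMass ε f from rfl, h,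
      Real.sqrt_one]⟩

theorem IsMinimizerLLL.fockMass_eq_one {β G ε : ℝ} {f : ℂ → ℂ} (hf : IsMinimizerLLL β G ε f) :
    fockMass ε f = 1 := by
  have h := hf.1.2.2
  rwa [fockNorm, Real.sqrt_eq_one] at h

/-- A competitor of finite energy makes the infimum smaller than `⊤`, which excludes the infinite
branch for `f`. -/
theorem IsMinimizerLLL.mem_fockS_two {β G ε : ℝ} (hε : 0 < ε) {f : ℂ → ℂ}
    (hf : IsMinimizerLLL β G ε f) {g : ℂ → ℂ} (hg : g ∈ FockS ε 2) (hg1 : fockMass ε g = 1) :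
    f ∈ FockS ε 2 := by
  by_contra hn
  have h1 : infLLL β G ε ≤ energyLLL β G ε g :=
    sInf_le ⟨g, admissible_of_fockS_two hg hg1, rfl⟩
  rw [← hf.2, energyLLL, if_neg hn, energyLLL_eq hε hg] at h1
  exact absurd h1 (not_le.2 (EReal.coe_lt_top _))

theorem IsMinimizerLLL.energy_le {β G ε : ℝ} (hε : 0 < ε) {f : ℂ → ℂ}
    (hf : IsMinimizerLLL β G ε f) {g : ℂ → ℂ} (hg : g ∈ FockS ε 2) (hg1 : fockMass ε g = 1) :
    potentialEnergy β ε f + G / 2 * quarticEnergy ε f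
      ≤ potentialEnergy β ε g + G / 2 * quarticEnergy ε g := by
  have h1 : infLLL β G ε ≤ energyLLL β G ε g :=
    sInf_le ⟨g, admissible_of_fockS_two hg hg1, rfl⟩
  rw [← hf.2, energyLLL_eq hε (hf.mem_fockS_two hε hg hg1), energyLLL_eq hε hg] at h1
  exact_mod_cast h1

theorem fockS_two_const_mul {ε : ℝ} {f : ℂ → ℂ} (hf : f ∈ FockS ε 2) (c : ℂ) :
    (fun z => c * f z) ∈ FockS ε 2 := by
  rw [fockS_two_iff] at hf ⊢
  refine ⟨hf.1.const_mul c, (hf.2.const_mul (‖c‖ ^ 2)).congr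
    (Filter.Eventually.of_forall fun z => ?_)⟩
  simp only [norm_mul, mul_pow]
  ring

theorem fockS_two_add {ε : ℝ} {f g : ℂ → ℂ} (hf : f ∈ FockS ε 2) (hg : g ∈ FockS ε 2) :
    (fun z => f z + g z) ∈ FockS ε 2 := by
  rw [fockS_two_iff] at hf hg ⊢
  have hfc := hf.1.continuous
  have hgc := hg.1.continuous
  refine ⟨hf.1.add hg.1, ((hf.2.const_mul 2).add (hg.2.const_mul 2)).mono' (by fun_prop)
    (Filter.Eventually.of_forall fun z => ?_)⟩
  rw [Real.norm_of_nonneg (by positivity)]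
  have h : ‖f z + g z‖ ^ 2 ≤ 2 * ‖f z‖ ^ 2 + 2 * ‖g z‖ ^ 2 := by
    nlinarith [norm_add_le (f z) (g z), norm_nonneg (f z + g z), sq_nonneg (‖f z‖ - ‖g z‖)]
  calc _ ≤ (1 + ‖z‖ ^ 2) ^ 2 * ((2 * ‖f z‖ ^ 2 + 2 * ‖g z‖ ^ 2) * Real.exp (-‖z‖ ^ 2 / ε)) := by
        gcongr
    _ = _ := by simp only [Pi.add_apply]; ring

/-- Minimality in homogeneous form: after normalising `g`, the denominators are cleared with the
squared mass. Along a line `f + t h` both sides are then polynomials in `t`. -/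
theorem IsMinimizerLLL.energy_mul_sq_le {β G ε : ℝ} (hε : 0 < ε) {f : ℂ → ℂ}
    (hf : IsMinimizerLLL β G ε f) {g : ℂ → ℂ} (hg : g ∈ FockS ε 2) (hg0 : 0 < fockMass ε g) :
    (potentialEnergy β ε f + G / 2 * quarticEnergy ε f) * fockMass ε g ^ 2
      ≤ potentialEnergy β ε g * fockMass ε g + G / 2 * quarticEnergy ε g := by
  set n := fockMass ε g with hn
  have hs : ‖((Real.sqrt n)⁻¹ : ℂ)‖ ^ 2 = n⁻¹ := by
    rw [norm_inv, Complex.norm_real, inv_pow, Real.norm_of_nonneg (Real.sqrt_nonneg _),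
      Real.sq_sqrt hg0.le]
  have hd : ∀ z, ‖((Real.sqrt n)⁻¹ : ℂ) * g z‖ ^ 2 * Real.exp (-‖z‖ ^ 2 / ε)
      = n⁻¹ * (‖g z‖ ^ 2 * Real.exp (-‖z‖ ^ 2 / ε)) := fun z => by
    rw [norm_mul, mul_pow, hs]; ring
  have h1 : fockMass ε (fun z => ((Real.sqrt n)⁻¹ : ℂ) * g z) = 1 := by
    unfold fockMass
    simp only [hd]
    rw [integral_const_mul]
    exact inv_mul_cancel₀ hg0.ne'
  have h2 : potentialEnergy β ε (fun z => ((Real.sqrt n)⁻¹ : ℂ) * g z)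
      = n⁻¹ * potentialEnergy β ε g := by
    unfold potentialEnergy
    simp only [hd]
    rw [← integral_const_mul]
    congr 1; ext z; ring
  have h3 : quarticEnergy ε (fun z => ((Real.sqrt n)⁻¹ : ℂ) * g z)
      = n⁻¹ ^ 2 * quarticEnergy ε g := by
    unfold quarticEnergy
    simp only [hd]
    rw [← integral_const_mul]
    congr 1; ext z; ring
  have h := hf.energy_le hε (fockS_two_const_mul hg _) h1
  rw [h2, h3] at h
  have h4 := mul_le_mul_of_nonneg_right h (sq_nonneg n)
  refine h4.trans (le_of_eq ?_)
  field_simp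

/-! ### The Euler-Lagrange equation. -/

section EulerLagrange

variable {β G ε : ℝ} {f h : ℂ → ℂ}

theorem norm_mul_conj_le (a b : ℂ) : ‖a * conj b‖ ≤ (‖a‖ ^ 2 + ‖b‖ ^ 2) / 2 := by
  rw [norm_mul, RCLike.norm_conj]
  nlinarith [sq_nonneg (‖a‖ - ‖b‖)]

/-- Continuous functions dominated by the weighted density of two functions are integrable. -/
theorem integrable_of_norm_le_add {E : Type*} [NormedAddCommGroup E] (hf : f ∈ FockS ε 2)
    (hh : h ∈ FockS ε 2) {F : ℂ → E} (hF : Continuous F) (C : ℝ)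
    (hle : ∀ z, ‖F z‖ ≤ C * ((1 + ‖z‖ ^ 2) ^ 2 * (‖f z‖ ^ 2 * Real.exp (-‖z‖ ^ 2 / ε)))
      + C * ((1 + ‖z‖ ^ 2) ^ 2 * (‖h z‖ ^ 2 * Real.exp (-‖z‖ ^ 2 / ε)))) :
    Integrable F :=
  (((fockS_two_iff.1 hf).2.const_mul C).add ((fockS_two_iff.1 hh).2.const_mul C)).mono'
    hF.aestronglyMeasurable (Filter.Eventually.of_forall hle)

theorem integrable_weight_mul_conj (hf : f ∈ FockS ε 2) (hh : h ∈ FockS ε 2) {v : ℂ → ℝ}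
    (hv : Continuous v) {C : ℝ} (hvC : ∀ z, |v z| ≤ C * (1 + ‖z‖ ^ 2) ^ 2) :
    Integrable fun z => (v z : ℂ) * (f z * conj (h z)) * (Real.exp (-‖z‖ ^ 2 / ε) : ℂ) := by
  have hfc := hf.1.continuous
  have hhc := hh.1.continuous
  have hC : 0 ≤ C := by
    have := (abs_nonneg _).trans (hvC 0)
    simpa using this
  refine integrable_of_norm_le_add hf hh (by fun_prop) C fun z => ?_
  rw [norm_mul, norm_mul, Complex.norm_real, Complex.norm_real, Real.norm_eq_abs, Real.norm_eq_abs,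
    Real.abs_exp]
  calc _ ≤ (C * (1 + ‖z‖ ^ 2) ^ 2) * ((‖f z‖ ^ 2 + ‖h z‖ ^ 2) / 2) * Real.exp (-‖z‖ ^ 2 / ε) := by
        gcongr
        · exact hvC z
        · exact norm_mul_conj_le _ _
    _ ≤ (C * (1 + ‖z‖ ^ 2) ^ 2) * (‖f z‖ ^ 2 + ‖h z‖ ^ 2) * Real.exp (-‖z‖ ^ 2 / ε) := by
        gcongr
        have : 0 ≤ ‖f z‖ ^ 2 + ‖h z‖ ^ 2 := by positivity
        linarith
    _ = _ := by ring

/-- The Euler-Lagrange equation, real part. -/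
theorem IsMinimizerLLL.euler_lagrange_re (hε : 0 < ε) (hf : IsMinimizerLLL β G ε f)
    (hf2 : f ∈ FockS ε 2) (hh : h ∈ FockS ε 2) :
    ∫ z : ℂ, (-β * ‖z‖ ^ 2 + 1 / 4 * ‖z‖ ^ 4
        - (potentialEnergy β ε f + G * quarticEnergy ε f)
        + G * (‖f z‖ ^ 2 * Real.exp (-‖z‖ ^ 2 / ε))) *
        ((f z * conj (h z)).re * Real.exp (-‖z‖ ^ 2 / ε)) = 0 := by
  have hfc := hf2.1.continuous
  have hhc := hh.1.continuous
  set p : ℂ → ℝ := fun z => ‖f z‖ ^ 2 * Real.exp (-‖z‖ ^ 2 / ε) with hp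
  set q : ℂ → ℝ := fun z => (f z * conj (h z)).re * Real.exp (-‖z‖ ^ 2 / ε) with hq
  set r : ℂ → ℝ := fun z => ‖h z‖ ^ 2 * Real.exp (-‖z‖ ^ 2 / ε) with hr
  set V : ℂ → ℝ := fun z => -β * ‖z‖ ^ 2 + 1 / 4 * ‖z‖ ^ 4 with hV
  have hVc : Continuous V := by fun_prop
  have hpc : Continuous p := by fun_prop
  have hqc : Continuous q := by fun_prop
  have hrc : Continuous r := by fun_prop
  have hp0 : ∀ z, 0 ≤ p z := fun z => by positivity
  have hr0 : ∀ z, 0 ≤ r z := fun z => by positivity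
  have hqle : ∀ z, |q z| ≤ p z + r z := fun z => by
    have h1 := (Complex.abs_re_le_norm (f z * conj (h z))).trans (norm_mul_conj_le _ _)
    simp only [hq, hp, hr]
    rw [abs_mul, Real.abs_exp, ← add_mul]
    refine mul_le_mul_of_nonneg_right (h1.trans ?_) (Real.exp_pos _).le
    have : 0 ≤ ‖f z‖ ^ 2 + ‖h z‖ ^ 2 := by positivity
    linarith
  obtain ⟨C1, hC1, hpC⟩ := exists_density_le hε hf2
  obtain ⟨C2, hC2, hrC⟩ := exists_density_le hε hh
  have hint : ∀ (v s : ℂ → ℝ) (C : ℝ), Continuous v → Continuous s →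
      (∀ z, |v z| ≤ C * (1 + ‖z‖ ^ 2) ^ 2) → (∀ z, |s z| ≤ p z + r z) →
      Integrable fun z => v z * s z := by
    intro v s C hv hs hvC hsC
    have hC : 0 ≤ C := by
      have := (abs_nonneg _).trans (hvC 0)
      simpa using this
    refine integrable_of_norm_le_add hf2 hh (by fun_prop) C fun z => ?_
    rw [norm_mul, Real.norm_eq_abs, Real.norm_eq_abs]
    calc _ ≤ (C * (1 + ‖z‖ ^ 2) ^ 2) * (p z + r z) := by
          gcongr
          · exact hvC z
          · exact hsC z
      _ = _ := by simp only [hp, hr]; ring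
  have hpp : ∀ z, |p z| ≤ p z + r z := fun z => by
    rw [abs_of_nonneg (hp0 z)]; linarith [hr0 z]
  have hrr : ∀ z, |r z| ≤ p z + r z := fun z => by
    rw [abs_of_nonneg (hr0 z)]; linarith [hp0 z]
  have hV1 := abs_potential_le β
  have h1 : ∀ z : ℂ, |(1 : ℝ)| ≤ 1 * (1 + ‖z‖ ^ 2) ^ 2 := fun z => by
    rw [abs_one, one_mul]; exact one_le_weight z
  have hbd : ∀ (s : ℂ → ℝ), (∀ z, |s z| ≤ p z + r z) → ∀ z, |s z| ≤
      (C1 + C2) * (1 + ‖z‖ ^ 2) ^ 2 := fun s hs z =>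
    ((hs z).trans (add_le_add (hpC z) (hrC z))).trans
      (le_mul_of_one_le_right (by positivity) (one_le_weight z))
  have ip : Integrable p := by simpa using hint (fun _ => 1) p 1 continuous_const hpc h1 hpp
  have iq : Integrable q := by simpa using hint (fun _ => 1) q 1 continuous_const hqc h1 hqle
  have ir : Integrable r := by simpa using hint (fun _ => 1) r 1 continuous_const hrc h1 hrr
  have iVp := hint V p _ hVc hpc hV1 hpp
  have iVq := hint V q _ hVc hqc hV1 hqle
  have iVr := hint V r _ hVc hrc hV1 hrr
  have ipp := hint p p _ hpc hpc (hbd p hpp) hpp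
  have ipq := hint p q _ hpc hqc (hbd p hpp) hqle
  have iqq := hint q q _ hqc hqc (hbd q hqle) hqle
  have ipr := hint p r _ hpc hrc (hbd p hpp) hrr
  have iqr := hint q r _ hqc hrc (hbd q hqle) hrr
  have irr := hint r r _ hrc hrc (hbd r hrr) hrr
  set g : ℝ → ℂ → ℂ := fun t z => f z + (t : ℂ) * h z with hg
  have hg2 : ∀ t, g t ∈ FockS ε 2 := fun t => fockS_two_add hf2 (fockS_two_const_mul hh _)
  have hdens : ∀ t z, ‖g t z‖ ^ 2 * Real.exp (-‖z‖ ^ 2 / ε)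
      = p z + 2 * t * q z + t ^ 2 * r z := by
    intro t z
    have : ‖g t z‖ ^ 2 = ‖f z‖ ^ 2 + 2 * t * (f z * conj (h z)).re + t ^ 2 * ‖h z‖ ^ 2 := by
      simp only [hg, ← Complex.normSq_eq_norm_sq, Complex.normSq_apply, Complex.add_re,
        Complex.add_im, Complex.mul_re, Complex.mul_im, Complex.ofReal_re, Complex.ofReal_im,
        Complex.conj_re, Complex.conj_im]
      ring
    rw [this]; ring
  have hmass : ∀ t, fockMass ε (g t) = (∫ z, p z) + 2 * t * (∫ z, q z) + t ^ 2 * ∫ z, r z := by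
    intro t
    unfold fockMass
    simp only [hdens]
    have i2 : Integrable fun z => p z + 2 * t * q z := ip.add (iq.const_mul _)
    rw [integral_add i2 (ir.const_mul _), integral_add ip (iq.const_mul _),
      integral_const_mul, integral_const_mul]
  have hpot : ∀ t, potentialEnergy β ε (g t) =
      (∫ z, V z * p z) + 2 * t * (∫ z, V z * q z) + t ^ 2 * ∫ z, V z * r z := by
    intro t
    unfold potentialEnergy
    simp only [hdens]
    have e : ∀ z, (-β * ‖z‖ ^ 2 + 1 / 4 * ‖z‖ ^ 4) * (p z + 2 * t * q z + t ^ 2 * r z)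
        = V z * p z + 2 * t * (V z * q z) + t ^ 2 * (V z * r z) := fun z => by
      simp only [hV]; ring
    simp only [e]
    have i2 : Integrable fun z => V z * p z + 2 * t * (V z * q z) := iVp.add (iVq.const_mul _)
    rw [integral_add i2 (iVr.const_mul _),
      integral_add iVp (iVq.const_mul _), integral_const_mul, integral_const_mul]
  have hquart : ∀ t, quarticEnergy ε (g t) =
      (∫ z, p z * p z) + 4 * t * (∫ z, p z * q z) + t ^ 2 * ((4 * ∫ z, q z * q z)
        + (2 * ∫ z, p z * r z) + 4 * t * (∫ z, q z * r z) + t ^ 2 * ∫ z, r z * r z) := by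
    intro t
    unfold quarticEnergy
    simp only [hdens]
    have e : ∀ z, (p z + 2 * t * q z + t ^ 2 * r z) ^ 2
        = p z * p z + 4 * t * (p z * q z) + (4 * t ^ 2) * (q z * q z) + (2 * t ^ 2) * (p z * r z)
          + (4 * t ^ 3) * (q z * r z) + t ^ 4 * (r z * r z) := fun z => by
      ring
    simp only [e]
    have i2 : Integrable fun z => p z * p z + 4 * t * (p z * q z) := ipp.add (ipq.const_mul _)
    have i3 : Integrable fun z => p z * p z + 4 * t * (p z * q z) + (4 * t ^ 2) * (q z * q z) :=
      i2.add (iqq.const_mul _)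
    have i4 : Integrable fun z => p z * p z + 4 * t * (p z * q z) + (4 * t ^ 2) * (q z * q z)
      + (2 * t ^ 2) * (p z * r z) := i3.add (ipr.const_mul _)
    have i5 : Integrable fun z => p z * p z + 4 * t * (p z * q z) + (4 * t ^ 2) * (q z * q z)
      + (2 * t ^ 2) * (p z * r z) + (4 * t ^ 3) * (q z * r z) := i4.add (iqr.const_mul _)
    rw [integral_add i5 (irr.const_mul _), integral_add i4 (iqr.const_mul _),
      integral_add i3 (ipr.const_mul _), integral_add i2 (iqq.const_mul _),
      integral_add ipp (ipq.const_mul _)]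
    simp only [integral_const_mul]
    ring
  have hp1 : ∫ z, p z = 1 := hf.fockMass_eq_one
  have hA : potentialEnergy β ε f = ∫ z, V z * p z := rfl
  have hB : quarticEnergy ε f = ∫ z, p z * p z := by
    unfold quarticEnergy; simp only [sq (_ * _)]; rfl
  set A := potentialEnergy β ε f
  set B := quarticEnergy ε f
  -- `φ` is nonnegative near 0 by minimality and vanishes at 0, so its derivative there is zero.
  set φ : ℝ → ℝ := fun t => potentialEnergy β ε (g t) * fockMass ε (g t)
    + G / 2 * quarticEnergy ε (g t) - (A + G / 2 * B) * fockMass ε (g t) ^ 2 with hφ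
  have hφ0 : φ 0 = 0 := by
    simp only [hφ, hmass, hpot, hquart, hp1, ← hA, ← hB]; ring
  have hnc : Continuous fun t => fockMass ε (g t) := by
    simp only [hmass]; fun_prop
  have hmin : IsLocalMin φ 0 := by
    have : ∀ᶠ t in nhds (0:ℝ), 0 < fockMass ε (g t) := by
      refine hnc.continuousAt.eventually_const_lt ?_
      simp only [hmass, hp1]; norm_num
    filter_upwards [this] with t ht
    rw [hφ0]
    have := hf.energy_mul_sq_le hε (hg2 t) ht
    simp only [hφ]
    linarith
  have hder : HasDerivAt φ (2 * (∫ z, V z * q z) + A * (2 * ∫ z, q z)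
      + G / 2 * (4 * ∫ z, p z * q z) - (A + G / 2 * B) * (4 * ∫ z, q z)) 0 := by
    have hn : HasDerivAt (fun t => fockMass ε (g t)) (2 * ∫ z, q z) 0 := by
      simp only [hmass]
      have := (((hasDerivAt_id (0:ℝ)).const_mul 2).mul_const (∫ z, q z)).const_add (∫ z, p z)
      have := this.add (((hasDerivAt_id (0:ℝ)).pow 2).mul_const (∫ z, r z))
      convert! this using 1; simp
    have ha : HasDerivAt (fun t => potentialEnergy β ε (g t)) (2 * ∫ z, V z * q z) 0 := by
      simp only [hpot]
      have := (((hasDerivAt_id (0:ℝ)).const_mul 2).mul_const (∫ z, V z * q z)).const_add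
        (∫ z, V z * p z)
      have := this.add (((hasDerivAt_id (0:ℝ)).pow 2).mul_const (∫ z, V z * r z))
      convert! this using 1; simp
    have hb : HasDerivAt (fun t => quarticEnergy ε (g t)) (4 * ∫ z, p z * q z) 0 := by
      simp only [hquart]
      have h2 : HasDerivAt (fun t : ℝ => ((4 * ∫ z, q z * q z)
        + (2 * ∫ z, p z * r z) + 4 * t * (∫ z, q z * r z) + t ^ 2 * ∫ z, r z * r z))
        (4 * (∫ z, q z * r z)) 0 := by
        have := (((hasDerivAt_id (0:ℝ)).const_mul 4).mul_const (∫ z, q z * r z)).const_add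
          ((4 * ∫ z, q z * q z) + (2 * ∫ z, p z * r z))
        have := this.add (((hasDerivAt_id (0:ℝ)).pow 2).mul_const (∫ z, r z * r z))
        convert! this using 1; simp
      have := (((hasDerivAt_id (0:ℝ)).const_mul 4).mul_const (∫ z, p z * q z)).const_add
        (∫ z, p z * p z)
      have := this.add (((hasDerivAt_id (0:ℝ)).pow 2).mul h2)
      convert! this using 1; simp
    have := ((ha.mul hn).add (hb.const_mul (G / 2))).sub ((hn.pow 2).const_mul (A + G / 2 * B))
    convert! this using 1
    simp only [hmass, hpot, hp1, ← hA, show (2 - 1 : ℕ) = 1 from rfl, pow_one]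
    push_cast
    ring
  -- The coefficients of `∫ q` add up to `2A - 4(A + G/2 · B) = -2(A + G B)`, which is the origin of
  -- the multiplier `A + G B`.
  have hz := hmin.hasDerivAt_eq_zero hder
  have e : ∀ z, (V z - (A + G * B) + G * p z) * q z
      = V z * q z - (A + G * B) * q z + G * (p z * q z) := fun z => by ring
  show ∫ z, (V z - (A + G * B) + G * p z) * q z = 0
  simp only [e]
  have i2 : Integrable fun z => V z * q z - (A + G * B) * q z := iVq.sub (iq.const_mul _)
  rw [integral_add i2 (ipq.const_mul _), integral_sub iVq (iq.const_mul _),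
    integral_const_mul, integral_const_mul]
  linarith

/-- The Euler-Lagrange equation of the minimisation problem. -/
theorem IsMinimizerLLL.euler_lagrange (hε : 0 < ε) (hf : IsMinimizerLLL β G ε f)
    (hf2 : f ∈ FockS ε 2) (hh : h ∈ FockS ε 2) :
    ∫ z : ℂ, ((-β * ‖z‖ ^ 2 + 1 / 4 * ‖z‖ ^ 4
        - (potentialEnergy β ε f + G * quarticEnergy ε f)
        + G * (‖f z‖ ^ 2 * Real.exp (-‖z‖ ^ 2 / ε)) : ℝ) : ℂ) *
        (f z * conj (h z)) * (Real.exp (-‖z‖ ^ 2 / ε) : ℂ) = 0 := by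
  have hfc := hf2.1.continuous
  obtain ⟨C, hC, hfC⟩ := exists_density_le hε hf2
  set v : ℂ → ℝ := fun z => -β * ‖z‖ ^ 2 + 1 / 4 * ‖z‖ ^ 4
        - (potentialEnergy β ε f + G * quarticEnergy ε f)
        + G * (‖f z‖ ^ 2 * Real.exp (-‖z‖ ^ 2 / ε)) with hv
  have hvC : ∀ z, |v z| ≤ ((|β| + 1) + |potentialEnergy β ε f + G * quarticEnergy ε f| + |G| * C)
      * (1 + ‖z‖ ^ 2) ^ 2 := by
    intro z
    have h1 := abs_potential_le β z
    have h2 := one_le_weight z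
    have h3 : |G * (‖f z‖ ^ 2 * Real.exp (-‖z‖ ^ 2 / ε))| ≤ |G| * C := by
      rw [abs_mul, abs_of_nonneg (by positivity : 0 ≤ ‖f z‖ ^ 2 * Real.exp (-‖z‖ ^ 2 / ε))]
      exact mul_le_mul_of_nonneg_left (hfC z) (abs_nonneg _)
    calc |v z| ≤ (|β| + 1) * (1 + ‖z‖ ^ 2) ^ 2
          + |potentialEnergy β ε f + G * quarticEnergy ε f| + |G| * C :=
          (abs_add_le _ _).trans (add_le_add ((abs_sub _ _).trans (add_le_add h1 le_rfl)) h3)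
      _ ≤ _ := by
        nlinarith [mul_le_mul_of_nonneg_left h2
          (abs_nonneg (potentialEnergy β ε f + G * quarticEnergy ε f)),
          mul_le_mul_of_nonneg_left h2 (by positivity : 0 ≤ |G| * C)]
  have hint := integrable_weight_mul_conj hf2 hh (by fun_prop) hvC
  have hre := hf.euler_lagrange_re hε hf2 hh
  -- Testing with `i h` turns the real part of `f h̄` into its imaginary part.
  have him := hf.euler_lagrange_re hε hf2 (fockS_two_const_mul hh Complex.I)
  apply Complex.ext
  · rw [← Complex.reCLM_apply, ← Complex.reCLM.integral_comp_comm hint, Complex.zero_re, ← hre]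
    congr 1; ext z
    simp only [Complex.reCLM_apply, Complex.re_mul_ofReal, Complex.re_ofReal_mul]
    ring
  · rw [← Complex.imCLM_apply, ← Complex.imCLM.integral_comp_comm hint, Complex.zero_im, ← him]
    congr 1; ext z
    have : (f z * conj (Complex.I * h z)).re = (f z * conj (h z)).im := by
      simp only [map_mul, Complex.conj_I, Complex.mul_re, Complex.mul_im, Complex.neg_re,
        Complex.neg_im, Complex.I_re, Complex.I_im, Complex.conj_re, Complex.conj_im]
      ring
    rw [this]
    simp only [Complex.imCLM_apply, Complex.im_mul_ofReal, Complex.im_ofReal_mul]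
    ring

end EulerLagrange

/-! ### Gaussian growth bounds and the energy of polynomials. -/

theorem gaussMoment_succ {κ : ℝ} (hκ : 0 < κ) (k : ℕ) :
    gaussMoment κ (k + 1) = gaussMoment κ k * (k + 1) / κ := by
  unfold gaussMoment
  rw [Nat.factorial_succ]
  push_cast
  field_simp
  ring

section Growth

theorem exists_pow_le_exp_sq {δ : ℝ} (hδ : 0 < δ) (k : ℕ) :
    ∃ C, 0 ≤ C ∧ ∀ x : ℝ, 0 ≤ x → x ^ k ≤ C * Real.exp (δ * x ^ 2) := by
  refine ⟨1 + k.factorial / δ ^ k, by positivity, fun x hx => ?_⟩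
  have h1 : x ^ k ≤ 1 + (x ^ 2) ^ k := by
    rcases le_total x 1 with h | h
    · have := pow_le_one₀ (n := k) hx h
      have : 0 ≤ (x ^ 2) ^ k := by positivity
      linarith
    · have : x ^ k ≤ (x ^ 2) ^ k := by
        gcongr; nlinarith
      linarith
  have h2 : (x ^ 2) ^ k ≤ k.factorial / δ ^ k * Real.exp (δ * x ^ 2) := by
    have := Real.pow_div_factorial_le_exp (δ * x ^ 2) (by positivity) k
    rw [mul_pow, div_le_iff₀ (by positivity)] at this
    rw [div_mul_eq_mul_div, le_div_iff₀ (by positivity)]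
    linarith
  have h3 : 1 ≤ Real.exp (δ * x ^ 2) := Real.one_le_exp (by positivity)
  linarith

theorem exists_eval_le_exp_sq {δ : ℝ} (hδ : 0 < δ) (P : Polynomial ℂ) :
    ∃ C, 0 ≤ C ∧ ∀ z : ℂ, ‖P.eval z‖ ≤ C * Real.exp (δ * ‖z‖ ^ 2) := by
  induction P using Polynomial.induction_on' with
  | add p q hp hq =>
    obtain ⟨C, hC, h⟩ := hp
    obtain ⟨D, hD, h'⟩ := hq
    refine ⟨C + D, by positivity, fun z => ?_⟩
    rw [Polynomial.eval_add, add_mul]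
    exact (norm_add_le _ _).trans (add_le_add (h z) (h' z))
  | monomial n a =>
    obtain ⟨C, hC, h⟩ := exists_pow_le_exp_sq hδ n
    refine ⟨‖a‖ * C, by positivity, fun z => ?_⟩
    rw [Polynomial.eval_monomial, norm_mul, norm_pow, mul_assoc]
    exact mul_le_mul_of_nonneg_left (h _ (norm_nonneg _)) (norm_nonneg _)

theorem exp_linear_le {δ : ℝ} (hδ : 0 < δ) (c : ℝ) :
    ∀ x : ℝ, Real.exp (c * x) ≤ Real.exp (c ^ 2 / (4 * δ)) * Real.exp (δ * x ^ 2) := by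
  intro x
  rw [← Real.exp_add]
  apply Real.exp_le_exp.2
  have : c ^ 2 / (4 * δ) + δ * x ^ 2 - c * x = (c - 2 * δ * x) ^ 2 / (4 * δ) := by
    field_simp; ring
  have : 0 ≤ (c - 2 * δ * x) ^ 2 / (4 * δ) := by positivity
  linarith

theorem fockS_two_of_norm_le {ε : ℝ} {h : ℂ → ℂ} (hd : Differentiable ℂ h) {C α : ℝ}
    (hα : 2 * α < ε⁻¹) (hle : ∀ z, ‖h z‖ ≤ C * Real.exp (α * ‖z‖ ^ 2)) : h ∈ FockS ε 2 := by
  rw [fockS_two_iff]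
  have hc := hd.continuous
  refine ⟨hd, ?_⟩
  have hκ : 0 < ε⁻¹ - 2 * α := by linarith
  have hi := (((integrable_norm_pow_mul_exp_neg 0 hκ).add
    ((integrable_norm_pow_mul_exp_neg 2 hκ).const_mul 2)).add
    (integrable_norm_pow_mul_exp_neg 4 hκ)).const_mul (C ^ 2)
  refine hi.mono' (by fun_prop) (Filter.Eventually.of_forall fun z => ?_)
  rw [Real.norm_of_nonneg (by positivity)]
  have h1 : ‖h z‖ ^ 2 ≤ C ^ 2 * Real.exp (2 * α * ‖z‖ ^ 2) := by
    have := pow_le_pow_left₀ (norm_nonneg _) (hle z) 2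
    rw [mul_pow, ← Real.exp_nat_mul] at this
    convert! this using 3
    push_cast; ring
  calc _ ≤ (1 + ‖z‖ ^ 2) ^ 2 * (C ^ 2 * Real.exp (2 * α * ‖z‖ ^ 2) *
        Real.exp (-‖z‖ ^ 2 / ε)) := by gcongr
    _ = _ := by
      have e : Real.exp (2 * α * ‖z‖ ^ 2) * Real.exp (-‖z‖ ^ 2 / ε)
          = Real.exp (-(ε⁻¹ - 2 * α) * ‖z‖ ^ 2) := by
        rw [← Real.exp_add]; congr 1; rw [div_eq_inv_mul]; ring
      simp only [Pi.add_apply]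
      rw [mul_assoc (C ^ 2), e]
      ring

theorem fockS_two_polynomial {ε : ℝ} (hε : 0 < ε) (P : Polynomial ℂ) :
    (fun z => P.eval z) ∈ FockS ε 2 := by
  have hδ : 0 < ε⁻¹ / 4 := by positivity
  obtain ⟨C, -, h⟩ := exists_eval_le_exp_sq hδ P
  exact fockS_two_of_norm_le P.differentiable (by linarith [inv_pos.2 hε]) h

end Growth

section PolynomialEnergy

/-- Parseval's identity for `X ^ j * P`. The free bound `n` lets the sums for different `j` share
one range. -/
theorem integral_norm_pow_mul_polynomial {κ : ℝ} (hκ : 0 < κ) (P : Polynomial ℂ) (j : ℕ) {n : ℕ}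
    (hn : P.natDegree < n) :
    ∫ z : ℂ, (‖z‖ ^ 2) ^ j * ‖P.eval z‖ ^ 2 * Real.exp (-κ * ‖z‖ ^ 2)
      = ∑ k ∈ Finset.range n, ‖P.coeff k‖ ^ 2 * gaussMoment κ (j + k) := by
  have h := polyInner_eq_sum hκ (Polynomial.X ^ j * P) (Polynomial.X ^ j * P)
  have hdeg : (Polynomial.X ^ j * P).natDegree + 1 ≤ j + n := by
    have := Polynomial.natDegree_mul_le (p := Polynomial.X ^ j) (q := P)
    rw [Polynomial.natDegree_X_pow] at this
    omega
  rw [Finset.sum_subset (Finset.range_subset_range.2 hdeg) (fun k _ hk => by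
    rw [Polynomial.coeff_eq_zero_of_natDegree_lt (by simpa using hk)]; simp),
    Finset.sum_range_add, Finset.sum_eq_zero (s := Finset.range j) (fun k hk => by
      rw [Polynomial.coeff_X_pow_mul', if_neg (by simpa using hk)]; simp), zero_add] at h
  have hc : ∀ k, (Polynomial.X ^ j * P).coeff (j + k) = P.coeff k := fun k => by
    rw [add_comm, Polynomial.coeff_X_pow_mul]
  simp only [hc] at h
  have e : ∀ z : ℂ, (Polynomial.X ^ j * P).eval z * conj ((Polynomial.X ^ j * P).eval z) *
      (Real.exp (-κ * ‖z‖ ^ 2) : ℂ)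
      = (((‖z‖ ^ 2) ^ j * ‖P.eval z‖ ^ 2 * Real.exp (-κ * ‖z‖ ^ 2) : ℝ) : ℂ) := by
    intro z
    rw [Complex.mul_conj, Complex.normSq_eq_norm_sq, Polynomial.eval_mul, Polynomial.eval_pow,
      Polynomial.eval_X, norm_mul, norm_pow]
    push_cast; ring
  have e2 : ∀ k, P.coeff k * conj (P.coeff k) * (gaussMoment κ (j + k) : ℂ)
      = ((‖P.coeff k‖ ^ 2 * gaussMoment κ (j + k) : ℝ) : ℂ) := by
    intro k
    rw [Complex.mul_conj, Complex.normSq_eq_norm_sq]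
    push_cast; ring
  unfold polyInner at h
  simp only [e, e2] at h
  rw [integral_complex_ofReal, ← Complex.ofReal_sum] at h
  exact_mod_cast h

theorem fockMass_polynomial {ε : ℝ} (hε : 0 < ε) (P : Polynomial ℂ) {n : ℕ}
    (hn : P.natDegree < n) : fockMass ε (fun z => P.eval z)
      = ∑ k ∈ Finset.range n, ‖P.coeff k‖ ^ 2 * gaussMoment ε⁻¹ k := by
  have h := integral_norm_pow_mul_polynomial (inv_pos.2 hε) P 0 hn
  simp only [pow_zero, one_mul, zero_add] at h
  rw [← h]
  unfold fockMass
  simp only [exp_neg_norm_sq_div]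

theorem potentialEnergy_polynomial {β ε : ℝ} (hε : 0 < ε) (P : Polynomial ℂ) {n : ℕ}
    (hn : P.natDegree < n) : potentialEnergy β ε (fun z => P.eval z)
      = ∑ k ∈ Finset.range n, ‖P.coeff k‖ ^ 2 * gaussMoment ε⁻¹ k *
        (-β * (ε * (k + 1)) + 1 / 4 * (ε ^ 2 * (k + 1) * (k + 2))) := by
  have hκ := inv_pos.2 hε
  have h1 := integral_norm_pow_mul_polynomial hκ P 1 hn
  have h2 := integral_norm_pow_mul_polynomial hκ P 2 hn
  have hint : ∀ j : ℕ, Integrable fun z : ℂ =>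
      (‖z‖ ^ 2) ^ j * ‖P.eval z‖ ^ 2 * Real.exp (-ε⁻¹ * ‖z‖ ^ 2) := by
    intro j
    have := (fock_of_fockS_two (fockS_two_polynomial hε (Polynomial.X ^ j * P))).2
    refine this.congr (Filter.Eventually.of_forall fun z => ?_)
    simp only [Polynomial.eval_mul, Polynomial.eval_pow, Polynomial.eval_X, norm_mul, norm_pow,
      exp_neg_norm_sq_div]
    ring
  unfold potentialEnergy
  have e : ∀ z : ℂ, (-β * ‖z‖ ^ 2 + 1 / 4 * ‖z‖ ^ 4) *
      (‖P.eval z‖ ^ 2 * Real.exp (-‖z‖ ^ 2 / ε))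
      = -β * ((‖z‖ ^ 2) ^ 1 * ‖P.eval z‖ ^ 2 * Real.exp (-ε⁻¹ * ‖z‖ ^ 2))
        + 1 / 4 * ((‖z‖ ^ 2) ^ 2 * ‖P.eval z‖ ^ 2 * Real.exp (-ε⁻¹ * ‖z‖ ^ 2)) := fun z => by
    rw [exp_neg_norm_sq_div]; ring
  simp only [e]
  rw [integral_add ((hint 1).const_mul _) ((hint 2).const_mul _), integral_const_mul,
    integral_const_mul, h1, h2, Finset.mul_sum, Finset.mul_sum, ← Finset.sum_add_distrib]
  refine Finset.sum_congr rfl fun k _ => ?_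
  rw [show 2 + k = (k + 1) + 1 by ring, add_comm 1 k, gaussMoment_succ hκ (k + 1),
    gaussMoment_succ hκ k]
  push_cast
  field_simp
  ring

end PolynomialEnergy

/-! ### A trial function of bounded energy, by random signs. -/

section RandomSigns

/-- Khinchin's inequality for the fourth moment, with constant 3; `T` is the set of indices with
sign `+`. The induction pairs `T` with `insert a T`, so odd powers of the new term cancel, and the
second moment supplies the cross term. -/
theorem sum_powerset_signs {ι : Type*} [DecidableEq ι] (A : Finset ι) (x : ι → ℂ) :
    ∑ T ∈ A.powerset, ‖∑ i ∈ A, (if i ∈ T then 1 else -1) * x i‖ ^ 2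
      = 2 ^ A.card * ∑ i ∈ A, ‖x i‖ ^ 2 ∧
    ∑ T ∈ A.powerset, ‖∑ i ∈ A, (if i ∈ T then 1 else -1) * x i‖ ^ 4
      ≤ 2 ^ A.card * (3 * (∑ i ∈ A, ‖x i‖ ^ 2) ^ 2) := by
  induction A using Finset.induction_on with
  | empty => simp
  | insert a A ha ih =>
    obtain ⟨ih2, ih4⟩ := ih
    have hs : ∀ T ∈ A.powerset, (∑ i ∈ insert a A, (if i ∈ T then 1 else -1) * x i)
        = (∑ i ∈ A, (if i ∈ T then 1 else -1) * x i) - x a := by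
      intro T hT
      have : a ∉ T := fun h => ha (Finset.mem_powerset.1 hT h)
      rw [Finset.sum_insert ha, if_neg this]; ring
    have hs' : ∀ T ∈ A.powerset, (∑ i ∈ insert a A, (if i ∈ insert a T then 1 else -1) * x i)
        = (∑ i ∈ A, (if i ∈ T then 1 else -1) * x i) + x a := by
      intro T hT
      rw [Finset.sum_insert ha, if_pos (Finset.mem_insert_self _ _), one_mul, add_comm]
      congr 1
      refine Finset.sum_congr rfl fun i hi => ?_
      have : i ≠ a := fun h => ha (h ▸ hi)
      simp [Finset.mem_insert, this]
    have p2 : ∀ u v : ℂ, ‖u - v‖ ^ 2 + ‖u + v‖ ^ 2 = 2 * ‖u‖ ^ 2 + 2 * ‖v‖ ^ 2 := by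
      intro u v
      simp only [← Complex.normSq_eq_norm_sq, Complex.normSq_apply, Complex.add_re, Complex.add_im,
        Complex.sub_re, Complex.sub_im]
      ring
    -- The two sides differ by `8 (Im (u v̄))²`.
    have p4 : ∀ u v : ℂ, ‖u - v‖ ^ 4 + ‖u + v‖ ^ 4
        ≤ 2 * ‖u‖ ^ 4 + 12 * (‖u‖ ^ 2 * ‖v‖ ^ 2) + 2 * ‖v‖ ^ 4 := by
      intro u v
      have e : ∀ w : ℂ, ‖w‖ ^ 4 = (‖w‖ ^ 2) ^ 2 := fun w => by ring
      simp only [e]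
      simp only [← Complex.normSq_eq_norm_sq, Complex.normSq_apply, Complex.add_re, Complex.add_im,
        Complex.sub_re, Complex.sub_im]
      nlinarith [sq_nonneg (u.re * v.im - u.im * v.re)]
    have hc : (insert a A).card = A.card + 1 := Finset.card_insert_of_notMem ha
    constructor
    · rw [Finset.sum_powerset_insert ha, ← Finset.sum_add_distrib,
        Finset.sum_congr rfl fun T hT => by rw [hs T hT, hs' T hT, p2], Finset.sum_add_distrib,
        ← Finset.mul_sum, ih2, Finset.sum_const, Finset.card_powerset, Finset.sum_insert ha, hc,
        nsmul_eq_mul]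
      push_cast; ring
    · rw [Finset.sum_powerset_insert ha, ← Finset.sum_add_distrib]
      have hle : ∑ T ∈ A.powerset, (‖∑ i ∈ insert a A, (if i ∈ T then 1 else -1) * x i‖ ^ 4
          + ‖∑ i ∈ insert a A, (if i ∈ insert a T then 1 else -1) * x i‖ ^ 4)
          ≤ ∑ T ∈ A.powerset, (2 * ‖∑ i ∈ A, (if i ∈ T then 1 else -1) * x i‖ ^ 4
            + 12 * (‖∑ i ∈ A, (if i ∈ T then 1 else -1) * x i‖ ^ 2 * ‖x a‖ ^ 2)
            + 2 * ‖x a‖ ^ 4) := by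
        refine Finset.sum_le_sum fun T hT => ?_
        rw [hs T hT, hs' T hT]
        exact p4 _ _
      refine hle.trans ?_
      rw [Finset.sum_add_distrib, Finset.sum_add_distrib, ← Finset.mul_sum, ← Finset.mul_sum,
        ← Finset.sum_mul, ih2, Finset.sum_const, Finset.card_powerset, Finset.sum_insert ha, hc,
        nsmul_eq_mul]
      push_cast
      have h0 : 0 ≤ (2 : ℝ) ^ A.card * ‖x a‖ ^ 4 := by positivity
      have e : (2 : ℝ) ^ (A.card + 1) = 2 ^ A.card * 2 := pow_succ _ _
      rw [e]
      linarith

end RandomSigns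

/-- About `1/ε` monomials of equal mass have a total density bounded by a constant, spread over a
disc of radius of order 1. For random signs the mean of the squared density is at most 3 times the
square of this density, so some choice of signs has bounded interaction energy. -/
theorem exists_trial {ε : ℝ} (hε : 0 < ε) (hε1 : ε < 1) (β : ℝ) {G : ℝ} (hG : 0 < G) :
    ∃ g ∈ FockS ε 2, fockMass ε g = 1 ∧
      potentialEnergy β ε g + G / 2 * quarticEnergy ε g ≤ 2 * |β| + 2 + G := by
  have hκ := inv_pos.2 hε
  set K := ⌈ε⁻¹⌉₊ with hK
  have hK1 : 1 ≤ ε * K := by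
    have := Nat.le_ceil ε⁻¹
    have := mul_le_mul_of_nonneg_left this hε.le
    rwa [mul_inv_cancel₀ hε.ne'] at this
  have hK2 : ε * K ≤ 2 := by
    have := (Nat.ceil_lt_add_one hκ.le).le
    have := mul_le_mul_of_nonneg_left this hε.le
    rw [mul_add, mul_inv_cancel₀ hε.ne'] at this
    linarith
  have hK0 : (0 : ℝ) < K := by
    by_contra h
    have : (K:ℝ) ≤ 0 := not_lt.1 h
    nlinarith
  -- Each monomial receives mass `1/K`, whatever its sign.
  set c : ℕ → ℝ := fun k => Real.sqrt ((K * gaussMoment ε⁻¹ k)⁻¹) with hc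
  have hc2 : ∀ k, c k ^ 2 = (K * gaussMoment ε⁻¹ k)⁻¹ := fun k => by
    have := gaussMoment_pos hκ k
    exact Real.sq_sqrt (by positivity)
  set P : Finset ℕ → Polynomial ℂ := fun T => ∑ k ∈ Finset.range K,
    Polynomial.monomial k ((if k ∈ T then 1 else -1) * (c k : ℂ)) with hP
  have hcoeff : ∀ T k, k < K → (P T).coeff k = (if k ∈ T then 1 else -1) * (c k : ℂ) := by
    intro T k hk
    simp only [hP, Polynomial.finsetSum_coeff, Polynomial.coeff_monomial]
    rw [Finset.sum_ite_eq', if_pos (Finset.mem_range.2 hk)]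
  have hnorm : ∀ T k, k < K → ‖(P T).coeff k‖ ^ 2 * gaussMoment ε⁻¹ k = (K : ℝ)⁻¹ := by
    intro T k hk
    have h1 : ‖(if k ∈ T then (1 : ℂ) else -1)‖ = 1 := by split_ifs <;> simp
    have := gaussMoment_pos hκ k
    rw [hcoeff T k hk, norm_mul, h1, one_mul, Complex.norm_real, Real.norm_eq_abs, sq_abs, hc2,
      mul_inv,
      mul_assoc, inv_mul_cancel₀ this.ne', mul_one]
  have hdeg : ∀ T, (P T).natDegree < K := by
    intro T
    have hKn : 0 < K := by exact_mod_cast hK0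
    refine lt_of_le_of_lt (Polynomial.natDegree_sum_le_of_forall_le (n := K - 1) _ _
      fun k hk => ?_) (by omega)
    refine (Polynomial.natDegree_monomial_le _).trans ?_
    have := Finset.mem_range.1 hk
    omega
  have hmass : ∀ T, fockMass ε (fun z => (P T).eval z) = 1 := by
    intro T
    rw [fockMass_polynomial hε _ (hdeg T),
      Finset.sum_congr rfl fun k hk => hnorm T k (Finset.mem_range.1 hk)]
    simp [hK0.ne']
  have hpot : ∀ T, potentialEnergy β ε (fun z => (P T).eval z) ≤ 2 * |β| + 3 / 2 := by
    intro T
    rw [potentialEnergy_polynomial hε _ (hdeg T)]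
    calc _ ≤ ∑ k ∈ Finset.range K, (K : ℝ)⁻¹ * (2 * |β| + 3 / 2) := by
          refine Finset.sum_le_sum fun k hk => ?_
          have hk' := Finset.mem_range.1 hk
          rw [hnorm T k hk']
          have hkK : (k : ℝ) + 1 ≤ K := by exact_mod_cast hk'
          have h1 : ε * (k + 1) ≤ 2 := (mul_le_mul_of_nonneg_left hkK hε.le).trans hK2
          have h0 : 0 ≤ ε * ((k : ℝ) + 1) := by positivity
          have h2 : ε * (k + 2) ≤ 3 := by linarith
          have h3 : ε ^ 2 * (k + 1) * (k + 2) ≤ 6 := by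
            calc _ = (ε * (k + 1)) * (ε * (k + 2)) := by ring
              _ ≤ 2 * 3 := by gcongr
              _ = 6 := by norm_num
          have h4 : -β * (ε * (k + 1)) ≤ |β| * 2 := by
            calc _ ≤ |β| * (ε * (k + 1)) := mul_le_mul_of_nonneg_right (neg_le_abs β) h0
              _ ≤ _ := mul_le_mul_of_nonneg_left h1 (abs_nonneg _)
          refine mul_le_mul_of_nonneg_left ?_ (by positivity)
          linarith
      _ = _ := by
        rw [Finset.sum_const, Finset.card_range, nsmul_eq_mul, ← mul_assoc,
          mul_inv_cancel₀ hK0.ne', one_mul]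
  set ρ : ℂ → ℝ := fun z => (∑ k ∈ Finset.range K, ‖(c k : ℂ) * z ^ k‖ ^ 2) *
    Real.exp (-‖z‖ ^ 2 / ε) with hρ
  have hterm : ∀ k (z : ℂ), ‖(c k : ℂ) * z ^ k‖ ^ 2
      = (K * Real.pi * ε)⁻¹ * ((ε⁻¹ * ‖z‖ ^ 2) ^ k / k.factorial) := by
    intro k z
    rw [norm_mul, mul_pow, Complex.norm_real, Real.norm_eq_abs, sq_abs, hc2, norm_pow, gaussMoment,
      mul_pow]
    simp only [inv_pow]
    field_simp
    ring
  -- The sum is a partial sum of the series of `exp(|z|²/ε)`, which the Gaussian weight cancels.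
  have hρle : ∀ z, ρ z ≤ (K * Real.pi * ε)⁻¹ := by
    intro z
    simp only [hρ, hterm]
    rw [← Finset.mul_sum, mul_assoc]
    refine mul_le_of_le_one_right (by positivity) ?_
    calc _ ≤ Real.exp (ε⁻¹ * ‖z‖ ^ 2) * Real.exp (-‖z‖ ^ 2 / ε) := by
          gcongr
          exact Real.sum_le_exp_of_nonneg (by positivity) K
      _ = 1 := by
          rw [exp_neg_norm_sq_div, ← Real.exp_add]
          simp
  have hρ0 : ∀ z, 0 ≤ ρ z := fun z => by positivity
  have hρi : Integrable ρ ∧ ∫ z, ρ z = 1 := by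
    have hi : ∀ k, Integrable fun z : ℂ => ‖(c k : ℂ) * z ^ k‖ ^ 2 * Real.exp (-‖z‖ ^ 2 / ε) := by
      intro k
      have := (fock_of_fockS_two (fockS_two_polynomial hε (Polynomial.monomial k (c k : ℂ)))).2
      simpa only [Polynomial.eval_monomial] using this
    simp only [hρ, Finset.sum_mul]
    refine ⟨integrable_finsetSum _ fun k _ => hi k, ?_⟩
    rw [integral_finsetSum _ fun k _ => hi k]
    have : ∀ k, ∫ z : ℂ, ‖(c k : ℂ) * z ^ k‖ ^ 2 * Real.exp (-‖z‖ ^ 2 / ε) = (K : ℝ)⁻¹ := by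
      intro k
      have e : ∀ z : ℂ, ‖(c k : ℂ) * z ^ k‖ ^ 2 * Real.exp (-‖z‖ ^ 2 / ε)
          = c k ^ 2 * ((‖z‖ ^ 2) ^ k * Real.exp (-ε⁻¹ * ‖z‖ ^ 2)) := fun z => by
        rw [exp_neg_norm_sq_div, norm_mul, Complex.norm_real, Real.norm_eq_abs, mul_pow, sq_abs,
          norm_pow]
        ring
      simp only [e]
      rw [integral_const_mul, integral_norm_sq_pow_mul_exp_neg k hκ, hc2]
      change (K * gaussMoment ε⁻¹ k)⁻¹ * gaussMoment ε⁻¹ k = _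
      rw [mul_inv, mul_assoc, inv_mul_cancel₀ (gaussMoment_pos hκ k).ne', mul_one]
    simp only [this]
    simp [hK0.ne']
  have heval : ∀ T (z : ℂ), (P T).eval z
      = ∑ k ∈ Finset.range K, (if k ∈ T then 1 else -1) * ((c k : ℂ) * z ^ k) := by
    intro T z
    simp only [hP, Polynomial.eval_finsetSum, Polynomial.eval_monomial, mul_assoc]
  have hsum : ∑ T ∈ (Finset.range K).powerset, quarticEnergy ε (fun z => (P T).eval z)
      ≤ ∑ T ∈ (Finset.range K).powerset, 3 * (K * Real.pi * ε)⁻¹ := by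
    rw [Finset.sum_const, Finset.card_powerset, Finset.card_range, nsmul_eq_mul]
    unfold quarticEnergy
    rw [← integral_finsetSum _ fun T _ => integrable_quartic hε (fockS_two_polynomial hε (P T))]
    calc _ ≤ ∫ z, (2 : ℝ) ^ K * (3 * (K * Real.pi * ε)⁻¹) * ρ z := by
          refine integral_mono (integrable_finsetSum _ fun T _ =>
            integrable_quartic hε (fockS_two_polynomial hε (P T))) (hρi.1.const_mul _) fun z => ?_
          have h := (sum_powerset_signs (Finset.range K) fun k => (c k : ℂ) * z ^ k).2
          have h2 := mul_le_mul_of_nonneg_right h (sq_nonneg (Real.exp (-‖z‖ ^ 2 / ε)))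
          rw [Finset.card_range] at h2
          calc _ = (∑ T ∈ (Finset.range K).powerset, ‖∑ k ∈ Finset.range K,
                (if k ∈ T then 1 else -1) * ((c k : ℂ) * z ^ k)‖ ^ 4)
                  * Real.exp (-‖z‖ ^ 2 / ε) ^ 2 := by
                rw [Finset.sum_mul]
                refine Finset.sum_congr rfl fun T _ => ?_
                simp only [heval]
                ring
            _ ≤ _ := h2
            _ = (2 : ℝ) ^ K * 3 * (ρ z * ρ z) := by simp only [hρ]; ring
            _ ≤ (2 : ℝ) ^ K * 3 * ((K * Real.pi * ε)⁻¹ * ρ z) := by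
                have := mul_le_mul_of_nonneg_right (hρle z) (hρ0 z)
                gcongr
            _ = _ := by ring
      _ = _ := by rw [integral_const_mul, hρi.2]; push_cast; ring
  -- Some choice of signs does no worse than the average.
  obtain ⟨T, -, hT⟩ := Finset.exists_le_of_sum_le ⟨∅, Finset.empty_mem_powerset _⟩ hsum
  refine ⟨_, fockS_two_polynomial hε (P T), hmass T, ?_⟩
  have hB : 3 * (K * Real.pi * ε)⁻¹ ≤ 1 := by
    rw [← div_eq_mul_inv, div_le_one (by positivity)]
    nlinarith [Real.pi_gt_three]
  have h1 := hpot T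
  have h2 := mul_le_mul_of_nonneg_left (hT.trans hB) (by positivity : 0 ≤ G / 2)
  linarith

/-! ### Blow-up of the energy of monomials. -/

theorem sixteen_pow_le_centralBinom_sq (n : ℕ) :
    16 ^ n ≤ n.centralBinom ^ 2 * (4 * (n + 1)) := by
  -- For `n ≥ 1` the stronger bound with `4n` is the one that passes through the induction, since
  -- `16 n(n+1) ≤ (2(2n+1))²`.
  have key : ∀ m : ℕ, 16 ^ (m + 1) ≤ (m + 1).centralBinom ^ 2 * (4 * (m + 1)) := by
    intro m
    induction m with
    | zero => decide
    | succ m ih =>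
      have h := Nat.succ_mul_centralBinom_succ (m + 1)
      set a := (m + 1).centralBinom
      set b := (m + 1 + 1).centralBinom
      have h2 : (m + 1 + 1) ^ 2 * b ^ 2 = (2 * (2 * (m + 1) + 1)) ^ 2 * a ^ 2 := by
        rw [← mul_pow, ← mul_pow, h]
      refine Nat.le_of_mul_le_mul_left ?_ (by positivity : 0 < (m + 1 + 1) * (m + 1))
      calc (m + 1 + 1) * (m + 1) * 16 ^ (m + 1 + 1)
          = 16 * ((m + 1 + 1) * (m + 1)) * 16 ^ (m + 1) := by ring
        _ ≤ 16 * ((m + 1 + 1) * (m + 1)) * (a ^ 2 * (4 * (m + 1))) := by gcongr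
        _ ≤ 4 * (m + 1) * ((2 * (2 * (m + 1) + 1)) ^ 2 * a ^ 2) := by
            have : 16 * ((m + 1 + 1) * (m + 1)) ≤ (2 * (2 * (m + 1) + 1)) ^ 2 := by nlinarith
            calc _ = 4 * (m + 1) * (16 * ((m + 1 + 1) * (m + 1)) * a ^ 2) := by ring
              _ ≤ _ := by gcongr
        _ = _ := by rw [← h2]; ring
  cases n with
  | zero => simp
  | succ m => exact (key m).trans (by gcongr; omega)

/-- This ratio is the interaction energy of the normalised monomial of degree `n`, up to the factor
`1/(2πε)`. -/
theorem centralBinom_div_lower (n : ℕ) :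
    (2 * Real.sqrt (n + 1))⁻¹ ≤ (n.centralBinom : ℝ) / 4 ^ n := by
  have h : (16 : ℝ) ^ n ≤ (n.centralBinom : ℝ) ^ 2 * (4 * (n + 1)) := by
    exact_mod_cast sixteen_pow_le_centralBinom_sq n
  have hs := Real.sq_sqrt (by positivity : (0:ℝ) ≤ n + 1)
  have hs0 : 0 < Real.sqrt ((n:ℝ) + 1) := Real.sqrt_pos.2 (by positivity)
  rw [inv_eq_one_div, div_le_div_iff₀ (by positivity) (by positivity), one_mul]
  refine le_of_sq_le_sq ?_ (by positivity)
  calc ((4 : ℝ) ^ n) ^ 2 = 16 ^ n := by rw [← pow_mul, mul_comm, pow_mul]; norm_num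
    _ ≤ _ := h
    _ = _ := by rw [mul_pow, mul_pow, hs]; ring

theorem neg_sq_le_potential (β x : ℝ) : -β ^ 2 ≤ -β * x + 1 / 4 * x ^ 2 := by
  nlinarith [sq_nonneg (x / 2 - β)]

/-- The energy of monomials blows up as `ε → 0`, uniformly in the degree. -/
theorem exists_monomial_energy_lt (β : ℝ) {G : ℝ} (hG : 0 < G) {C : ℝ} (hC : 0 ≤ C) :
    ∃ ε₁ : ℝ, 0 < ε₁ ∧ ∀ ε, 0 < ε → ε < ε₁ → ∀ (N : ℕ) (a : ℂ),
      fockMass ε (fun z => (Polynomial.monomial N a).eval z) = 1 →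
      C < potentialEnergy β ε (fun z => (Polynomial.monomial N a).eval z)
        + G / 2 * quarticEnergy ε (fun z => (Polynomial.monomial N a).eval z) := by
  -- With `r = ε(N+1)`, the mean of `|z|²`: for `r ≥ R` the potential alone exceeds `C`. For `r < R`
  -- the interaction is at least `G / (8π √(εr))`, and `D` is chosen so that this exceeds `C + β²`
  -- once `εR < (G/D)²`.
  set R := 4 * (|β| + C + 1) with hR
  set D := 8 * Real.pi * (C + β ^ 2 + 1) with hD
  have hRp : 0 < R := by positivity
  have hDp : 0 < D := by positivity
  refine ⟨(G / D) ^ 2 / R, by positivity, fun ε hε hlt N a hm => ?_⟩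
  have hκ := inv_pos.2 hε
  have hmN := gaussMoment_pos hκ N
  have hdeg : (Polynomial.monomial N a).natDegree < N + 1 :=
    Nat.lt_succ_of_le (Polynomial.natDegree_monomial_le _)
  have hsingle : ∀ F : ℕ → ℝ, ∑ k ∈ Finset.range (N + 1),
      ‖(Polynomial.monomial N a).coeff k‖ ^ 2 * F k = ‖a‖ ^ 2 * F N := by
    intro F
    rw [Finset.sum_eq_single N]
    · simp
    · intro k _ hk
      rw [Polynomial.coeff_monomial, if_neg (Ne.symm hk)]; simp
    · simp
  rw [fockMass_polynomial hε _ hdeg, hsingle] at hm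
  have hpot : potentialEnergy β ε (fun z => (Polynomial.monomial N a).eval z)
      = -β * (ε * (N + 1)) + 1 / 4 * (ε ^ 2 * (N + 1) * (N + 2)) := by
    rw [potentialEnergy_polynomial hε _ hdeg]
    simp only [mul_assoc (‖_‖ ^ 2)]
    rw [hsingle, ← mul_assoc, hm, one_mul]
  have hquart : quarticEnergy ε (fun z => (Polynomial.monomial N a).eval z)
      = ε⁻¹ / (2 * Real.pi) * (N.centralBinom / 4 ^ N) := by
    unfold quarticEnergy
    have e : ∀ z : ℂ, (‖(Polynomial.monomial N a).eval z‖ ^ 2 * Real.exp (-‖z‖ ^ 2 / ε)) ^ 2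
        = (‖a‖ ^ 2) ^ 2 * ((‖z‖ ^ 2) ^ (2 * N) * Real.exp (-(2 * ε⁻¹) * ‖z‖ ^ 2)) := by
      intro z
      rw [exp_neg_norm_sq_div, mul_pow, ← Real.exp_nat_mul, Polynomial.eval_monomial, norm_mul,
        norm_pow]
      push_cast
      rw [show (2 : ℝ) * (-ε⁻¹ * ‖z‖ ^ 2) = -(2 * ε⁻¹) * ‖z‖ ^ 2 by ring]
      ring
    simp only [e]
    -- The moment `(2N)!` for the weight `2/ε`, divided by the square of `N!` from the
    -- normalisation, produces the central binomial coefficient.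
    rw [integral_const_mul, integral_norm_sq_pow_mul_exp_neg _ (by positivity),
      eq_div_of_mul_eq hmN.ne' hm, gaussMoment, Nat.centralBinom, Nat.cast_choose ℝ (by omega),
      show 2 * N - N = N by omega, show (4 : ℝ) ^ N = 2 ^ (2 * N) by rw [pow_mul]; norm_num,
      mul_pow]
    simp only [inv_pow]
    field_simp
    ring
  rw [hpot, hquart]
  set r := ε * ((N : ℝ) + 1) with hr
  have hr0 : 0 < r := by positivity
  have hr2 : r ^ 2 ≤ ε ^ 2 * (N + 1) * (N + 2) := by
    have : 0 ≤ ε ^ 2 * ((N : ℝ) + 1) := by positivity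
    rw [hr]; nlinarith
  have hq0 : 0 ≤ G / 2 * (ε⁻¹ / (2 * Real.pi) * (N.centralBinom / 4 ^ N)) := by positivity
  rcases le_or_gt R r with h | h
  · have h1 : (|β| + C + 1) * r ≤ 1 / 4 * r ^ 2 := by nlinarith
    have h2 : -|β| * r ≤ -β * r := by nlinarith [le_abs_self β]
    have h3 : 1 ≤ r := by
      have : 1 ≤ R := by rw [hR]; nlinarith [abs_nonneg β]
      linarith
    nlinarith
  · have h1 := neg_sq_le_potential β r
    have h2 := centralBinom_div_lower N
    have hs : Real.sqrt (N + 1) = Real.sqrt (r / ε) := by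
      congr 1; rw [hr]; field_simp
    have hkey : C + β ^ 2 + 1 ≤ G / 2 * (ε⁻¹ / (2 * Real.pi) * (2 * Real.sqrt (N + 1))⁻¹) := by
      have hse : Real.sqrt (N + 1) * ε ≤ G / D := by
        rw [hs]
        refine le_of_sq_le_sq ?_ (by positivity)
        rw [mul_pow, Real.sq_sqrt (by positivity)]
        rw [lt_div_iff₀ hRp] at hlt
        calc r / ε * ε ^ 2 = ε * r := by field_simp
          _ ≤ ε * R := by gcongr
          _ ≤ _ := hlt.le
      have hs0 : 0 < Real.sqrt ((N : ℝ) + 1) := Real.sqrt_pos.2 (by positivity)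
      rw [le_div_iff₀ hDp, hD] at hse
      rw [show G / 2 * (ε⁻¹ / (2 * Real.pi) * (2 * Real.sqrt (N + 1))⁻¹)
        = G / (8 * Real.pi * (Real.sqrt (N + 1) * ε)) by field_simp; norm_num]
      rw [le_div_iff₀ (by positivity)]
      linarith
    have h3 : G / 2 * (ε⁻¹ / (2 * Real.pi) * (2 * Real.sqrt (N + 1))⁻¹)
        ≤ G / 2 * (ε⁻¹ / (2 * Real.pi) * (N.centralBinom / 4 ^ N)) := by gcongr
    linarith

/-! ### Hadamard factorisation for finitely many zeros. -/

section FiniteZeros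

open Filter Topology

/-- An entire function divided by the full power of `z - z₀` at a point. -/
theorem exists_entire_eq_pow_mul {f : ℂ → ℂ} (hf : Differentiable ℂ f) (hne : ∃ z, f z ≠ 0)
    (z₀ : ℂ) : ∃ (n : ℕ) (g : ℂ → ℂ), Differentiable ℂ g ∧ g z₀ ≠ 0 ∧
      ∀ z, f z = (z - z₀) ^ n * g z := by
  have ha : AnalyticAt ℂ f z₀ := hf.analyticAt z₀
  have htop : analyticOrderAt f z₀ ≠ ⊤ := by
    intro h
    rw [analyticOrderAt_eq_top] at h
    obtain ⟨z, hz⟩ := hne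
    have hA : AnalyticOnNhd ℂ f Set.univ := fun w _ => hf.analyticAt w
    exact hz (hA.eqOn_zero_of_preconnected_of_eventuallyEq_zero isPreconnected_univ
      (Set.mem_univ z₀) h (Set.mem_univ z))
  obtain ⟨g₀, hg₀, hne₀, heq⟩ := ha.analyticOrderAt_ne_top.1 htop
  set n := analyticOrderNatAt f z₀
  classical
  set g : ℂ → ℂ := fun z => if z = z₀ then g₀ z₀ else f z / (z - z₀) ^ n with hg
  have hfg : ∀ z, z ≠ z₀ → f z = (z - z₀) ^ n * g z := by
    intro z hz
    have : (z - z₀) ^ n ≠ 0 := pow_ne_zero _ (sub_ne_zero.2 hz)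
    simp only [hg, if_neg hz]
    field_simp
  have hloc : g =ᶠ[𝓝 z₀] g₀ := by
    filter_upwards [heq] with z hz
    by_cases h : z = z₀
    · simp [hg, h]
    · have : (z - z₀) ^ n ≠ 0 := pow_ne_zero _ (sub_ne_zero.2 h)
      simp only [hg, if_neg h, hz, smul_eq_mul]
      field_simp
  refine ⟨n, g, fun z => ?_, by simpa [hg] using hne₀, fun z => ?_⟩
  · by_cases h : z = z₀
    · rw [h]
      exact hg₀.differentiableAt.congr_of_eventuallyEq hloc
    · have h1 : DifferentiableAt ℂ (fun w => f w / (w - z₀) ^ n) z :=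
        (hf z).div (by fun_prop) (pow_ne_zero _ (sub_ne_zero.2 h))
      refine h1.congr_of_eventuallyEq ?_
      filter_upwards [isOpen_ne.mem_nhds h] with w hw
      simp only [hg, if_neg hw]
  · by_cases h : z = z₀
    · have := heq.self_of_nhds
      rw [h, this]
      simp [hg]
    · exact hfg z h

/-- Zeros are divided out one at a time, by induction on their number. The lower bound on `P` away
from the origin lets `g` inherit growth bounds from `f` on large circles. -/
theorem exists_polynomial_mul_nonvanishing {f : ℂ → ℂ} (hf : Differentiable ℂ f)
    (hne : ∃ z, f z ≠ 0) (hfin : {z | f z = 0}.Finite) :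
    ∃ (P : Polynomial ℂ) (R₀ : ℝ) (g : ℂ → ℂ), Differentiable ℂ g ∧ (∀ z, g z ≠ 0) ∧
      (∀ z, f z = P.eval z * g z) ∧ ∀ z, R₀ ≤ ‖z‖ → 1 ≤ ‖P.eval z‖ := by
  induction hn : {z | f z = 0}.ncard using Nat.strong_induction_on generalizing f with
  | _ n ih =>
    by_cases hz : ∃ z₀, f z₀ = 0
    · obtain ⟨z₀, hz₀⟩ := hz
      obtain ⟨m, g, hg, hg0, hfg⟩ := exists_entire_eq_pow_mul hf hne z₀
      have hsub : {z | g z = 0} ⊂ {z | f z = 0} := by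
        refine ⟨fun z hz => ?_, fun h => ?_⟩
        · have hz' : g z = 0 := hz
          show f z = 0
          rw [hfg, hz', mul_zero]
        · exact hg0 (h hz₀)
      obtain ⟨P, R₀, k, hk, hk0, hgk, hP⟩ := ih _ (hn ▸ Set.ncard_lt_ncard hsub hfin) hg
        ⟨z₀, hg0⟩ (hfin.subset hsub.1) rfl
      refine ⟨(Polynomial.X - Polynomial.C z₀) ^ m * P, max R₀ (‖z₀‖ + 1), k, hk, hk0,
        fun z => ?_, fun z hz => ?_⟩
      · rw [hfg, hgk]; simp [mul_assoc]
      · have h1 : 1 ≤ ‖z - z₀‖ := by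
          have := norm_sub_norm_le z z₀
          have := le_of_max_le_right hz
          linarith
        simp only [Polynomial.eval_mul, Polynomial.eval_pow, Polynomial.eval_sub,
          Polynomial.eval_X, Polynomial.eval_C, norm_mul, norm_pow]
        exact one_le_mul_of_one_le_of_one_le (one_le_pow₀ h1) (hP z (le_of_max_le_left hz))
    · push Not at hz
      exact ⟨1, 0, f, hf, hz, by simp, by simp⟩

/-- `g'/g` is entire and so has a primitive `h`; then `g exp(-h)` has derivative 0. The
normalisation at 0 serves the Borel-Carathéodory inequality. -/
theorem exists_eq_const_mul_exp {g : ℂ → ℂ} (hg : Differentiable ℂ g) (h0 : ∀ z, g z ≠ 0) :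
    ∃ h : ℂ → ℂ, Differentiable ℂ h ∧ h 0 = 0 ∧ ∀ z, g z = g 0 * Complex.exp (h z) := by
  have hd : Differentiable ℂ fun z => deriv g z / g z :=
    fun z => (hg.analyticAt z).deriv.differentiableAt.div (hg z) (h0 z)
  obtain ⟨h, hh0, hh⟩ := hd.isExactOn_univ.with_val_at 0 0
  have hh' : ∀ z, HasDerivAt h (deriv g z / g z) z := fun z => hh z (Set.mem_univ z)
  refine ⟨h, fun z => (hh' z).differentiableAt, hh0, fun z => ?_⟩
  have hder : ∀ w, HasDerivAt (fun w => g w * Complex.exp (-h w)) 0 w := by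
    intro w
    have := (hg w).hasDerivAt.mul (hh' w).neg.cexp
    convert! this using 1
    have := h0 w
    field_simp
    ring
  have hc := is_const_of_deriv_eq_zero (fun w => (hder w).differentiableAt)
    (fun w => (hder w).deriv) z 0
  simp only [hh0, neg_zero, Complex.exp_zero, mul_one] at hc
  rw [← hc, mul_assoc, ← Complex.exp_add, neg_add_cancel, Complex.exp_zero, mul_one]

/-- An entire function whose real part grows at most quadratically is a quadratic polynomial. -/
theorem eq_quadratic_of_re_le {h : ℂ → ℂ} (hh : Differentiable ℂ h) (h0 : h 0 = 0) {m R₁ : ℝ}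
    (hm : 0 < m) (hre : ∀ R, R₁ ≤ R → ∀ z, ‖z‖ ≤ R → (h z).re ≤ m * (1 + R ^ 2)) :
    ∃ a b : ℂ, ∀ z, h z = a * z ^ 2 + b * z := by
  have hzero : ∀ n, 3 ≤ n → iteratedDeriv n h 0 = 0 := by
    intro n hn
    -- Borel-Carathéodory bounds `|h|` by a multiple of `1 + R²` on the circle of radius `R/2`;
    -- Cauchy's estimate then makes derivatives of order at least 3 at 0 `O(1/R)`.
    have hbound : ∀ R, max R₁ 1 ≤ R → ‖iteratedDeriv n h 0‖
        ≤ (n.factorial * 2 ^ n * 4 * m) / R := by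
      intro R hR
      have hR1 : 1 ≤ R := le_of_max_le_right hR
      have hM : 0 < m * (1 + R ^ 2) := by positivity
      have hsph : ∀ z ∈ Metric.sphere (0:ℂ) (R / 2), ‖h z‖ ≤ 2 * (m * (1 + R ^ 2)) := by
        intro z hz
        have hz' : ‖z‖ = R / 2 := by simpa using hz
        have := Complex.borelCaratheodory_zero hM hh.differentiableOn
          (fun w hw => hre R (le_of_max_le_left hR) w (by
            have : ‖w‖ < R := by simpa using hw
            exact this.le)) (by linarith) (z := z) (by simp [hz']; linarith) h0
        rw [hz'] at this
        refine this.trans (le_of_eq ?_)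
        have : R - R / 2 = R / 2 := by ring
        rw [this]
        field_simp
      have h1 := Complex.norm_iteratedDeriv_le_of_forall_mem_sphere_norm_le n
        (by linarith : 0 < R / 2) hh.diffContOnCl hsph
      refine h1.trans ?_
      rw [div_pow, div_le_div_iff₀ (by positivity) (by linarith)]
      have h2 : (1 + R ^ 2) * R ≤ 2 * R ^ n := by
        have h3 : R ^ 3 ≤ R ^ n := pow_le_pow_right₀ hR1 hn
        nlinarith
      calc n.factorial * (2 * (m * (1 + R ^ 2))) * R
          = n.factorial * 2 * m * ((1 + R ^ 2) * R) := by ring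
        _ ≤ n.factorial * 2 * m * (2 * R ^ n) := by gcongr
        _ = _ := by field_simp; norm_num
    by_contra hne
    have hpos : 0 < ‖iteratedDeriv n h 0‖ := norm_pos_iff.2 hne
    set X := ‖iteratedDeriv n h 0‖
    set K := (n.factorial * 2 ^ n * 4 * m : ℝ)
    have hK : 0 < K := by positivity
    have hb := hbound (max R₁ 1 + K / X) (by
      have : 0 < K / X := by positivity
      linarith)
    have h1 : 1 ≤ max R₁ 1 := le_max_right _ _
    rw [le_div_iff₀ (by positivity)] at hb
    have : X * (K / X) = K := by field_simp
    nlinarith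
  have hT := fun z => Complex.taylorSeries_eq_of_entire' 0 z hh
  refine ⟨(2 : ℂ)⁻¹ * iteratedDeriv 2 h 0, iteratedDeriv 1 h 0, fun z => ?_⟩
  rw [← hT z, tsum_eq_sum (s := Finset.range 3)]
  · simp [Finset.sum_range_succ, h0]; ring
  · intro n hn
    rw [hzero n (by simpa using hn)]; simp

/-- Hadamard factorization for functions of order two with finitely many zeros. -/
theorem exists_polynomial_mul_exp_quadratic {f : ℂ → ℂ} (hf : Differentiable ℂ f)
    (hne : ∃ z, f z ≠ 0) (hfin : {z | f z = 0}.Finite) {C α : ℝ} (hα : 0 < α)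
    (hgr : ∀ z, ‖f z‖ ≤ C * Real.exp (α * ‖z‖ ^ 2)) :
    ∃ (P : Polynomial ℂ) (a b : ℂ), P ≠ 0 ∧
      ∀ z, f z = P.eval z * Complex.exp (a * z ^ 2 + b * z) := by
  obtain ⟨P, R₀, g, hg, hg0, hfg, hP⟩ := exists_polynomial_mul_nonvanishing hf hne hfin
  obtain ⟨h, hh, hh0, hgh⟩ := exists_eq_const_mul_exp hg hg0
  have hC : 0 < C := by
    obtain ⟨z, hz⟩ := hne
    by_contra hC
    have := hgr z
    have h1 : C * Real.exp (α * ‖z‖ ^ 2) ≤ 0 :=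
      mul_nonpos_of_nonpos_of_nonneg (not_lt.1 hC) (Real.exp_pos _).le
    exact hz (norm_le_zero_iff.1 (this.trans h1))
  have hg00 : 0 < ‖g 0‖ := norm_pos_iff.2 (hg0 0)
  obtain ⟨a, b, hab⟩ := eq_quadratic_of_re_le hh hh0 (m := |Real.log (C / ‖g 0‖)| + α)
    (R₁ := max R₀ 1) (by positivity) (by
      intro R hR z hz
      have hR1 : 1 ≤ R := le_of_max_le_right hR
      have hball : z ∈ closure (Metric.ball (0:ℂ) R) := by
        rw [closure_ball _ (by linarith)]; simpa using hz
      -- On the circle `|P| ≥ 1`, so `|g| ≤ |f|` there; the maximum principle carries the bound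
      -- inside, past the zeros of `P`.
      have hmax := Complex.norm_le_of_forall_mem_frontier_norm_le Metric.isBounded_ball
        hg.diffContOnCl (C := C * Real.exp (α * R ^ 2)) (fun w hw => by
          rw [frontier_ball _ (by linarith)] at hw
          have hw' : ‖w‖ = R := by simpa using hw
          have h1 := hgr w
          rw [hfg, norm_mul, hw'] at h1
          have h2 := hP w (by rw [hw']; exact le_of_max_le_left hR)
          exact (le_mul_of_one_le_left (norm_nonneg _) h2).trans h1) hball
      rw [hgh, norm_mul, Complex.norm_exp] at hmax
      have h3 : Real.exp (h z).re ≤ C / ‖g 0‖ * Real.exp (α * R ^ 2) := by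
        rw [div_mul_eq_mul_div, le_div_iff₀ hg00]; linarith
      rw [← Real.exp_log (by positivity : 0 < C / ‖g 0‖), ← Real.exp_add, Real.exp_le_exp] at h3
      have h4 := le_abs_self (Real.log (C / ‖g 0‖))
      have h5 := abs_nonneg (Real.log (C / ‖g 0‖))
      nlinarith [mul_nonneg h5 (sq_nonneg R)])
  refine ⟨P * Polynomial.C (g 0), a, b, ?_, fun z => ?_⟩
  · intro hzero
    obtain ⟨z, hz⟩ := hne
    apply hz
    have := congrArg (Polynomial.eval z) hzero
    simp only [Polynomial.eval_mul, Polynomial.eval_C, Polynomial.eval_zero] at this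
    rw [hfg, hgh, ← mul_assoc, this, zero_mul]
  · rw [hfg, hgh, hab]; simp [mul_assoc]

end FiniteZeros

/-! ### The bound on the quadratic coefficient of the exponent. -/

section QuadraticCoefficient

open Filter Topology

/-- A direction in which `|exp(az² + bz)|` grows fastest: `a` fixes `u` up to sign, and the sign is
chosen for `b`. -/
theorem exists_unit_mul_sq (a b : ℂ) :
    ∃ u : ℂ, ‖u‖ = 1 ∧ a * u ^ 2 = (‖a‖ : ℂ) ∧ 0 ≤ (b * u).re := by
  set v : ℂ := Complex.exp ((-(Complex.arg a) / 2 : ℝ) * Complex.I) with hv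
  have hv1 : ‖v‖ = 1 := Complex.norm_exp_ofReal_mul_I _
  have hva : a * v ^ 2 = (‖a‖ : ℂ) := by
    conv_lhs => rw [← Complex.norm_mul_exp_arg_mul_I a]
    rw [hv, ← Complex.exp_nat_mul, mul_assoc, ← Complex.exp_add]
    have : (Complex.arg a : ℂ) * Complex.I
        + (2 : ℕ) * (((-(Complex.arg a) / 2 : ℝ) : ℂ) * Complex.I) = 0 := by
      push_cast; ring
    rw [this, Complex.exp_zero, mul_one]
  rcases le_total 0 (b * v).re with h | h
  · exact ⟨v, hv1, hva, h⟩
  · exact ⟨-v, by rw [norm_neg, hv1], by rw [neg_sq, hva], by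
      rw [mul_neg, Complex.neg_re]; linarith⟩

/-- Otherwise the exponential compensates the Gaussian along a ray. Since `z f` is still in the Fock
space, the pointwise bound would make `|z P(z)|` bounded on that ray, although `X * P` has positive
degree. The extra factor `z` covers constant `P`. -/
theorem two_mul_norm_lt_of_mem_fockS {ε : ℝ} (hε : 0 < ε) {P : Polynomial ℂ} (hP : P ≠ 0) {a b : ℂ}
    (hf : (fun z => P.eval z * Complex.exp (a * z ^ 2 + b * z)) ∈ FockS ε 2) :
    2 * ‖a‖ < ε⁻¹ := by
  by_contra hcon
  have hcon := not_lt.1 hcon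
  set f : ℂ → ℂ := fun z => P.eval z * Complex.exp (a * z ^ 2 + b * z) with hfdef
  have hfc := hf.1.continuous
  have hzf : (fun z => z * f z) ∈ Fock ε := by
    refine ⟨differentiable_id.mul hf.1, integrable_of_norm_le hf (by fun_prop) 1 fun z => ?_⟩
    rw [Real.norm_of_nonneg (by positivity), norm_mul, mul_pow, one_mul, mul_assoc]
    exact mul_le_mul_of_nonneg_right (by nlinarith [sq_nonneg ‖z‖, sq_nonneg (‖z‖ ^ 2)])
      (by positivity)
  have hb := norm_sq_mul_exp_le hε hzf
  set D := (Real.pi * ε)⁻¹ * ∫ w : ℂ, ‖w * f w‖ ^ 2 * Real.exp (-‖w‖ ^ 2 / ε)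
  obtain ⟨u, hu1, hu2, hu3⟩ := exists_unit_mul_sq a b
  have hdeg : 0 < (Polynomial.X * P).degree := by
    rw [Polynomial.degree_mul, Polynomial.degree_X]
    have : 0 ≤ P.degree := Polynomial.zero_le_degree_iff.2 hP
    exact lt_of_lt_of_le (by norm_num : (0 : WithBot ℕ) < 1) (le_add_of_nonneg_right this)
  have ht : Tendsto (fun r : ℝ => ‖(Polynomial.X * P).eval ((r : ℂ) * u)‖) atTop atTop := by
    refine Polynomial.tendsto_norm_atTop _ hdeg ?_
    simp only [norm_mul, hu1, mul_one, Complex.norm_real]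
    exact tendsto_norm_atTop_atTop
  have hle : ∀ r : ℝ, 0 ≤ r → ‖(Polynomial.X * P).eval ((r : ℂ) * u)‖ ^ 2 ≤ D := by
    intro r hr
    refine le_trans ?_ (hb (r * u))
    have hn : ‖(r : ℂ) * u‖ = r := by
      rw [norm_mul, hu1, mul_one, Complex.norm_real, Real.norm_of_nonneg hr]
    have hre : (a * ((r : ℂ) * u) ^ 2 + b * ((r : ℂ) * u)).re = ‖a‖ * r ^ 2 + r * (b * u).re := by
      have : a * ((r : ℂ) * u) ^ 2 + b * ((r : ℂ) * u)
          = ((‖a‖ * r ^ 2 : ℝ) : ℂ) + (r : ℂ) * (b * u) := by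
        push_cast; rw [← hu2]; ring
      rw [this, Complex.add_re, Complex.ofReal_re, Complex.re_ofReal_mul]
    have h1 : ‖(r : ℂ) * u * f (r * u)‖ ^ 2 = ‖(Polynomial.X * P).eval ((r : ℂ) * u)‖ ^ 2
        * Real.exp (2 * (‖a‖ * r ^ 2 + r * (b * u).re)) := by
      simp only [hfdef]
      rw [← mul_assoc, norm_mul, Complex.norm_exp, hre, mul_pow, ← Real.exp_nat_mul,
        Polynomial.eval_mul, Polynomial.eval_X]
      push_cast; rfl
    rw [h1, hn, mul_assoc, ← Real.exp_add]
    refine le_mul_of_one_le_right (by positivity) (Real.one_le_exp ?_)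
    have h2 : -r ^ 2 / ε = -(ε⁻¹ * r ^ 2) := by rw [div_eq_inv_mul]; ring
    rw [h2]
    have h3 := mul_le_mul_of_nonneg_right hcon (sq_nonneg r)
    have h4 := mul_nonneg hr hu3
    linarith
  obtain ⟨r, hr0, hr⟩ := ((eventually_ge_atTop (0:ℝ)).and
    (ht.eventually_gt_atTop (max D 1))).exists
  have h1 := hle r hr0
  have h2 := le_max_left D 1
  have h3 := le_max_right D 1
  nlinarith

end QuadraticCoefficient

/-! ### Gaussian integrals with quadratic exponent and polynomial prefactors. -/

section GaussianMoments

/-- The exponent `A w² + B w̄² + s w + t w̄ - κ |w|²`, with `w` and `w̄` as independent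
variables. -/
noncomputable def gaussExponent (A B s κ t x y : ℂ) : ℂ :=
  A * x ^ 2 + B * y ^ 2 + s * x + t * y - κ * (x * y)

/-- The moment `∫ R(w) S(w̄) exp (A w² + B w̄² + s w + t w̄ - κ |w|²)`. -/
noncomputable def gaussInt (A B s κ : ℂ) (R S : Polynomial ℂ) (t : ℂ) : ℂ :=
  ∫ w : ℂ, R.eval w * S.eval (conj w) * Complex.exp (gaussExponent A B s κ t w (conj w))

/-- `Fx` and `Fy` are the Wirtinger derivatives `∂F` and `∂̄F`. Integrals of directional derivatives
vanish, and the directions `1` and `i` separate the two. -/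
theorem integral_wirtinger_eq_zero {F Fx Fy : ℂ → ℂ} (hF : Integrable F) (hx : Integrable Fx)
    (hy : Integrable Fy)
    (hd : ∀ v w, HasLineDerivAt ℝ F (v * Fx w + conj v * Fy w) w v) :
    ∫ w, Fx w = 0 ∧ ∫ w, Fy w = 0 := by
  have key : ∀ v : ℂ, v * (∫ w, Fx w) + conj v * ∫ w, Fy w = 0 := by
    intro v
    have hg : Integrable fun w => v * Fx w + conj v * Fy w :=
      (hx.const_mul v).add (hy.const_mul (conj v))
    have h := integral_bilinear_hasLineDerivAt_right_eq_neg_left_of_integrable (μ := volume)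
      (f := fun _ : ℂ => (1 : ℂ)) (f' := fun _ => 0) (g := F)
      (g' := fun w => v * Fx w + conj v * Fy w) (v := v) (B := ContinuousLinearMap.mul ℝ ℂ)
      (by simp) (by simpa using hg) (by simpa using hF)
      (fun w _ => by simpa [HasLineDerivAt] using hasDerivAt_const (0:ℝ) (1:ℂ)) (fun w _ => hd v w)
    simp only [ContinuousLinearMap.mul_apply', one_mul, zero_mul, integral_zero, neg_zero] at h
    rwa [integral_add (hx.const_mul _) (hy.const_mul _), integral_const_mul,
      integral_const_mul] at h
  have h1 := key 1
  have h2 := key Complex.I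
  simp only [map_one, one_mul, Complex.conj_I] at h1 h2
  have h3 : (∫ w, Fx w) - ∫ w, Fy w = 0 := by
    apply mul_left_cancel₀ Complex.I_ne_zero
    linear_combination h2
  constructor
  · linear_combination (h1 + h3) / 2
  · linear_combination (h1 - h3) / 2

variable {A B s : ℂ} {κ : ℝ}

theorem exists_gauss_bound (hκ : ‖A‖ + ‖B‖ < κ) (R S : Polynomial ℂ) (T : ℝ) :
    ∃ C δ : ℝ, 0 < δ ∧ ∀ t : ℂ, ‖t‖ ≤ T → ∀ w : ℂ,
      ‖R.eval w * S.eval (conj w) * Complex.exp (gaussExponent A B s κ t w (conj w))‖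
        ≤ C * Real.exp (-δ * ‖w‖ ^ 2) := by
  -- A quarter of the spectral gap: three shares absorb `R`, `S` and the linear terms, and one is
  -- left as decay.
  set δ := (κ - ‖A‖ - ‖B‖) / 4 with hδ
  have hδ0 : 0 < δ := by rw [hδ]; linarith
  obtain ⟨C₁, hC₁, h₁⟩ := exists_eval_le_exp_sq hδ0 R
  obtain ⟨C₂, hC₂, h₂⟩ := exists_eval_le_exp_sq hδ0 S
  set c := ‖s‖ + T
  refine ⟨C₁ * C₂ * Real.exp (c ^ 2 / (4 * δ)), δ, hδ0, fun t ht w => ?_⟩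
  have hre : (gaussExponent A B s κ t w (conj w)).re
      ≤ (‖A‖ + ‖B‖ - κ) * ‖w‖ ^ 2 + c * ‖w‖ := by
    have e : gaussExponent A B s κ t w (conj w)
        = A * w ^ 2 + B * conj w ^ 2 + s * w + t * conj w - ((κ * ‖w‖ ^ 2 : ℝ) : ℂ) := by
      rw [gaussExponent, Complex.mul_conj, Complex.normSq_eq_norm_sq]; push_cast; ring
    rw [e, Complex.sub_re, Complex.ofReal_re]
    have := (Complex.re_le_norm (A * w ^ 2 + B * conj w ^ 2 + s * w + t * conj w)).trans
      ((norm_add_le _ _).trans (add_le_add ((norm_add_le _ _).trans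
        (add_le_add (norm_add_le _ _) le_rfl)) le_rfl))
    simp only [norm_mul, norm_pow, RCLike.norm_conj] at this
    have h3 := mul_le_mul_of_nonneg_right ht (norm_nonneg w)
    simp only [c]
    linarith
  have hS := h₂ (conj w)
  rw [RCLike.norm_conj] at hS
  rw [norm_mul, norm_mul, Complex.norm_exp]
  calc _ ≤ (C₁ * Real.exp (δ * ‖w‖ ^ 2)) * (C₂ * Real.exp (δ * ‖w‖ ^ 2)) *
        (Real.exp ((‖A‖ + ‖B‖ - κ) * ‖w‖ ^ 2) *
          (Real.exp (c ^ 2 / (4 * δ)) * Real.exp (δ * ‖w‖ ^ 2))) := by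
        gcongr
        · exact h₁ w
        · refine (Real.exp_le_exp.2 hre).trans ?_
          rw [Real.exp_add]
          exact mul_le_mul_of_nonneg_left (exp_linear_le hδ0 c ‖w‖) (Real.exp_pos _).le
    _ = C₁ * C₂ * Real.exp (c ^ 2 / (4 * δ)) * (Real.exp (δ * ‖w‖ ^ 2) *
        Real.exp (δ * ‖w‖ ^ 2) * Real.exp (δ * ‖w‖ ^ 2) *
        Real.exp ((‖A‖ + ‖B‖ - κ) * ‖w‖ ^ 2)) := by ring
    _ = _ := by
        rw [← Real.exp_add, ← Real.exp_add, ← Real.exp_add]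
        congr 2
        rw [hδ]; ring

theorem continuous_gauss_integrand (R S : Polynomial ℂ) (t : ℂ) : Continuous fun w : ℂ =>
    R.eval w * S.eval (conj w) * Complex.exp (gaussExponent A B s κ t w (conj w)) := by
  unfold gaussExponent
  have := R.continuous
  have := S.continuous
  fun_prop

theorem integrable_gauss (hκ : ‖A‖ + ‖B‖ < κ) (R S : Polynomial ℂ) (t : ℂ) :
    Integrable fun w : ℂ =>
      R.eval w * S.eval (conj w) * Complex.exp (gaussExponent A B s κ t w (conj w)) := by
  obtain ⟨C, δ, hδ, h⟩ := exists_gauss_bound (s := s) hκ R S ‖t‖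
  have hi := (integrable_norm_pow_mul_exp_neg 0 hδ).const_mul C
  simp only [pow_zero, one_mul] at hi
  exact hi.mono' (continuous_gauss_integrand R S t).aestronglyMeasurable
    (Filter.Eventually.of_forall (h t le_rfl))

theorem gaussInt_add_left (hκ : ‖A‖ + ‖B‖ < κ) (R R' S : Polynomial ℂ) (t : ℂ) :
    gaussInt A B s κ (R + R') S t = gaussInt A B s κ R S t + gaussInt A B s κ R' S t := by
  unfold gaussInt
  rw [← integral_add (integrable_gauss hκ R S t) (integrable_gauss hκ R' S t)]
  simp only [Polynomial.eval_add, add_mul]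

theorem gaussInt_add_right (hκ : ‖A‖ + ‖B‖ < κ) (R S S' : Polynomial ℂ) (t : ℂ) :
    gaussInt A B s κ R (S + S') t = gaussInt A B s κ R S t + gaussInt A B s κ R S' t := by
  unfold gaussInt
  rw [← integral_add (integrable_gauss hκ R S t) (integrable_gauss hκ R S' t)]
  simp only [Polynomial.eval_add, add_mul, mul_add]

theorem gaussInt_C_mul_left (c : ℂ) (R S : Polynomial ℂ) (t : ℂ) :
    gaussInt A B s κ (Polynomial.C c * R) S t = c * gaussInt A B s κ R S t := by
  unfold gaussInt
  rw [← integral_const_mul]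
  simp only [Polynomial.eval_mul, Polynomial.eval_C, mul_assoc]

theorem gaussInt_C_mul_right (c : ℂ) (R S : Polynomial ℂ) (t : ℂ) :
    gaussInt A B s κ R (Polynomial.C c * S) t = c * gaussInt A B s κ R S t := by
  unfold gaussInt
  rw [← integral_const_mul]
  congr 1; ext w
  simp only [Polynomial.eval_mul, Polynomial.eval_C]
  ring

/-- The integrals of `∂` and `∂̄` of the integrand vanish. Thus multiplication by `κ w̄` can be
traded for a first order operator acting on `R`, and `κ w` for one acting on `S`. -/
theorem gaussInt_ibp (hκ : ‖A‖ + ‖B‖ < κ) (R S : Polynomial ℂ) (t : ℂ) :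
    gaussInt A B s κ (Polynomial.derivative R
        + R * (Polynomial.C (2 * A) * Polynomial.X + Polynomial.C s)) S t
      = κ * gaussInt A B s κ R (Polynomial.X * S) t ∧
    gaussInt A B s κ R (Polynomial.derivative S
        + S * (Polynomial.C (2 * B) * Polynomial.X + Polynomial.C t)) t
      = κ * gaussInt A B s κ (Polynomial.X * R) S t := by
  set R₁ := Polynomial.derivative R + R * (Polynomial.C (2 * A) * Polynomial.X + Polynomial.C s)
  set S₁ := Polynomial.derivative S + S * (Polynomial.C (2 * B) * Polynomial.X + Polynomial.C t)
  have i1 := integrable_gauss (s := s) hκ R₁ S t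
  have i2 := (integrable_gauss (s := s) hκ R (Polynomial.X * S) t).const_mul (κ : ℂ)
  have i3 := integrable_gauss (s := s) hκ R S₁ t
  have i4 := (integrable_gauss (s := s) hκ (Polynomial.X * R) S t).const_mul (κ : ℂ)
  have h := integral_wirtinger_eq_zero (integrable_gauss (s := s) hκ R S t) (i1.sub i2) (i3.sub i4)
    (fun v w => by
      -- `w` and `w̄` vary independently along complex `τ`, which makes everything holomorphic in
      -- `τ`; the restriction to real `τ` comes at the end.
      have hx : HasDerivAt (fun τ : ℂ => w + τ * v) v ((0 : ℝ) : ℂ) := by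
        simpa using ((hasDerivAt_id ((0 : ℝ) : ℂ)).mul_const v).const_add w
      have hy : HasDerivAt (fun τ : ℂ => conj w + τ * conj v) (conj v) ((0 : ℝ) : ℂ) := by
        simpa using ((hasDerivAt_id ((0 : ℝ) : ℂ)).mul_const (conj v)).const_add (conj w)
      have hR : HasDerivAt (fun τ : ℂ => R.eval (w + τ * v))
          ((Polynomial.derivative R).eval w * v) ((0 : ℝ) : ℂ) := by
        have := (R.hasDerivAt (w + ((0:ℝ):ℂ) * v)).comp ((0:ℝ):ℂ) hx
        simpa [Function.comp_def] using this
      have hS : HasDerivAt (fun τ : ℂ => S.eval (conj w + τ * conj v))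
          ((Polynomial.derivative S).eval (conj w) * conj v) ((0 : ℝ) : ℂ) := by
        have := (S.hasDerivAt (conj w + ((0:ℝ):ℂ) * conj v)).comp ((0:ℝ):ℂ) hy
        simpa [Function.comp_def] using this
      have hE : HasDerivAt (fun τ : ℂ => gaussExponent A B s κ t (w + τ * v)
          (conj w + τ * conj v)) (2 * A * w * v + 2 * B * conj w * conj v + s * v + t * conj v
            - κ * (v * conj w + w * conj v)) ((0 : ℝ) : ℂ) := by
        unfold gaussExponent
        have := (((((hx.pow 2).const_mul A).add ((hy.pow 2).const_mul B)).add
          (hx.const_mul s)).add (hy.const_mul t)).sub ((hx.mul hy).const_mul (κ : ℂ))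
        convert! this using 1
        simp; ring
      have hall := ((hR.mul hS).mul hE.cexp).comp_ofReal
      unfold HasLineDerivAt
      convert! hall using 1
      · ext τ
        simp
      · simp only [R₁, S₁, Pi.sub_apply, Polynomial.eval_add, Polynomial.eval_mul,
          Polynomial.eval_C, Polynomial.eval_X, Complex.ofReal_zero, zero_mul, add_zero]
        simp
        ring)
  constructor
  · have := h.1
    rw [integral_sub' i1 i2, integral_const_mul, sub_eq_zero] at this
    exact this
  · have := h.2
    rw [integral_sub' i3 i4, integral_const_mul, sub_eq_zero] at this
    exact this

theorem hasDerivAt_gaussInt (hκ : ‖A‖ + ‖B‖ < κ) (R S : Polynomial ℂ) (t : ℂ) :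
    HasDerivAt (gaussInt A B s κ R S) (gaussInt A B s κ R (Polynomial.X * S) t) t := by
  obtain ⟨C, δ, hδ, h⟩ := exists_gauss_bound (s := s) hκ R (Polynomial.X * S) (‖t‖ + 1)
  have hi := (integrable_norm_pow_mul_exp_neg 0 hδ).const_mul C
  simp only [pow_zero, one_mul] at hi
  set F : ℂ → ℂ → ℂ := fun t w => R.eval w * S.eval (conj w) *
      Complex.exp (gaussExponent A B s κ t w (conj w))
  set F' : ℂ → ℂ → ℂ := fun t w => R.eval w * (Polynomial.X * S).eval (conj w) *
      Complex.exp (gaussExponent A B s κ t w (conj w))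
  have hbound : ∀ w, ∀ t' ∈ Metric.ball t 1, ‖F' t' w‖ ≤ C * Real.exp (-δ * ‖w‖ ^ 2) := by
    intro w t' ht'
    refine h t' ?_ w
    have h1 : ‖t' - t‖ < 1 := by simpa [dist_eq_norm] using ht'
    have := norm_add_le (t' - t) t
    rw [sub_add_cancel] at this
    linarith
  have hdiff : ∀ w, ∀ t' ∈ Metric.ball t 1, HasDerivAt (fun τ => F τ w) (F' t' w) t' := by
    intro w t' _
    have hE : HasDerivAt (fun τ => gaussExponent A B s κ τ w (conj w)) (conj w) t' := by
      have h1 : (fun τ => gaussExponent A B s κ τ w (conj w)) = fun τ => τ * conj w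
          + (A * w ^ 2 + B * conj w ^ 2 + s * w - κ * (w * conj w)) := by
        ext τ; unfold gaussExponent; ring
      rw [h1]
      exact (hasDerivAt_mul_const (conj w)).add_const _
    have h2 := hE.cexp.const_mul (R.eval w * S.eval (conj w))
    have h3 : F' t' w = R.eval w * S.eval (conj w) *
        (Complex.exp (gaussExponent A B s κ t' w (conj w)) * conj w) := by
      simp only [F', Polynomial.eval_mul, Polynomial.eval_X]
      ring
    rw [h3]
    exact h2
  exact (hasDerivAt_integral_of_dominated_loc_of_deriv_le (μ := volume)
    (Metric.ball_mem_nhds t one_pos) (Filter.Eventually.of_forall fun t' =>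
      (continuous_gauss_integrand R S t').aestronglyMeasurable) (integrable_gauss hκ R S t)
    (continuous_gauss_integrand R (Polynomial.X * S) t).aestronglyMeasurable
    (Filter.Eventually.of_forall hbound) hi (Filter.Eventually.of_forall hdiff)).2

/-- By AM-GM, `4|A||B| ≤ (|A| + |B|)² < κ²`. -/
theorem gauss_discriminant_ne_zero (hκ : ‖A‖ + ‖B‖ < κ) : (κ : ℂ) ^ 2 - 4 * (A * B) ≠ 0 := by
  intro h
  have h1 : (κ : ℂ) ^ 2 = 4 * (A * B) := sub_eq_zero.1 h
  have h2 := congrArg norm h1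
  rw [norm_pow, Complex.norm_real, norm_mul, norm_mul, Real.norm_eq_abs, sq_abs] at h2
  have h3 : ‖(4 : ℂ)‖ = 4 := by simp
  rw [h3] at h2
  nlinarith [sq_nonneg (‖A‖ - ‖B‖), norm_nonneg A, norm_nonneg B]

/-- The Gaussian integral as a function of `t`. -/
theorem gaussInt_one_one (hκ : ‖A‖ + ‖B‖ < κ) (t : ℂ) :
    gaussInt A B s κ 1 1 t = gaussInt A B s κ 1 1 0
      * Complex.exp ((A * t ^ 2 + s * κ * t) / (κ ^ 2 - 4 * (A * B))) := by
  set D := (κ : ℂ) ^ 2 - 4 * (A * B) with hD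
  have hD0 : D ≠ 0 := gauss_discriminant_ne_zero hκ
  -- Differentiation in `t` produces the moment of `w̄`. The two integrations by parts form a linear
  -- system for the moments of `w` and `w̄`, with determinant `D`, and yield a linear differential
  -- equation in `t`.
  have hder : ∀ t, HasDerivAt (gaussInt A B s κ 1 1)
      ((2 * A * t + s * κ) / D * gaussInt A B s κ 1 1 t) t := by
    intro t
    have h := hasDerivAt_gaussInt (s := s) hκ 1 1 t
    obtain ⟨h1, h2⟩ := gaussInt_ibp (s := s) hκ 1 1 t
    have e1 : Polynomial.C s = Polynomial.C s * (1 : Polynomial ℂ) := by rw [mul_one]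
    have e2 : Polynomial.C t = Polynomial.C t * (1 : Polynomial ℂ) := by rw [mul_one]
    rw [Polynomial.derivative_one, zero_add, one_mul, mul_one, gaussInt_add_left hκ,
      gaussInt_C_mul_left, e1, gaussInt_C_mul_left] at h1
    rw [Polynomial.derivative_one, zero_add, one_mul, mul_one, gaussInt_add_right hκ,
      gaussInt_C_mul_right, e2, gaussInt_C_mul_right] at h2
    rw [mul_one] at h
    convert! h using 1
    rw [div_mul_eq_mul_div, div_eq_iff hD0, hD]
    linear_combination κ * h1 + 2 * A * h2
  have hder2 : ∀ t, HasDerivAt (fun t => gaussInt A B s κ 1 1 t *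
      Complex.exp (-((A * t ^ 2 + s * κ * t) / D))) 0 t := by
    intro t
    have hq : HasDerivAt (fun t : ℂ => -((A * t ^ 2 + s * κ * t) / D))
        (-((A * (2 * t) + s * κ) / D)) t := by
      have := ((((hasDerivAt_id t).pow 2).const_mul A).add
        ((hasDerivAt_id t).const_mul (s * κ))).div_const D |>.neg
      convert! this using 1
      simp
    have := (hder t).mul hq.cexp
    convert! this using 1
    field_simp
    ring
  have hc := is_const_of_deriv_eq_zero (fun w => (hder2 w).differentiableAt)
    (fun w => (hder2 w).deriv) t 0
  have h0 : -((A * 0 ^ 2 + s * κ * 0) / D) = 0 := by ring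
  simp only [h0, Complex.exp_zero, mul_one] at hc
  rw [← hc, mul_assoc, ← Complex.exp_add, neg_add_cancel, Complex.exp_zero, mul_one]

/-- Integration by parts gives two linear equations for the moments `(j+1, k)` and `(j, k+1)` in
terms of moments of lower total degree; the determinant is the nonzero discriminant. -/
theorem exists_gaussInt_monomial (hκ : ‖A‖ + ‖B‖ < κ) (n : ℕ) : ∀ j k : ℕ, j + k = n →
    ∃ p : Polynomial ℂ, ∀ t, gaussInt A B s κ (Polynomial.X ^ j) (Polynomial.X ^ k) t
      = p.eval t * gaussInt A B s κ 1 1 t := by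
  induction n using Nat.strong_induction_on with
  | _ n ih =>
    have hD0 := gauss_discriminant_ne_zero (A := A) (B := B) hκ
    -- At `j = 0` or `k = 0` the truncated exponent is harmless, because its coefficient is 0.
    have hrel : ∀ (j k : ℕ) (t : ℂ), (j : ℂ) * gaussInt A B s κ
        (Polynomial.X ^ (j - 1)) (Polynomial.X ^ k) t
          + (2 * A) * gaussInt A B s κ (Polynomial.X ^ (j + 1)) (Polynomial.X ^ k) t
          + s * gaussInt A B s κ (Polynomial.X ^ j) (Polynomial.X ^ k) t
          = κ * gaussInt A B s κ (Polynomial.X ^ j) (Polynomial.X ^ (k + 1)) t ∧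
        (k : ℂ) * gaussInt A B s κ (Polynomial.X ^ j) (Polynomial.X ^ (k - 1)) t
          + (2 * B) * gaussInt A B s κ (Polynomial.X ^ j) (Polynomial.X ^ (k + 1)) t
          + t * gaussInt A B s κ (Polynomial.X ^ j) (Polynomial.X ^ k) t
          = κ * gaussInt A B s κ (Polynomial.X ^ (j + 1)) (Polynomial.X ^ k) t := by
      intro j k t
      have h := gaussInt_ibp (s := s) hκ (Polynomial.X ^ j) (Polynomial.X ^ k) t
      have e : ∀ (m : ℕ) (c d : ℂ), Polynomial.derivative (Polynomial.X ^ m : Polynomial ℂ)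
          + Polynomial.X ^ m * (Polynomial.C c * Polynomial.X + Polynomial.C d)
          = Polynomial.C (m : ℂ) * Polynomial.X ^ (m - 1)
            + Polynomial.C c * Polynomial.X ^ (m + 1) + Polynomial.C d * Polynomial.X ^ m := by
        intro m c d
        rw [Polynomial.derivative_X_pow]; ring
      rw [e, e, gaussInt_add_left hκ, gaussInt_add_left hκ, gaussInt_add_right hκ,
        gaussInt_add_right hκ] at h
      simp only [gaussInt_C_mul_left, gaussInt_C_mul_right, ← pow_succ'] at h
      exact h
    have hlow : ∀ (j k : ℕ) (c : ℂ), j + k + 1 = n → ∃ p q r : Polynomial ℂ, ∀ t,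
        (j : ℂ) * gaussInt A B s κ (Polynomial.X ^ (j - 1)) (Polynomial.X ^ k) t
          = p.eval t * gaussInt A B s κ 1 1 t ∧
        (k : ℂ) * gaussInt A B s κ (Polynomial.X ^ j) (Polynomial.X ^ (k - 1)) t
          = q.eval t * gaussInt A B s κ 1 1 t ∧
        gaussInt A B s κ (Polynomial.X ^ j) (Polynomial.X ^ k) t
          = r.eval t * gaussInt A B s κ 1 1 t := by
      intro j k c hjk
      obtain ⟨p, hp⟩ := ih (j - 1 + k) (by omega) (j - 1) k rfl
      obtain ⟨q, hq⟩ := ih (j + (k - 1)) (by omega) j (k - 1) rfl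
      obtain ⟨r, hr⟩ := ih (j + k) (by omega) j k rfl
      refine ⟨Polynomial.C (j : ℂ) * p, Polynomial.C (k : ℂ) * q, r, fun t => ⟨?_, ?_, hr t⟩⟩
      · rw [hp, Polynomial.eval_mul, Polynomial.eval_C, mul_assoc]
      · rw [hq, Polynomial.eval_mul, Polynomial.eval_C, mul_assoc]
    intro j k hjk
    rcases k with _ | k
    · rcases j with _ | j
      · exact ⟨1, fun t => by simp⟩
      · obtain ⟨p, q, r, h⟩ := hlow j 0 0 (by omega)
        refine ⟨Polynomial.C (((κ : ℂ) ^ 2 - 4 * (A * B))⁻¹) * (Polynomial.C (κ : ℂ) *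
          (q + Polynomial.X * r) + Polynomial.C (2 * B) * (p + Polynomial.C s * r)), fun t => ?_⟩
        obtain ⟨h1, h2⟩ := hrel j 0 t
        obtain ⟨g1, g2, g3⟩ := h t
        simp only [Polynomial.eval_mul, Polynomial.eval_C, Polynomial.eval_add, Polynomial.eval_X]
        rw [mul_assoc, eq_inv_mul_iff_mul_eq₀ hD0]
        rw [g1] at h1
        rw [g2] at h2
        rw [g3] at h1 h2
        linear_combination -(κ : ℂ) * h2 - 2 * B * h1
    · obtain ⟨p, q, r, h⟩ := hlow j k 0 (by omega)
      refine ⟨Polynomial.C (((κ : ℂ) ^ 2 - 4 * (A * B))⁻¹) * (Polynomial.C (κ : ℂ) *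
        (p + Polynomial.C s * r) + Polynomial.C (2 * A) * (q + Polynomial.X * r)), fun t => ?_⟩
      obtain ⟨h1, h2⟩ := hrel j k t
      obtain ⟨g1, g2, g3⟩ := h t
      simp only [Polynomial.eval_mul, Polynomial.eval_C, Polynomial.eval_add, Polynomial.eval_X]
      rw [mul_assoc, eq_inv_mul_iff_mul_eq₀ hD0]
      rw [g1] at h1
      rw [g2] at h2
      rw [g3] at h1 h2
      linear_combination -(κ : ℂ) * h1 - 2 * A * h2

theorem exists_gaussInt_eq (hκ : ‖A‖ + ‖B‖ < κ) (R S : Polynomial ℂ) :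
    ∃ p : Polynomial ℂ, ∀ t, gaussInt A B s κ R S t = p.eval t * gaussInt A B s κ 1 1 t := by
  induction R using Polynomial.induction_on' with
  | add R R' hR hR' =>
    obtain ⟨p, hp⟩ := hR
    obtain ⟨p', hp'⟩ := hR'
    exact ⟨p + p', fun t => by
      rw [gaussInt_add_left hκ, hp, hp', Polynomial.eval_add, add_mul]⟩
  | monomial j a =>
    induction S using Polynomial.induction_on' with
    | add S S' hS hS' =>
      obtain ⟨p, hp⟩ := hS
      obtain ⟨p', hp'⟩ := hS'
      exact ⟨p + p', fun t => by
        rw [gaussInt_add_right hκ, hp, hp', Polynomial.eval_add, add_mul]⟩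
    | monomial k b =>
      obtain ⟨p, hp⟩ := exists_gaussInt_monomial (s := s) hκ (j + k) j k rfl
      refine ⟨Polynomial.C (a * b) * p, fun t => ?_⟩
      rw [← Polynomial.C_mul_X_pow_eq_monomial, ← Polynomial.C_mul_X_pow_eq_monomial,
        gaussInt_C_mul_left, gaussInt_C_mul_right, hp, Polynomial.eval_mul, Polynomial.eval_C]
      ring

/-- When `B = 0` the Gaussian integral reproduces `R` at `t / κ`. -/
theorem gaussInt_reproducing (hκ : ‖A‖ < κ) (R : Polynomial ℂ) (t : ℂ) :
    gaussInt A 0 s κ R 1 t = R.eval (t / κ) * gaussInt A 0 s κ 1 1 t := by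
  have hκ' : ‖A‖ + ‖(0 : ℂ)‖ < κ := by simpa using hκ
  have hκ0 : (κ : ℂ) ≠ 0 := by
    have : 0 < κ := (norm_nonneg A).trans_lt hκ
    exact_mod_cast this.ne'
  have hX : ∀ R, gaussInt A 0 s κ (Polynomial.X * R) 1 t
      = t / κ * gaussInt A 0 s κ R 1 t := by
    intro R
    have h := (gaussInt_ibp (s := s) hκ' R 1 t).2
    have e : Polynomial.derivative (1 : Polynomial ℂ) + 1 * (Polynomial.C (2 * 0) * Polynomial.X
        + Polynomial.C t) = Polynomial.C t * 1 := by simp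
    rw [e, gaussInt_C_mul_right] at h
    rw [div_mul_eq_mul_div, eq_div_iff hκ0, h, mul_comm]
  have hpow : ∀ j : ℕ, gaussInt A 0 s κ (Polynomial.X ^ j) 1 t
      = (t / κ) ^ j * gaussInt A 0 s κ 1 1 t := by
    intro j
    induction j with
    | zero => simp
    | succ j ih => rw [pow_succ', hX, ih]; ring
  induction R using Polynomial.induction_on' with
  | add R R' hR hR' => rw [gaussInt_add_left hκ', hR, hR', Polynomial.eval_add, add_mul]
  | monomial j a =>
    rw [← Polynomial.C_mul_X_pow_eq_monomial, gaussInt_C_mul_left, hpow]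
    simp [mul_assoc]

/-- For `B = t = 0` the integrand is the radial Gaussian times an entire function with value 1 at 0,
so the mean value property gives `π/κ`. -/
theorem gaussInt_one_one_zero_ne_zero (hκ : ‖A‖ < κ) : gaussInt A 0 s κ 1 1 0 ≠ 0 := by
  have hκ' : ‖A‖ + ‖(0 : ℂ)‖ < κ := by simpa using hκ
  have hκ0 : 0 < κ := (norm_nonneg A).trans_lt hκ
  have hi := integrable_gauss (s := s) hκ' 1 1 0
  have e : ∀ w : ℂ, (1 : Polynomial ℂ).eval w * (1 : Polynomial ℂ).eval (conj w) *
      Complex.exp (gaussExponent A 0 s κ 0 w (conj w))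
      = (Real.exp (-κ * ‖w‖ ^ 2) : ℂ) * Complex.exp (A * w ^ 2 + s * w) := by
    intro w
    rw [Polynomial.eval_one, Polynomial.eval_one, one_mul, one_mul, gaussExponent,
      Complex.mul_conj, Complex.normSq_eq_norm_sq, Complex.ofReal_exp, ← Complex.exp_add]
    congr 1; push_cast; ring
  unfold gaussInt
  simp only [e] at hi ⊢
  rw [integral_exp_neg_mul_entire hκ0 (by fun_prop) hi]
  have : ((Real.pi / κ : ℝ) : ℂ) ≠ 0 := by
    exact_mod_cast (by positivity : Real.pi / κ ≠ 0)
  simpa using this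

end GaussianMoments

/-! ### Vanishing of the quadratic coefficient and magnetic translation. -/

/-- Otherwise `p = -q E` with `E' = L E` and `L` of degree exactly 1. Differentiating gives `p' q =
p (q' + q L)`, where the right side has the larger degree. -/
theorem eq_zero_of_exp_quadratic_relation {p q : Polynomial ℂ} {a b c a' b' c' : ℂ} (ha : a ≠ a')
    (h : ∀ t, p.eval t * Complex.exp (a * t ^ 2 + b * t + c)
      + q.eval t * Complex.exp (a' * t ^ 2 + b' * t + c') = 0) : p = 0 := by
  by_contra hp
  have hq : q ≠ 0 := by
    intro hq
    apply hp
    refine Polynomial.funext fun t => ?_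
    have := h t
    rw [hq] at this
    simpa using this
  set L : Polynomial ℂ := Polynomial.C (2 * (a' - a)) * Polynomial.X + Polynomial.C (b' - b)
  have hL : L.natDegree = 1 :=
    Polynomial.natDegree_linear (mul_ne_zero two_ne_zero (sub_ne_zero.2 ha.symm))
  have hL0 : L ≠ 0 := fun h0 => by rw [h0] at hL; simp at hL
  set E : ℂ → ℂ := fun t => Complex.exp ((a' - a) * t ^ 2 + (b' - b) * t + (c' - c)) with hE
  have hpE : ∀ t, p.eval t = -(q.eval t * E t) := by
    intro t
    have h1 := h t
    have h2 : Complex.exp (a' * t ^ 2 + b' * t + c')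
        = E t * Complex.exp (a * t ^ 2 + b * t + c) := by
      simp only [hE]; rw [← Complex.exp_add]; congr 1; ring
    rw [h2] at h1
    apply mul_right_cancel₀ (Complex.exp_ne_zero (a * t ^ 2 + b * t + c))
    linear_combination h1
  have hdE : ∀ t, HasDerivAt E (E t * L.eval t) t := by
    intro t
    have h1 : HasDerivAt (fun t : ℂ => (a' - a) * t ^ 2 + (b' - b) * t + (c' - c))
        (L.eval t) t := by
      have := ((((hasDerivAt_id t).pow 2).const_mul (a' - a)).add
        ((hasDerivAt_id t).const_mul (b' - b))).add_const (c' - c)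
      convert! this using 1
      simp [L]; ring
    exact h1.cexp
  have hdp : ∀ t, (Polynomial.derivative p).eval t
      = -((Polynomial.derivative q).eval t * E t + q.eval t * (E t * L.eval t)) := by
    intro t
    have h1 := p.hasDerivAt t
    have h2 := ((q.hasDerivAt t).mul (hdE t)).neg
    refine h1.unique (h2.congr_of_eventuallyEq (Filter.Eventually.of_forall fun t => ?_))
    simpa using hpE t
  have hpoly : Polynomial.derivative p * q = p * (Polynomial.derivative q + q * L) := by
    refine Polynomial.funext fun t => ?_
    simp only [Polynomial.eval_mul, Polynomial.eval_add]
    rw [hdp, hpE]; ring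
  have hdeg1 : (Polynomial.derivative p * q).natDegree ≤ p.natDegree + q.natDegree := by
    refine Polynomial.natDegree_mul_le.trans (add_le_add ?_ le_rfl)
    exact (Polynomial.natDegree_derivative_le p).trans (Nat.sub_le _ _)
  have hqL : (q * L).natDegree = q.natDegree + 1 := by
    rw [Polynomial.natDegree_mul hq hL0, hL]
  have hsum : (Polynomial.derivative q + q * L).natDegree = q.natDegree + 1 := by
    rw [Polynomial.natDegree_add_eq_right_of_natDegree_lt, hqL]
    rw [hqL]
    exact lt_of_le_of_lt ((Polynomial.natDegree_derivative_le q).trans (Nat.sub_le _ _))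
      (Nat.lt_succ_self _)
  have hne : Polynomial.derivative q + q * L ≠ 0 := fun h0 => by rw [h0] at hsum; simp at hsum
  rw [hpoly, Polynomial.natDegree_mul hp hne, hsum] at hdeg1
  omega

/-- This operator is what `κ w̄` becomes after integration by parts; the degree count is where `a ≠
0` matters. -/
theorem natDegree_twisted_derivative {a : ℂ} (ha : a ≠ 0) (b : ℂ) {R : Polynomial ℂ} (hR : R ≠ 0) :
    (Polynomial.derivative R + R * (Polynomial.C (2 * a) * Polynomial.X
      + Polynomial.C b)).natDegree = R.natDegree + 1 := by
  set L : Polynomial ℂ := Polynomial.C (2 * a) * Polynomial.X + Polynomial.C b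
  have hL : L.natDegree = 1 := Polynomial.natDegree_linear (mul_ne_zero two_ne_zero ha)
  have hL0 : L ≠ 0 := fun h0 => by rw [h0] at hL; simp at hL
  have hRL : (R * L).natDegree = R.natDegree + 1 := by
    rw [Polynomial.natDegree_mul hR hL0, hL]
  rw [Polynomial.natDegree_add_eq_right_of_natDegree_lt, hRL]
  rw [hRL]
  exact lt_of_le_of_lt ((Polynomial.natDegree_derivative_le R).trans (Nat.sub_le _ _))
    (Nat.lt_succ_self _)

theorem exp_linear_mem_fockS_two {ε : ℝ} (hε : 0 < ε) (P : Polynomial ℂ) (t : ℂ) :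
    (fun w => P.eval w * Complex.exp (t * w)) ∈ FockS ε 2 := by
  have hδ : 0 < ε⁻¹ / 8 := by positivity
  have := P.differentiable
  obtain ⟨C, hC, h⟩ := exists_eval_le_exp_sq hδ P
  refine fockS_two_of_norm_le (C := C * Real.exp (‖t‖ ^ 2 / (4 * (ε⁻¹ / 8)))) (α := ε⁻¹ / 4)
    (by fun_prop) (by linarith [inv_pos.2 hε]) fun w => ?_
  have h1 : ‖Complex.exp (t * w)‖ ≤ Real.exp (‖t‖ * ‖w‖) := by
    rw [Complex.norm_exp, Real.exp_le_exp, ← norm_mul]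
    exact Complex.re_le_norm _
  rw [norm_mul]
  calc _ ≤ (C * Real.exp (ε⁻¹ / 8 * ‖w‖ ^ 2)) * (Real.exp (‖t‖ ^ 2 / (4 * (ε⁻¹ / 8))) *
        Real.exp (ε⁻¹ / 8 * ‖w‖ ^ 2)) := by
        gcongr
        · exact h w
        · exact h1.trans (exp_linear_le hδ _ _)
    _ = C * Real.exp (‖t‖ ^ 2 / (4 * (ε⁻¹ / 8))) * (Real.exp (ε⁻¹ / 8 * ‖w‖ ^ 2) *
        Real.exp (ε⁻¹ / 8 * ‖w‖ ^ 2)) := by ring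
    _ = _ := by rw [← Real.exp_add]; congr 2; ring

section Translation

variable {β G ε : ℝ} {f : ℂ → ℂ}

/-- The Euler-Lagrange equation tested on the reproducing kernels. -/
theorem IsMinimizerLLL.euler_lagrange_kernel (hε : 0 < ε) (hf : IsMinimizerLLL β G ε f)
    (hf2 : f ∈ FockS ε 2) {P : Polynomial ℂ} {a b : ℂ}
    (hfP : ∀ z, f z = P.eval z * Complex.exp (a * z ^ 2 + b * z)) (ha : 2 * ‖a‖ < ε⁻¹) (t : ℂ) :
    -(β : ℂ) * gaussInt a 0 b (ε⁻¹ : ℝ) (Polynomial.X * P) Polynomial.X t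
      + 1 / 4 * gaussInt a 0 b (ε⁻¹ : ℝ) (Polynomial.X ^ 2 * P) (Polynomial.X ^ 2) t
      - ((potentialEnergy β ε f + G * quarticEnergy ε f : ℝ) : ℂ)
        * gaussInt a 0 b (ε⁻¹ : ℝ) P 1 t
      + G * gaussInt (2 * a) (conj a) (2 * b) ((2 * ε⁻¹ : ℝ) : ℂ) (P ^ 2)
        (P.map (starRingEnd ℂ)) (t + conj b) = 0 := by
  set κ := ε⁻¹ with hκ
  set μ := potentialEnergy β ε f + G * quarticEnergy ε f
  have hκ0 : 0 < κ := inv_pos.2 hε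
  have hk1 : ‖a‖ + ‖(0 : ℂ)‖ < κ := by rw [norm_zero, add_zero]; linarith [norm_nonneg a]
  have hk2 : ‖2 * a‖ + ‖conj a‖ < 2 * κ := by
    rw [norm_mul, RCLike.norm_conj, Complex.norm_ofNat]
    linarith [norm_nonneg a]
  have hh : (fun w => Complex.exp (conj t * w)) ∈ FockS ε 2 := by
    simpa using exp_linear_mem_fockS_two hε 1 (conj t)
  have h := hf.euler_lagrange hε hf2 hh
  have i1 := (integrable_gauss (s := b) hk1 (Polynomial.X * P) Polynomial.X t).const_mul (-(β : ℂ))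
  have i2 := (integrable_gauss (s := b) hk1 (Polynomial.X ^ 2 * P) (Polynomial.X ^ 2) t).const_mul
    (1 / 4 : ℂ)
  have i3 := (integrable_gauss (s := b) hk1 P 1 t).const_mul (μ : ℂ)
  have i4 := (integrable_gauss (s := 2 * b) hk2 (P ^ 2) (P.map (starRingEnd ℂ))
    (t + conj b)).const_mul (G : ℂ)
  unfold gaussInt
  rw [← integral_const_mul, ← integral_const_mul, ← integral_const_mul, ← integral_const_mul,
    ← integral_add' i1 i2, ← integral_sub' (i1.add i2) i3, ← integral_add' ((i1.add i2).sub i3) i4]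
  refine Eq.trans ?_ h
  congr 1
  ext w
  have hmap : (P.map (starRingEnd ℂ)).eval (conj w) = conj (P.eval w) := by
    rw [Polynomial.eval_map, Polynomial.eval₂_hom]
  have hw2 : ((‖w‖ ^ 2 : ℝ) : ℂ) = w * conj w := by
    rw [Complex.mul_conj, Complex.normSq_eq_norm_sq]
  have hf2' : ((‖f w‖ ^ 2 : ℝ) : ℂ) = f w * conj (f w) := by
    rw [Complex.mul_conj, Complex.normSq_eq_norm_sq]
  have hconjexp : conj (Complex.exp (conj t * w)) = Complex.exp (t * conj w) := by
    rw [← Complex.exp_conj, map_mul, Complex.conj_conj]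
  have hconjf : conj (f w) = conj (P.eval w) *
      Complex.exp (conj a * conj w ^ 2 + conj b * conj w) := by
    rw [hfP, map_mul, ← Complex.exp_conj, map_add, map_mul, map_mul, map_pow]
  have hW : ((Real.exp (-‖w‖ ^ 2 / ε) : ℝ) : ℂ) = Complex.exp (-(κ * (w * conj w))) := by
    rw [exp_neg_norm_sq_div, ← hκ, ← hw2, Complex.ofReal_exp]
    congr 1; push_cast; ring
  have hE1 : Complex.exp (gaussExponent a 0 b κ t w (conj w))
      = Complex.exp (a * w ^ 2 + b * w) * Complex.exp (t * conj w)
        * Complex.exp (-(κ * (w * conj w))) := by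
    rw [← Complex.exp_add, ← Complex.exp_add, gaussExponent]; congr 1; ring
  have hE2 : Complex.exp (gaussExponent (2 * a) (conj a) (2 * b) ((2 * κ : ℝ) : ℂ)
      (t + conj b) w (conj w)) = Complex.exp (a * w ^ 2 + b * w) * Complex.exp (a * w ^ 2 + b * w) *
        Complex.exp (conj a * conj w ^ 2 + conj b * conj w) * Complex.exp (t * conj w)
        * Complex.exp (-(κ * (w * conj w))) * Complex.exp (-(κ * (w * conj w))) := by
    simp only [← Complex.exp_add]
    rw [gaussExponent]; congr 1; push_cast; ring
  have hv : ((-β * ‖w‖ ^ 2 + 1 / 4 * ‖w‖ ^ 4 - μ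
      + G * (‖f w‖ ^ 2 * Real.exp (-‖w‖ ^ 2 / ε)) : ℝ) : ℂ)
      = -β * (w * conj w) + 1 / 4 * (w * conj w) ^ 2 - μ
        + G * (f w * conj (f w) * Complex.exp (-(κ * (w * conj w)))) := by
    rw [← hW, ← hw2, ← hf2']
    push_cast; ring
  rw [hv, hW, hconjexp, hconjf, hfP w]
  simp only [Pi.add_apply, Pi.sub_apply, Polynomial.eval_mul, Polynomial.eval_pow,
    Polynomial.eval_X, Polynomial.eval_one, hmap, hE1, hE2]
  ring

/-- A minimiser with finitely many zeros has no quadratic term in its exponential factor. -/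
theorem IsMinimizerLLL.quadratic_coeff_eq_zero (hε : 0 < ε) (hf : IsMinimizerLLL β G ε f)
    (hf2 : f ∈ FockS ε 2) {P : Polynomial ℂ} (hP : P ≠ 0) {a b : ℂ}
    (hfP : ∀ z, f z = P.eval z * Complex.exp (a * z ^ 2 + b * z)) : a = 0 := by
  by_contra ha0
  have ha : 2 * ‖a‖ < ε⁻¹ := by
    refine two_mul_norm_lt_of_mem_fockS hε hP (b := b) ?_
    rwa [← funext hfP]
  have hEL := hf.euler_lagrange_kernel hε hf2 hfP ha
  set κ := ε⁻¹ with hκ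
  set μ := potentialEnergy β ε f + G * quarticEnergy ε f
  have hκ0 : 0 < κ := inv_pos.2 hε
  have hκc : (κ : ℂ) ≠ 0 := by exact_mod_cast hκ0.ne'
  have hk : ‖a‖ < κ := by linarith [norm_nonneg a]
  have hk1 : ‖a‖ + ‖(0 : ℂ)‖ < κ := by rw [norm_zero, add_zero]; exact hk
  have hk2 : ‖2 * a‖ + ‖conj a‖ < 2 * κ := by
    rw [norm_mul, RCLike.norm_conj, Complex.norm_ofNat]
    linarith [norm_nonneg a]
  set L : Polynomial ℂ := Polynomial.C (2 * a) * Polynomial.X + Polynomial.C b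
  set T : Polynomial ℂ → Polynomial ℂ := fun R => Polynomial.derivative R + R * L with hT
  have hTdeg : ∀ R, R ≠ 0 → (T R).natDegree = R.natDegree + 1 :=
    fun R hR => natDegree_twisted_derivative ha0 b hR
  have hTg : ∀ R S t, gaussInt a 0 b κ R (Polynomial.X * S) t
      = (κ : ℂ)⁻¹ * gaussInt a 0 b κ (T R) S t := by
    intro R S t
    rw [(gaussInt_ibp (s := b) hk1 R S t).1, inv_mul_cancel_left₀ hκc]
  -- The linear part of the equation with every `w̄` replaced by `T / κ`; the reproducing property
  -- then evaluates it at `t / κ`.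
  set p : Polynomial ℂ := Polynomial.C (-(β : ℂ) * (κ : ℂ)⁻¹) * T (Polynomial.X * P)
    + Polynomial.C (1 / 4 * ((κ : ℂ)⁻¹) ^ 2) * T (T (Polynomial.X ^ 2 * P))
    + Polynomial.C (-(μ : ℂ)) * P with hp
  have hlin : ∀ t, -(β : ℂ) * gaussInt a 0 b κ (Polynomial.X * P) Polynomial.X t
      + 1 / 4 * gaussInt a 0 b κ (Polynomial.X ^ 2 * P) (Polynomial.X ^ 2) t
      - (μ : ℂ) * gaussInt a 0 b κ P 1 t = p.eval (t / κ) * gaussInt a 0 b κ 1 1 t := by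
    intro t
    rw [← gaussInt_reproducing hk, hp, gaussInt_add_left hk1, gaussInt_add_left hk1,
      gaussInt_C_mul_left, gaussInt_C_mul_left, gaussInt_C_mul_left, sq Polynomial.X,
      show (Polynomial.X : Polynomial ℂ) * Polynomial.X
        = Polynomial.X * (Polynomial.X * 1) by rw [mul_one], hTg, hTg]
    have := hTg (Polynomial.X * P) 1 t
    rw [mul_one] at this
    rw [this, mul_one]
    ring
  obtain ⟨q, hq⟩ := exists_gaussInt_eq (s := 2 * b) hk2 (P ^ 2) (P.map (starRingEnd ℂ))
  set D := ((2 * κ : ℝ) : ℂ) ^ 2 - 4 * (2 * a * conj a) with hD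
  have hD0 : D ≠ 0 := gauss_discriminant_ne_zero hk2
  set J₁ := gaussInt a 0 b κ 1 1 0
  set J₂ := gaussInt (2 * a) (conj a) (2 * b) ((2 * κ : ℝ) : ℂ) 1 1 0
  have hJ₁ : J₁ ≠ 0 := gaussInt_one_one_zero_ne_zero hk
  have hrel : ∀ t, (Polynomial.C J₁ * p.comp (Polynomial.C (κ : ℂ)⁻¹ * Polynomial.X)).eval t
      * Complex.exp (a / κ ^ 2 * t ^ 2 + b / κ * t + 0)
      + (Polynomial.C (G * J₂) * q.comp (Polynomial.X + Polynomial.C (conj b))).eval t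
      * Complex.exp (2 * a / D * t ^ 2 + (2 * (2 * a) * conj b + 2 * b * (2 * κ)) / D * t
        + (2 * a * conj b ^ 2 + 2 * b * (2 * κ) * conj b) / D) = 0 := by
    intro t
    have h1 := hEL t
    rw [hlin, hq, gaussInt_one_one hk1, gaussInt_one_one hk2] at h1
    refine Eq.trans ?_ h1
    have e1 : (a * t ^ 2 + b * κ * t) / (κ ^ 2 - 4 * (a * 0))
        = a / κ ^ 2 * t ^ 2 + b / κ * t + 0 := by
      rw [mul_zero, mul_zero, sub_zero]; field_simp; ring
    have e2 : (2 * a * (t + conj b) ^ 2 + 2 * b * ((2 * κ : ℝ) : ℂ) * (t + conj b)) / D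
        = 2 * a / D * t ^ 2 + (2 * (2 * a) * conj b + 2 * b * (2 * κ)) / D * t
        + (2 * a * conj b ^ 2 + 2 * b * (2 * κ) * conj b) / D := by
      push_cast; field_simp; ring
    rw [e1, e2]
    simp only [Polynomial.eval_mul, Polynomial.eval_C, Polynomial.eval_comp, Polynomial.eval_X,
      Polynomial.eval_add]
    rw [div_eq_inv_mul t]
    ring
  -- Equality would mean `4κ² - 8|a|² = 2κ²`, that is `2|a| = κ`, which the strict bound on `a`
  -- excludes.
  have hne : a / (κ : ℂ) ^ 2 ≠ 2 * a / D := by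
    intro heq
    rw [div_eq_div_iff (pow_ne_zero 2 hκc) hD0] at heq
    have h2 : D = 2 * κ ^ 2 := by
      apply mul_left_cancel₀ ha0; rw [heq]; ring
    have h3 : a * conj a = ((‖a‖ ^ 2 : ℝ) : ℂ) := by
      rw [Complex.mul_conj, Complex.normSq_eq_norm_sq]
    have h4 : (((2 * κ) ^ 2 - 8 * ‖a‖ ^ 2 : ℝ) : ℂ) = ((2 * κ ^ 2 : ℝ) : ℂ) := by
      rw [hD, mul_assoc 2 a, h3] at h2
      push_cast at h2 ⊢
      rw [← h2]; ring
    have h5 : (2 * κ) ^ 2 - 8 * ‖a‖ ^ 2 = 2 * κ ^ 2 := by exact_mod_cast h4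
    nlinarith [norm_nonneg a]
  have hzero := eq_zero_of_exp_quadratic_relation hne hrel
  have hp0 : p = 0 := by
    have h1 := (mul_eq_zero.1 hzero).resolve_left (by simpa using hJ₁)
    refine Polynomial.funext fun t => ?_
    have := congrArg (Polynomial.eval (κ * t)) h1
    simpa [Polynomial.eval_comp, inv_mul_cancel_left₀ hκc] using this
  have hXP : Polynomial.X * P ≠ 0 := mul_ne_zero Polynomial.X_ne_zero hP
  have hX2P : Polynomial.X ^ 2 * P ≠ 0 := mul_ne_zero (pow_ne_zero 2 Polynomial.X_ne_zero) hP
  have hd1 : (T (Polynomial.X * P)).natDegree = P.natDegree + 2 := by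
    rw [hTdeg _ hXP, Polynomial.natDegree_X_mul hP]
  have hd2' : (T (Polynomial.X ^ 2 * P)).natDegree = P.natDegree + 3 := by
    rw [hTdeg _ hX2P, Polynomial.natDegree_X_pow_mul _ hP]
  have hd2 : (T (T (Polynomial.X ^ 2 * P))).natDegree = P.natDegree + 4 := by
    rw [hTdeg, hd2']
    intro h0
    rw [h0] at hd2'
    simp at hd2'
  -- Only the `|w|⁴` term reaches degree `deg P + 4`: two from `X ^ 2` and one from each `T`.
  have hcoef := congrArg (fun r => Polynomial.coeff r (P.natDegree + 4)) hp0
  simp only [hp, Polynomial.coeff_add, Polynomial.coeff_C_mul, Polynomial.coeff_zero] at hcoef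
  rw [Polynomial.coeff_eq_zero_of_natDegree_lt (by omega : (T (Polynomial.X * P)).natDegree < _),
    Polynomial.coeff_eq_zero_of_natDegree_lt (by omega : P.natDegree < _), mul_zero, mul_zero,
    zero_add, add_zero, ← hd2] at hcoef
  have hlead := (mul_eq_zero.1 hcoef).resolve_left (by simp [hκc])
  rw [← Polynomial.leadingCoeff, Polynomial.leadingCoeff_eq_zero] at hlead
  rw [hlead] at hd2
  simp at hd2

/-- The Euler-Lagrange equation for a polynomial, after a magnetic translation by `c`, tested
on the monomial of degree `n`. -/
def PolynomialEulerLagrange (β G μ κ : ℝ) (c : ℂ) (Q : Polynomial ℂ) (n : ℕ) : Prop :=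
  -(β : ℂ) * polyInner κ ((Polynomial.X + Polynomial.C c) * Q)
      (Polynomial.X ^ n * (Polynomial.X + Polynomial.C c))
    + 1 / 4 * polyInner κ ((Polynomial.X + Polynomial.C c) ^ 2 * Q)
      (Polynomial.X ^ n * (Polynomial.X + Polynomial.C c) ^ 2)
    - (μ : ℂ) * polyInner κ Q (Polynomial.X ^ n * 1)
    + G * polyInner (2 * κ) (Q ^ 2) (Polynomial.X ^ n * Q) = 0

/-- Completing the square at `c = ε b̄` gives `|exp(b(v+c))|² exp(-|v+c|²/ε) = exp(ε|b|²)
exp(-|v|²/ε)`, so the linear exponent is only a shift of the centre. -/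
theorem IsMinimizerLLL.exists_translated_polynomial (hε : 0 < ε) (hf : IsMinimizerLLL β G ε f)
    (hf2 : f ∈ FockS ε 2) {P : Polynomial ℂ} (hP : P ≠ 0) {b : ℂ}
    (hfP : ∀ z, f z = P.eval z * Complex.exp (b * z)) :
    ∃ (c : ℂ) (Q : Polynomial ℂ), Q ≠ 0 ∧
      (∀ v, ‖f (v + c)‖ ^ 2 * Real.exp (-‖v + c‖ ^ 2 / ε)
        = ‖Q.eval v‖ ^ 2 * Real.exp (-‖v‖ ^ 2 / ε)) ∧
      ∀ n, PolynomialEulerLagrange β G (potentialEnergy β ε f + G * quarticEnergy ε f) ε⁻¹ c Q n := by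
  set κ := ε⁻¹ with hκ
  set μ := potentialEnergy β ε f + G * quarticEnergy ε f
  have hκ0 : 0 < κ := inv_pos.2 hε
  have hκε : (κ : ℂ) * ε = 1 := by
    rw [hκ]; push_cast
    exact inv_mul_cancel₀ (by exact_mod_cast hε.ne')
  set c : ℂ := ε * conj b with hc
  set m : ℝ := Real.exp (ε * ‖b‖ ^ 2 / 2) with hm
  have hm0 : 0 < m := Real.exp_pos _
  have hmc : (m : ℂ) ≠ 0 := by exact_mod_cast hm0.ne'
  set Q : Polynomial ℂ := Polynomial.C (m : ℂ) * P.comp (Polynomial.X + Polynomial.C c) with hQ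
  have hQe : ∀ v, Q.eval v = m * P.eval (v + c) := fun v => by
    simp [hQ, Polynomial.eval_comp]
  have hQ0 : Q ≠ 0 := by
    intro h
    apply hP
    refine Polynomial.funext fun z => ?_
    have h1 := congrArg (Polynomial.eval (z - c)) h
    rw [hQe, sub_add_cancel, Polynomial.eval_zero] at h1
    rw [Polynomial.eval_zero]
    exact (mul_eq_zero.1 h1).resolve_left hmc
  have hW : ∀ w : ℂ, ((Real.exp (-‖w‖ ^ 2 / ε) : ℝ) : ℂ) = Complex.exp (-(κ * (w * conj w))) := by
    intro w
    rw [exp_neg_norm_sq_div, ← hκ, Complex.mul_conj, Complex.normSq_eq_norm_sq, Complex.ofReal_exp]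
    congr 1; push_cast; ring
  have hmm : (m : ℂ) * m = Complex.exp (ε * (b * conj b)) := by
    rw [hm, Complex.mul_conj, Complex.normSq_eq_norm_sq, Complex.ofReal_exp, ← Complex.exp_add]
    congr 1; push_cast; ring
  have hgauge : ∀ v : ℂ, Complex.exp (b * (v + c)) * conj (Complex.exp (b * (v + c))) *
      ((Real.exp (-‖v + c‖ ^ 2 / ε) : ℝ) : ℂ)
      = m * m * ((Real.exp (-‖v‖ ^ 2 / ε) : ℝ) : ℂ) := by
    intro v
    rw [hW, hW, hmm, ← Complex.exp_conj, ← Complex.exp_add, ← Complex.exp_add, ← Complex.exp_add]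
    congr 1
    simp only [hc, map_mul, map_add, Complex.conj_conj, Complex.conj_ofReal]
    linear_combination (-(v * b) - conj v * conj b - ε * (b * conj b)) * hκε
  have hn : ∀ w : ℂ, ((‖w‖ ^ 2 : ℝ) : ℂ) = w * conj w := fun w => by
    rw [Complex.mul_conj, Complex.normSq_eq_norm_sq]
  have hdens : ∀ v, ‖f (v + c)‖ ^ 2 * Real.exp (-‖v + c‖ ^ 2 / ε)
        = ‖Q.eval v‖ ^ 2 * Real.exp (-‖v‖ ^ 2 / ε) := by
    intro v
    have : ((‖f (v + c)‖ ^ 2 * Real.exp (-‖v + c‖ ^ 2 / ε) : ℝ) : ℂ)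
        = ((‖Q.eval v‖ ^ 2 * Real.exp (-‖v‖ ^ 2 / ε) : ℝ) : ℂ) := by
      rw [Complex.ofReal_mul, Complex.ofReal_mul, hn, hn, hfP, hQe, map_mul, map_mul,
        Complex.conj_ofReal]
      linear_combination (P.eval (v + c) * conj (P.eval (v + c))) * hgauge v
    exact_mod_cast this
  refine ⟨c, Q, hQ0, hdens, fun n => ?_⟩
  -- This test function carries the same exponential as `f`, so after translation the exponentials
  -- cancel and `v ^ n` remains.
  have hh := exp_linear_mem_fockS_two hε ((Polynomial.X - Polynomial.C c) ^ n) b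
  have hEL := hf.euler_lagrange hε hf2 hh
  rw [← integral_add_right_eq_self _ c] at hEL
  have i1 := (integrable_polyInner hκ0 ((Polynomial.X + Polynomial.C c) * Q)
      (Polynomial.X ^ n * (Polynomial.X + Polynomial.C c))).const_mul (-(β : ℂ))
  have i2 := (integrable_polyInner hκ0 ((Polynomial.X + Polynomial.C c) ^ 2 * Q)
      (Polynomial.X ^ n * (Polynomial.X + Polynomial.C c) ^ 2)).const_mul (1 / 4 : ℂ)
  have i3 := (integrable_polyInner hκ0 Q (Polynomial.X ^ n * 1)).const_mul (μ : ℂ)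
  have i4 := (integrable_polyInner (by positivity : 0 < 2 * κ) (Q ^ 2)
    (Polynomial.X ^ n * Q)).const_mul (G : ℂ)
  unfold PolynomialEulerLagrange polyInner
  rw [← integral_const_mul, ← integral_const_mul, ← integral_const_mul, ← integral_const_mul,
    ← integral_add' i1 i2, ← integral_sub' (i1.add i2) i3, ← integral_add' ((i1.add i2).sub i3) i4]
  have hEL2 : (m : ℂ)⁻¹ * ∫ v : ℂ, ((-β * ‖v + c‖ ^ 2 + 1 / 4 * ‖v + c‖ ^ 4 - μ
      + G * (‖f (v + c)‖ ^ 2 * Real.exp (-‖v + c‖ ^ 2 / ε)) : ℝ) : ℂ) *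
        (f (v + c) * conj (((Polynomial.X - Polynomial.C c) ^ n).eval (v + c) *
          Complex.exp (b * (v + c)))) * ((Real.exp (-‖v + c‖ ^ 2 / ε) : ℝ) : ℂ) = 0 := by
    rw [hEL, mul_zero]
  rw [← integral_const_mul] at hEL2
  refine Eq.trans ?_ hEL2
  congr 1
  ext v
  have h3 : ((Real.exp (-(2 * κ) * ‖v‖ ^ 2) : ℝ) : ℂ)
      = ((Real.exp (-‖v‖ ^ 2 / ε) : ℝ) : ℂ) * ((Real.exp (-‖v‖ ^ 2 / ε) : ℝ) : ℂ) := by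
    rw [← Complex.ofReal_mul, exp_neg_norm_sq_div, ← Real.exp_add]
    congr 2; ring
  have h4 : ((‖v + c‖ ^ 4 : ℝ) : ℂ) = ((v + c) * conj (v + c)) ^ 2 := by
    rw [← hn]; push_cast; ring
  have hQm : P.eval (v + c) = (m : ℂ)⁻¹ * Q.eval v := by
    rw [hQe, inv_mul_cancel_left₀ hmc]
  have hg : (m : ℂ)⁻¹ * (m : ℂ)⁻¹ * (Complex.exp (b * (v + c)) * conj (Complex.exp (b * (v + c))) *
      ((Real.exp (-‖v + c‖ ^ 2 / ε) : ℝ) : ℂ)) = ((Real.exp (-‖v‖ ^ 2 / ε) : ℝ) : ℂ) := by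
    rw [hgauge]; field_simp
  rw [hdens, hfP]
  simp only [Pi.add_apply, Pi.sub_apply]
  have h5 : Real.exp (-κ * ‖v‖ ^ 2) = Real.exp (-‖v‖ ^ 2 / ε) := by rw [exp_neg_norm_sq_div]
  rw [h3, h5]
  simp only [Polynomial.eval_mul, Polynomial.eval_pow, Polynomial.eval_add, Polynomial.eval_sub,
    Polynomial.eval_X, Polynomial.eval_C, Polynomial.eval_one, add_sub_cancel_right, map_mul,
    map_pow, map_one]
  have hV : ∀ r s t u : ℝ, ((-β * r + 1 / 4 * s - μ + G * (t * u) : ℝ) : ℂ)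
      = -β * (r : ℂ) + 1 / 4 * (s : ℂ) - μ + G * ((t : ℂ) * (u : ℂ)) := by
    intros; push_cast; ring
  rw [hV, hn, hn, h4, hQm, map_add]
  linear_combination (-(Q.eval v * conj v ^ n * (-β * ((v + c) * (conj v + conj c))
    + 1 / 4 * ((v + c) * (conj v + conj c)) ^ 2 - μ
    + G * (Q.eval v * conj (Q.eval v) * ((Real.exp (-‖v‖ ^ 2 / ε) : ℝ) : ℂ))))) * hg

end Translation

/-! ### Extreme coefficients of the polynomial Euler-Lagrange equation. -/

section LeadingCoefficients

open Polynomial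

variable {β G μ κ : ℝ} {c : ℂ} {Q : ℂ[X]}

theorem polyInner_X_pow_mul_eq_zero (hκ : 0 < κ) {R : ℂ[X]} (T : ℂ[X]) {d : ℕ}
    (h : R.natDegree < d) : polyInner κ R (X ^ d * T) = 0 := by
  rw [polyInner_X_pow_mul hκ T h.le, coeff_eq_zero_of_natDegree_lt h, zero_mul, zero_mul]

theorem polyInner_X_pow_mul_left {κ : ℝ} (hκ : 0 < κ) {S : ℂ[X]} (T : ℂ[X]) {d : ℕ}
    (h : S.natDegree ≤ d) :
    polyInner κ (X ^ d * T) S = conj (S.coeff d) * T.coeff 0 * gaussMoment κ d := by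
  rw [← polyInner_conj_symm, polyInner_X_pow_mul hκ T h]
  simp

theorem exists_eq_X_pow_mul (hQ : Q ≠ 0) :
    ∃ T : ℂ[X], Q = X ^ Q.natTrailingDegree * T ∧ T.coeff 0 ≠ 0 := by
  obtain ⟨T, hT⟩ := X_pow_dvd_iff.2 fun d (hd : d < Q.natTrailingDegree) =>
    coeff_eq_zero_of_lt_natTrailingDegree hd
  refine ⟨T, hT, ?_⟩
  have h1 : Q.coeff Q.natTrailingDegree ≠ 0 := by
    have := trailingCoeff_nonzero_iff_nonzero.2 hQ
    rwa [trailingCoeff] at this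
  generalize Q.natTrailingDegree = j at hT h1
  rw [hT] at h1
  simpa [coeff_X_pow_mul'] using h1

theorem natDegree_X_add_C_mul (c : ℂ) (k : ℕ) (hQ : Q ≠ 0) :
    ((X + C c) ^ k * Q).natDegree = k + Q.natDegree := by
  rw [((monic_X_add_C c).pow k).natDegree_mul' hQ, natDegree_pow, natDegree_X_add_C, mul_one]

/-- Powers of `κ` cancel, leaving `16 (j+1)(j+2)(j+3)(j+4)` against `(2j+1)(2j+2)(2j+3)(2j+4)`; the
first is strictly larger. -/
theorem gaussMoment_ne {κ : ℝ} (hκ : 0 < κ) (j : ℕ) :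
    gaussMoment κ (j + 4) * gaussMoment (2 * κ) (2 * j)
      ≠ gaussMoment κ j * gaussMoment (2 * κ) (2 * j + 4) := by
  have h2 : 0 < 2 * κ := by positivity
  rw [gaussMoment_succ hκ (j + 3), gaussMoment_succ hκ (j + 2), gaussMoment_succ hκ (j + 1),
    gaussMoment_succ hκ j, gaussMoment_succ h2 (2 * j + 3), gaussMoment_succ h2 (2 * j + 2),
    gaussMoment_succ h2 (2 * j + 1), gaussMoment_succ h2 (2 * j)]
  have ha := gaussMoment_pos hκ j
  have hb := gaussMoment_pos h2 (2 * j)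
  set a := gaussMoment κ j
  set b := gaussMoment (2 * κ) (2 * j)
  intro h
  field_simp at h
  push_cast at h
  have hj : (0 : ℝ) ≤ j := Nat.cast_nonneg j
  set x := (j : ℝ)
  have h5 : 16 * ((x + 1) * (x + 2) * (x + 3) * (x + 4))
      - (2 * x + 1) * (2 * x + 2) * (2 * x + 3) * (2 * x + 4) = 0 := by
    linarith
  have h6 : (x + 1) * (x + 2) * (20 * x + 45) = 0 := by nlinarith
  have : 0 < (x + 1) * (x + 2) * (20 * x + 45) := by positivity
  linarith

/-- Let `j ≤ N` be the lowest and highest degrees in `Q`. The cubic term reaches degree `2N - j`,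
the linear terms only `N` if `c = 0` and `N + 2` otherwise. So `N = j` in the first case. In the
second `N = j + 2`, and the equations at the top and bottom degrees are incompatible when `j ≥ 2`.
-/
theorem PolynomialEulerLagrange.monomial_or_natDegree_le (hκ : 0 < κ) (hG : G ≠ 0) (hQ : Q ≠ 0)
    (h : ∀ n, PolynomialEulerLagrange β G μ κ c Q n) :
    (c = 0 ∧ ∃ N a, Q = monomial N a) ∨ Q.natDegree ≤ 3 := by
  obtain ⟨T, hT, hT0⟩ := exists_eq_X_pow_mul hQ
  set j := Q.natTrailingDegree with hj
  set N := Q.natDegree with hN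
  have hκ2 : 0 < 2 * κ := by positivity
  have hGc : (G : ℂ) ≠ 0 := by exact_mod_cast hG
  have hjN : j ≤ N := natTrailingDegree_le_natDegree Q
  have hqN : Q.coeff N ≠ 0 := by
    have := leadingCoeff_ne_zero.2 hQ
    rwa [leadingCoeff] at this
  have hd1 : ((X + C c) * Q).natDegree = 1 + N := by
    simpa using natDegree_X_add_C_mul c 1 hQ
  have hd2 : ((X + C c) ^ 2 * Q).natDegree = 2 + N := natDegree_X_add_C_mul c 2 hQ
  have hdQ2 : (Q ^ 2).natDegree = 2 * N := natDegree_pow Q 2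
  have hcQ2 : (Q ^ 2).coeff (2 * N) = Q.coeff N ^ 2 := by
    have := leadingCoeff_pow Q 2
    rwa [leadingCoeff, leadingCoeff, hdQ2] at this
  have hXT : ∀ n, X ^ n * Q = X ^ (n + j) * T := fun n => by
    conv_lhs => rw [hT]
    rw [pow_add, mul_assoc]
  have hm : ∀ n, ((gaussMoment κ n : ℝ) : ℂ) ≠ 0 := fun n => by
    exact_mod_cast (gaussMoment_pos hκ n).ne'
  have hm2 : ∀ n, ((gaussMoment (2 * κ) n : ℝ) : ℂ) ≠ 0 := fun n => by
    exact_mod_cast (gaussMoment_pos hκ2 n).ne'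
  have hnon : ∀ n, n + j = 2 * N → (G : ℂ) * polyInner (2 * κ) (Q ^ 2) (X ^ n * Q) ≠ 0 := by
    intro n hn
    rw [hXT, hn, polyInner_X_pow_mul hκ2 T hdQ2.le, hcQ2]
    exact mul_ne_zero hGc (mul_ne_zero (mul_ne_zero (pow_ne_zero 2 hqN)
      ((_root_.map_ne_zero _).2 hT0)) (hm2 _))
  have hz : ∀ (R T : ℂ[X]) (n : ℕ), R.natDegree < n → polyInner κ R (X ^ n * T) = 0 :=
    fun _ T _ hn => polyInner_X_pow_mul_eq_zero hκ T hn
  by_cases hc : c = 0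
  · left
    refine ⟨hc, N, Q.coeff N, ?_⟩
    have hjeq : j = N := by
      by_contra hne
      have hlt : j < N := lt_of_le_of_ne hjN hne
      -- Here `n + j = 2N`: the interaction term is nonzero and the linear terms vanish for reasons
      -- of degree.
      have h1 := h (2 * N - j)
      unfold PolynomialEulerLagrange at h1
      have e1 : X ^ (2 * N - j) * (X + C c) = X ^ (2 * N - j + 1) * 1 := by
        rw [hc, map_zero, add_zero, mul_one, pow_succ]
      have e2 : X ^ (2 * N - j) * (X + C c) ^ 2 = X ^ (2 * N - j + 2) * 1 := by
        rw [hc, map_zero, add_zero, mul_one, pow_add]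
      rw [e1, e2, hz ((X + C c) * Q) 1 (2 * N - j + 1) (by omega),
        hz ((X + C c) ^ 2 * Q) 1 (2 * N - j + 2) (by omega), hz Q 1 (2 * N - j) (by omega)] at h1
      apply hnon (2 * N - j) (by omega)
      linear_combination h1
    ext k
    rw [coeff_monomial]
    split_ifs with hk
    · rw [hk]
    · rcases lt_or_gt_of_ne hk with hk | hk
      · exact coeff_eq_zero_of_natDegree_lt hk
      · exact coeff_eq_zero_of_lt_natTrailingDegree (by omega)
  · right
    have hA : N ≤ j + 2 := by
      by_contra hlt
      have h1 := h (2 * N - j)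
      unfold PolynomialEulerLagrange at h1
      rw [hz ((X + C c) * Q) _ (2 * N - j) (by omega),
        hz ((X + C c) ^ 2 * Q) _ (2 * N - j) (by omega), hz Q _ (2 * N - j) (by omega)] at h1
      apply hnon (2 * N - j) (by omega)
      linear_combination h1
    have hlead2 : ((X + C c) ^ 2 * Q).coeff (N + 2) = Q.coeff N := by
      have h1 : ((X + C c) ^ 2 * Q).leadingCoeff = Q.leadingCoeff := by
        rw [leadingCoeff_mul, ((monic_X_add_C c).pow 2).leadingCoeff, one_mul]
      rwa [leadingCoeff, leadingCoeff, hd2, add_comm 2 N] at h1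
    have hc0 : ((X + C c) ^ 2).coeff 0 = c ^ 2 := by simp [coeff_zero_eq_eval_zero]
    -- The highest `n` reached by the linear terms; only the `c̄²` part of the quartic potential
    -- contributes.
    have hB := h (N + 2)
    unfold PolynomialEulerLagrange at hB
    rw [hz ((X + C c) * Q) _ (N + 2) (by omega),
      polyInner_X_pow_mul hκ ((X + C c) ^ 2) (by omega : ((X + C c) ^ 2 * Q).natDegree ≤ N + 2),
      hz Q _ (N + 2) (by omega), hlead2, hc0, hXT] at hB
    have hcc : conj (c ^ 2) ≠ 0 := (_root_.map_ne_zero _).2 (pow_ne_zero 2 hc)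
    have hNj : N = j + 2 := by
      by_contra hne
      rw [polyInner_X_pow_mul_eq_zero hκ2 _ (by omega : (Q ^ 2).natDegree < N + 2 + j)] at hB
      have : 1 / 4 * (Q.coeff N * conj (c ^ 2) * gaussMoment κ (N + 2) : ℂ) ≠ 0 :=
        mul_ne_zero (by norm_num) (mul_ne_zero (mul_ne_zero hqN hcc) (hm _))
      apply this
      linear_combination hB
    rw [show N + 2 + j = 2 * N by omega, polyInner_X_pow_mul hκ2 T hdQ2.le, hcQ2] at hB
    by_contra hN3
    -- The mirror image at the bottom degree. It requires `j ≥ 2`, which follows from `N > 3`.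
    have hC := h (j - 2)
    unfold PolynomialEulerLagrange at hC
    have e1 : (X + C c) * Q = X ^ j * ((X + C c) * T) := by
      conv_lhs => rw [hT]
      ring
    have e2 : (X + C c) ^ 2 * Q = X ^ j * ((X + C c) ^ 2 * T) := by
      conv_lhs => rw [hT]
      ring
    have e3 : Q ^ 2 = X ^ (2 * j) * T ^ 2 := by
      conv_lhs => rw [hT]
      ring
    have hX0 : (X : ℂ[X]) ^ (j - 2) ≠ 0 := pow_ne_zero _ X_ne_zero
    have f1 : (X ^ (j - 2) * (X + C c)).natDegree < j := by
      have := natDegree_X_add_C_mul c 1 hX0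
      rw [pow_one, natDegree_X_pow] at this
      rw [mul_comm, this]; omega
    have f2 : (X ^ (j - 2) * (X + C c) ^ 2).natDegree = j := by
      have := natDegree_X_add_C_mul c 2 hX0
      rw [natDegree_X_pow] at this
      rw [mul_comm, this]; omega
    have f2c : (X ^ (j - 2) * (X + C c) ^ 2).coeff j = 1 := by
      have h1 : (X ^ (j - 2) * (X + C c) ^ 2).leadingCoeff = 1 :=
        ((monic_X_pow _).mul ((monic_X_add_C c).pow 2)).leadingCoeff
      rwa [leadingCoeff, f2] at h1
    have f3 : ((X : ℂ[X]) ^ (j - 2) * 1).natDegree < j := by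
      rw [mul_one, natDegree_X_pow]; omega
    have f4 : (X ^ (j - 2) * Q).natDegree = 2 * j := by
      rw [natDegree_X_pow_mul _ hQ]; omega
    have f4c : (X ^ (j - 2) * Q).coeff (2 * j) = Q.coeff N := by
      rw [show 2 * j = N + (j - 2) by omega, coeff_X_pow_mul]
    rw [e1, polyInner_X_pow_mul_left hκ _ f1.le, coeff_eq_zero_of_natDegree_lt f1, e2,
      polyInner_X_pow_mul_left hκ _ f2.le, f2c, e3, polyInner_X_pow_mul_left hκ2 _ f4.le, f4c] at hC
    have e4 : polyInner κ Q (X ^ (j - 2) * 1) = 0 := by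
      conv_lhs => rw [hT]
      rw [polyInner_X_pow_mul_left hκ _ f3.le, coeff_eq_zero_of_natDegree_lt f3]
      simp
    have e5 : ((X + C c) ^ 2 * T).coeff 0 = c ^ 2 * T.coeff 0 := by
      rw [mul_coeff_zero, hc0]
    have e6 : (T ^ 2).coeff 0 = T.coeff 0 ^ 2 := by simp [coeff_zero_eq_eval_zero]
    rw [e4, e5, e6] at hC
    simp only [map_zero, map_one, zero_mul, mul_zero, zero_add, one_mul, sub_zero] at hB hC
    have hB' : 1 / 4 * (conj (c ^ 2) * gaussMoment κ (N + 2))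
        + G * (Q.coeff N * conj (T.coeff 0) * gaussMoment (2 * κ) (2 * N)) = 0 := by
      apply mul_left_cancel₀ hqN
      linear_combination hB
    have hB'' := congrArg conj hB'
    simp only [map_add, map_mul, map_zero, Complex.conj_conj, Complex.conj_ofReal, map_div₀,
      map_one, map_ofNat] at hB''
    have hC' : 1 / 4 * (c ^ 2 * gaussMoment κ j)
        + G * (conj (Q.coeff N) * T.coeff 0 * gaussMoment (2 * κ) (2 * j)) = 0 := by
      apply mul_left_cancel₀ hT0
      linear_combination hC
    apply gaussMoment_ne hκ j
    -- The conjugated top equation and the bottom one share the factor formed from the conjugate of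
    -- `Q.coeff N` and `T.coeff 0`. Eliminating it leaves an identity between moments.
    have hfin : (c ^ 2) * ((gaussMoment κ (j + 4) * gaussMoment (2 * κ) (2 * j) : ℝ) : ℂ)
        = (c ^ 2) * ((gaussMoment κ j * gaussMoment (2 * κ) (2 * j + 4) : ℝ) : ℂ) := by
      rw [show N + 2 = j + 4 by omega, show 2 * N = 2 * j + 4 by omega] at hB''
      push_cast
      linear_combination (4 * (gaussMoment (2 * κ) (2 * j) : ℂ)) * hB''
        - (4 * (gaussMoment (2 * κ) (2 * j + 4) : ℂ)) * hC'
    have := mul_left_cancel₀ (pow_ne_zero 2 hc) hfin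
    exact_mod_cast this

end LeadingCoefficients

/-! ### Low degrees, and the conclusion. -/

/-- Degree at most 3 makes the mean of `|z|²` at most `4ε`, so the mass sits on an area of order `ε`
and Cauchy-Schwarz bounds the squared density from below. -/
theorem quarticEnergy_lower_of_natDegree_le {ε : ℝ} (hε : 0 < ε) {Q : Polynomial ℂ}
    (hd : Q.natDegree ≤ 3) (hm : fockMass ε (fun z => Q.eval z) = 1) :
    (16 * Real.pi * ε)⁻¹ ≤ quarticEnergy ε (fun z => Q.eval z) := by
  have hκ := inv_pos.2 hε
  set p : ℂ → ℝ := fun z => ‖Q.eval z‖ ^ 2 * Real.exp (-‖z‖ ^ 2 / ε) with hp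
  have hQ2 := fockS_two_polynomial hε Q
  have ip : Integrable p := (fock_of_fockS_two hQ2).2
  have ipp : Integrable fun z => p z ^ 2 := integrable_quartic hε hQ2
  have hp1 : ∫ z, p z = 1 := hm
  have isp : Integrable fun z => ‖z‖ ^ 2 * p z := by
    have := (fock_of_fockS_two (fockS_two_polynomial hε (Polynomial.X * Q))).2
    refine this.congr (Filter.Eventually.of_forall fun z => ?_)
    simp only [hp, Polynomial.eval_mul, Polynomial.eval_X, norm_mul]
    ring
  have hs : ∫ z, ‖z‖ ^ 2 * p z ≤ 4 * ε := by
    have h1 := integral_norm_pow_mul_polynomial hκ Q 1 (Nat.lt_succ_of_le hd)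
    have h2 := fockMass_polynomial hε Q (Nat.lt_succ_of_le hd)
    rw [hm] at h2
    have e : ∀ z, (‖z‖ ^ 2) ^ 1 * ‖Q.eval z‖ ^ 2 * Real.exp (-ε⁻¹ * ‖z‖ ^ 2) = ‖z‖ ^ 2 * p z :=
      fun z => by simp only [hp, exp_neg_norm_sq_div]; ring
    simp only [e] at h1
    rw [h1]
    calc _ ≤ ∑ k ∈ Finset.range (3 + 1), ‖Q.coeff k‖ ^ 2 * gaussMoment ε⁻¹ k * (4 * ε) := by
          refine Finset.sum_le_sum fun k hk => ?_
          have hk' : (k : ℝ) + 1 ≤ 4 := by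
            have := Finset.mem_range.1 hk
            exact_mod_cast (by omega : k + 1 ≤ 4)
          have := gaussMoment_pos hκ k
          rw [add_comm 1 k, gaussMoment_succ hκ, div_inv_eq_mul, mul_assoc (‖_‖ ^ 2), mul_assoc]
          gcongr
      _ = _ := by rw [← Finset.sum_mul, ← h2, one_mul]
  set g : ℂ → ℝ := fun z => Real.exp (-(4 * ε)⁻¹ * ‖z‖ ^ 2) with hg
  have h4 : 0 < (4 * ε)⁻¹ := by positivity
  have ig : Integrable g := by
    have := integrable_norm_pow_mul_exp_neg 0 h4
    simpa only [pow_zero, one_mul] using this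
  have hg1 : ∫ z, g z = 4 * Real.pi * ε := by
    have := integral_norm_sq_pow_mul_exp_neg 0 h4
    simp only [pow_zero, one_mul, Nat.factorial_zero, Nat.cast_one, mul_one, zero_add, pow_one,
      div_inv_eq_mul] at this
    rw [hg, this]; ring
  -- The weight in Young's inequality, chosen so that the Gaussian contributes `1/4`, half of the
  -- lower bound `1/2` for the left side.
  set l := 8 * Real.pi * ε with hl
  have hl0 : 0 < l := by positivity
  have hpt : ∀ z, p z - (8 * ε)⁻¹ * (‖z‖ ^ 2 * p z) ≤ l / 2 * p z ^ 2 + (2 * l)⁻¹ * g z := by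
    intro z
    have hp0 : 0 ≤ p z := by positivity
    set e := Real.exp (-(8 * ε)⁻¹ * ‖z‖ ^ 2) with he
    have h1 : 1 - (8 * ε)⁻¹ * ‖z‖ ^ 2 ≤ e := by
      have := Real.add_one_le_exp (-(8 * ε)⁻¹ * ‖z‖ ^ 2)
      linarith
    have h2 : g z = e ^ 2 := by
      have h3 : (4 * ε)⁻¹ = 2 * (8 * ε)⁻¹ := by field_simp; norm_num
      simp only [hg, he]
      rw [← Real.exp_nat_mul, h3]; congr 1; push_cast; ring
    have h3 := mul_le_mul_of_nonneg_left h1 hp0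
    have h4 : 0 ≤ (l * p z - e) ^ 2 / (2 * l) := by positivity
    have h5 : (l * p z - e) ^ 2 / (2 * l) = l / 2 * p z ^ 2 + (2 * l)⁻¹ * e ^ 2 - p z * e := by
      field_simp; ring
    rw [h2]
    linarith
  have hI := integral_mono (ip.sub (isp.const_mul (8 * ε)⁻¹))
    ((ipp.const_mul (l / 2)).add (ig.const_mul (2 * l)⁻¹)) hpt
  rw [integral_sub' ip (isp.const_mul _), integral_add' (ipp.const_mul _) (ig.const_mul _),
    integral_const_mul, integral_const_mul, integral_const_mul, hp1, hg1] at hI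
  have h5 : (8 * ε)⁻¹ * ∫ z, ‖z‖ ^ 2 * p z ≤ 1 / 2 := by
    calc _ ≤ (8 * ε)⁻¹ * (4 * ε) := by gcongr
      _ = _ := by field_simp; norm_num
  have h6 : (2 * l)⁻¹ * (4 * Real.pi * ε) = 1 / 4 := by
    rw [hl]; field_simp; norm_num
  rw [h6] at hI
  change _ ≤ ∫ z, p z ^ 2
  rw [inv_le_iff_one_le_mul₀ (by positivity)]
  rw [hl] at hI
  linarith

theorem neg_sq_le_potentialEnergy {β ε : ℝ} {f : ℂ → ℂ} (hf : f ∈ FockS ε 2)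
    (hm : fockMass ε f = 1) : -β ^ 2 ≤ potentialEnergy β ε f := by
  have h := integral_mono ((fock_of_fockS_two hf).2.const_mul (-β ^ 2))
    (integrable_potential (β := β) hf) fun z => by
      have := neg_sq_le_potential β (‖z‖ ^ 2)
      rw [← pow_mul] at this
      exact mul_le_mul_of_nonneg_right this (by positivity)
  rw [integral_const_mul] at h
  rwa [show ∫ z : ℂ, ‖f z‖ ^ 2 * Real.exp (-‖z‖ ^ 2 / ε) = 1 from hm, mul_one] at h

theorem exists_ne_zero_of_fockMass_eq_one {ε : ℝ} {f : ℂ → ℂ} (hm : fockMass ε f = 1) :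
    ∃ z, f z ≠ 0 := by
  by_contra! h
  simp [fockMass, h] at hm

theorem exists_norm_le_exp {ε : ℝ} (hε : 0 < ε) {f : ℂ → ℂ} (hf : f ∈ FockS ε 2) :
    ∃ C, ∀ z, ‖f z‖ ≤ C * Real.exp (ε⁻¹ / 2 * ‖z‖ ^ 2) := by
  obtain ⟨C, hC, h⟩ := exists_density_le hε hf
  refine ⟨Real.sqrt C, fun z => ?_⟩
  refine abs_le_of_sq_le_sq' ?_ (by positivity) |>.2
  rw [mul_pow, Real.sq_sqrt hC, ← Real.exp_nat_mul]
  have h1 := h z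
  rw [exp_neg_norm_sq_div, neg_mul, Real.exp_neg, ← div_eq_mul_inv, div_le_iff₀ (Real.exp_pos _)]
    at h1
  convert h1 using 3
  push_cast; ring

theorem theorem2 (β G : ℝ) (hG : 0 < G) :
    ∃ ε₀ : ℝ, 0 < ε₀ ∧ ∀ ε : ℝ, 0 < ε → ε < ε₀ →
      ∀ f : ℂ → ℂ, IsMinimizerLLL β G ε f →
        {z : ℂ | f z = 0}.Infinite ∧
          ∀ p : Polynomial ℂ, f ≠ fun z => p.eval z := by
  set C := 2 * |β| + 2 + G with hC
  have hC0 : 0 ≤ C := by positivity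
  obtain ⟨ε₁, hε₁, hmono⟩ := exists_monomial_energy_lt β hG hC0
  -- The bounds serve, in turn, the trial function, the monomials, and degree at most 3, where the
  -- interaction energy is at least `G / (32πε)` and the potential at least `-β²`.
  refine ⟨min (min 1 ε₁) (G / (32 * Real.pi * (C + β ^ 2 + 1))), by positivity,
    fun ε hε hlt f hf => ?_⟩
  rw [lt_min_iff, lt_min_iff] at hlt
  obtain ⟨⟨hlt1, hlt2⟩, hlt3⟩ := hlt
  obtain ⟨g, hg, hg1, hgE⟩ := exists_trial hε hlt1 β hG
  have hf2 := hf.mem_fockS_two hε hg hg1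
  have hE := (hf.energy_le hε hg hg1).trans hgE
  have hm := hf.fockMass_eq_one
  have hne := exists_ne_zero_of_fockMass_eq_one hm
  have hinf : {z : ℂ | f z = 0}.Infinite := by
    intro hfin
    obtain ⟨K, hK⟩ := exists_norm_le_exp hε hf2
    obtain ⟨P, a, b, hP, hfP⟩ := exists_polynomial_mul_exp_quadratic hf2.1 hne
      hfin (by positivity : 0 < ε⁻¹ / 2) hK
    obtain rfl := hf.quadratic_coeff_eq_zero hε hf2 hP hfP
    simp only [zero_mul, zero_add] at hfP
    obtain ⟨c, Q, hQ, hdens, hEL⟩ := hf.exists_translated_polynomial hε hf2 hP hfP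
    have hmQ : fockMass ε (fun z => Q.eval z) = 1 := by
      rw [← hm, fockMass, fockMass, ← integral_add_right_eq_self
        (fun z => ‖f z‖ ^ 2 * Real.exp (-‖z‖ ^ 2 / ε)) c]
      simp only [hdens]
    have hqQ : quarticEnergy ε (fun z => Q.eval z) = quarticEnergy ε f := by
      rw [quarticEnergy, quarticEnergy, ← integral_add_right_eq_self
        (fun z => (‖f z‖ ^ 2 * Real.exp (-‖z‖ ^ 2 / ε)) ^ 2) c]
      simp only [hdens]
    rcases PolynomialEulerLagrange.monomial_or_natDegree_le (inv_pos.2 hε) hG.ne' hQ hEL with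
      ⟨rfl, N, q, rfl⟩ | hd
    · have h1 := hmono ε hε hlt2 N q hmQ
      rw [hqQ] at h1
      simp only [add_zero] at hdens
      simp only [potentialEnergy, ← hdens] at h1
      exact absurd hE (not_le.2 h1)
    · have h1 := quarticEnergy_lower_of_natDegree_le hε hd hmQ
      rw [hqQ] at h1
      have h2 := neg_sq_le_potentialEnergy (β := β) hf2 hm
      rw [lt_div_iff₀ (by positivity)] at hlt3
      have h3 : G / 2 * (16 * Real.pi * ε)⁻¹ ≤ C + β ^ 2 := by
        have := mul_le_mul_of_nonneg_left h1 (by positivity : 0 ≤ G / 2)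
        linarith
      rw [← div_eq_mul_inv, div_le_iff₀ (by positivity)] at h3
      have : 0 < Real.pi * ε := by positivity
      nlinarith
  refine ⟨hinf, ?_⟩
  rintro p rfl
  obtain ⟨z, hz⟩ := hne
  refine hinf (p.finite_setOfPred_isRoot ?_)
  rintro rfl
  simp at hz
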